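/- **Setting.** Agents $\mathcal A=\{1,\dots,N\}$ sit on a graph $\mathcal G$; $\mathcal N_a$ is the set of neighbours of $a$, and $|\mathcal N_a|\le r$ for all $a$, where $r\ge 1$. At each time $t\ge1$ agent $a$ draws a real sample $x_a^t$ from a law $D_a$ with mean $\mu_a$; all samples are independent. The laws have bounded fourth moment: $\mathbb E[(x_a-\mu_a)^2]\le\sigma^2$ and $\mathbb E[(x_a-\mu_a)^4]\le\kappa\sigma^4$ for all $a$, with $\sigma>0$. Let $\bar x_a^t=\frac1t\sum_{s=1}^t x_a^s$, $\mathcal C_a=\{a':\mu_{a'}=\mu_a\}$, $\Delta_a=\min_{a'\notin\mathcal C_a}|\mu_a-\mu_{a'}|$ ($=\infty$ if there is no such $a'$), and let $\mathcal{CC}_a$ be the connected component of $a$ in the subgraph of $\mathcal G$ induced by $\mathcal C_a$. Put $$\beta_\gamma(n)=\Big(\tfrac{2(\kappa+3)\sigma^4}{\gamma}\Big)^{1/4}\Big(\tfrac{1+\ln^2 n}{n}\Big)^{1/4},\qquad n^\star_\gamma(x)=\min\{n\ge1:\beta_\gamma(n)<x\}.$$ **Algorithm (C-ColME with parameters $\gamma$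 and $\alpha_t$).** Let $\mathcal C_a^0=\mathcal C_a^1=\mathcal N_a$ and, for $t\ge 2$, $\mathcal C_a^{t}=\{a'\in\mathcal C_a^{t-1}: |\bar x_a^{t}-\bar x_{a'}^{t-1}|\le\beta_\gamma(t)+\beta_\gamma(t-1)\}$. From arbitrary deterministic initial values $\hat\mu^0$, $\hat\mu^{t+1}=(1-\alpha_t)\bar x^{t+1}+\alpha_t W_t\hat\mu^t$ for $t\ge0$. Here $W_t$ is a (possibly random, otherwise arbitrary) nonnegative matrix with row sums $1$ and $(W_t)_{a,a'}=0$ if $a'\notin\mathcal C_a^t\cup\{a\}$. Moreover $W$ is a fixed symmetric nonnegative matrix with row sums $1$ such that, for $a\ne a'$, $W_{a,a'}>0$ iff $a'\in\mathcal C_a\cap\mathcal N_a$; for the component $c$ considered below, the rows of $W_t$ of the agents in $c$ are those of $W$ at every time $t$ at which $\mathcal C_{a}^t=\mathcal C_{a}\cap\mathcal N_{a}$ for all $a\in c$. **Component.** Let $c$ be one of the components $\mathcal{CC}_a$, $n_c=|c|$, such that at least one $D_a$, $a\in c$, is not a point mass. Let $\mathbf x$ be the vector of one sample of each agent of $c$,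 $\boldsymbol\mu$ its mean, $P=\frac1{n_c}\mathbf 1\mathbf 1^\top$, and $\lambda_2$ the second largest modulus of the eigenvalues (with multiplicity) of the block of $W$ indexed by $c$ ($\lambda_2=0$ if $n_c=1$). Run the algorithm with $\gamma=\frac{\delta}{4rn_c}$, let $\zeta_a^D=n^\star_\gamma(\Delta_a/4)+1$, and pick an agent $a$ uniformly at random in $c$, independently of the run. Let $g(x)=x\ln^2(ex)$. **Claim.** There is an absolute constant $C_0>0$ such that, for every such system and component $c$: 1. If $\alpha_t=\frac t{t+1}$, then $$\mathbb P\big(\forall t>\tau_a^C:\ |\hat\mu_a^t-\mu_a|<\varepsilon\big)\ge1-\delta,\qquad \tau_a^C=\max\Big\{\zeta_a^D,\ g\Big(C\,\frac{\mathbb E\|P\mathbf x-\boldsymbol\mu\|^4}{|\mathcal{CC}_a|\,\varepsilon^4\delta}\Big)\Big\},$$ both (i) with $C=C_0$, for all $\delta\in(0,1)$ and all $0<\varepsilon\le\varepsilon_0$, where $\varepsilon_0>0$ depends on the system (including $W$ and $\hat\mu^0$) and $c$, but not on $\delta$; and (ii) for all $\varepsilon>0$ and $\delta\in(0,1)$,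 with a constant $C>0$ that depends on the system and $c$, but not on $\varepsilon$, $\delta$ or the matrices $W_t$. 2. If $\alpha_t=\alpha$ is a constant in $(0,1)$, the same holds, both as in (i) and as in (ii) (with $\varepsilon_0$ and $C$ depending also on $\alpha$), with $$\tau_a^C=\max\Big\{\zeta_a^D,\ C\,\frac{\mathbb E\|\mathbf x-\boldsymbol\mu\|^4}{n_c\,\varepsilon^4\delta}\Big(\tfrac{(1-\alpha)^2}{(1-\alpha\lambda_2)^2}\Big(1+\tfrac1{\ln\frac1{\alpha\lambda_2}}\Big)^2+\tfrac1{n_c^2}\Big(1+\tfrac1{\ln\frac1\alpha}\Big)^2\Big)\Big\}$$ (where $1/\ln\frac1{\alpha\lambda_2}=0$ if $\lambda_2=0$). 3. With $\tilde n=\big\lceil\frac{2(\kappa+3)\sigma^4}{\delta\varepsilon^4}\big\rceil$, the averaging time in part 1 is $\tilde{\mathcal O}(\tilde n/|\mathcal{CC}_a|)$: for every $C>0$ there is $M>0$ depending only on $C$ such that, for all systems, all components $c$ (degenerate or not), all $\varepsilon>0$ and all $\delta\in(0,1)$, $$g\Big(C\,\frac{\mathbb E\|P\mathbf x-\boldsymbol\mu\|^4}{n_c\,\varepsilon^4\delta}\Big)\le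 M\,\frac{\tilde n}{n_c}\Big(1+\Big|\ln\frac{\tilde n}{n_c}\Big|\Big)^2 .$$ -/

import Mathlib

open MeasureTheory ProbabilityTheory

universe u

noncomputable section

namespace ColME

/-- The fixed data of the problem: `N` agents on a graph, agent `a` sampling from the law `D a`
on `ℝ` (with variance at most `σ²` and fourth central moment at most `κ σ⁴`), an upper bound `r`
on the neighbourhood sizes, the limit consensus matrix `W` and the initial estimates. -/
structure System (N : ℕ) where
  /-- the communication graph -/
  G : SimpleGraph (Fin N)
  /-- upper bound on the size of the neighbourhoods -/
  r : ℕ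
  one_le_r : 1 ≤ r
  degree_le : ∀ a, (G.neighborSet a).ncard ≤ r
  /-- the laws of the samples -/
  D : Fin N → Measure ℝ
  isProbabilityMeasure : ∀ a, IsProbabilityMeasure (D a)
  σ : ℝ
  κ : ℝ
  σ_pos : 0 < σ
  memLp : ∀ a, MemLp (fun x : ℝ => x) 4 (D a)
  variance_le : ∀ a, ∫ x, (x - ∫ y, y ∂(D a)) ^ 2 ∂(D a) ≤ σ ^ 2
  fourth_moment_le : ∀ a, ∫ x, (x - ∫ y, y ∂(D a)) ^ 4 ∂(D a) ≤ κ * σ ^ 4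
  /-- the consensus matrix used once the neighbours of the same class are identified -/
  W : Matrix (Fin N) (Fin N) ℝ
  W_symm : W.IsSymm
  W_nonneg : ∀ a b, 0 ≤ W a b
  W_row_sum : ∀ a, ∑ b, W a b = 1
  W_pos_iff : ∀ a b, a ≠ b →
    (0 < W a b ↔ G.Adj a b ∧ ∫ y, y ∂(D b) = ∫ y, y ∂(D a))
  /-- the estimates before the first sample -/
  init : Fin N → ℝ

namespace System

variable {N : ℕ} (S : System N)

/-- The true mean of agent `a`. -/
def mean (a : Fin N) : ℝ := ∫ y, y ∂(S.D a)

/-- The similarity class of `a`: the agents with the same true mean. -/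
def simClass (a : Fin N) : Set (Fin N) := {b | S.mean b = S.mean a}

/-- The edges of the graph that join agents of the same similarity class. -/
def classGraph : SimpleGraph (Fin N) where
  Adj a b := S.G.Adj a b ∧ S.mean a = S.mean b
  symm := ⟨fun _ _ h => ⟨h.1.symm, h.2.symm⟩⟩
  loopless := ⟨fun _ h => h.1.ne rfl⟩

/-- The components into which the graph splits when the edges between different classes are
removed; `S.comp a` is the one that contains `a`. -/
abbrev Component : Type := S.classGraph.ConnectedComponent

/-- The component of `a`. -/
def comp (a : Fin N) : S.Component := S.classGraph.connectedComponentMk a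

variable {S} in
open Classical in
/-- The set of agents of a component. -/
def members (c : S.Component) : Finset (Fin N) := {a | S.comp a = c}

variable {S} in
/-- The number of agents of a component. -/
def size (c : S.Component) : ℕ := (members c).card

variable {S} in
/-- Some agent of the component has a law that is not a point mass. -/
def Nondegenerate (c : S.Component) : Prop :=
  ∃ a ∈ members c, 0 < ∫ x, (x - S.mean a) ^ 2 ∂(S.D a)

/-! ### Confidence intervals and the identification time -/

/-- Half-width of the confidence interval after `n ≥ 1` samples, at level `1 - 2γ`. -/
def beta (γ : ℝ) (n : ℕ) : ℝ :=
  (2 * ((S.κ + 3) * S.σ ^ 4) / γ) ^ ((1 : ℝ) / 4) *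
    ((1 + Real.log n ^ 2) / n) ^ ((1 : ℝ) / 4)

/-- The smallest number `n ≥ 1` of samples with `β_γ(n) < x`. -/
def nStar (γ : ℝ) (x : ENNReal) : ℕ :=
  sInf {n : ℕ | 1 ≤ n ∧ ENNReal.ofReal (S.beta γ n) < x}

/-- Distance of the mean of `a` to the closest different mean (`∞` if there is none). -/
def gap (a : Fin N) : ENNReal :=
  ⨅ b : Fin N, ⨅ _ : b ∉ S.simClass a, ENNReal.ofReal |S.mean a - S.mean b|

variable {S} in
/-- The confidence parameter `γ = δ / (4 r n_c)`. -/
def level (c : S.Component) (δ : ℝ) : ℝ := δ / (4 * S.r * size c)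

/-- The identification time `ζ_a`. -/
def zeta (a : Fin N) (δ : ℝ) : ℕ := S.nStar (level (S.comp a) δ) (S.gap a / 4) + 1

/-! ### Moments and spectrum of a component -/

variable {S} in
/-- Joint law of one sample of each agent of the component. -/
def sampleLaw (c : S.Component) : Measure (members c → ℝ) :=
  Measure.pi fun a : members c => S.D a

variable {S} in
/-- The averaging matrix `P = (1 / n_c) 1 1ᵀ` of the component. -/
def avgMatrix (c : S.Component) : Matrix (members c) (members c) ℝ :=
  Matrix.of fun _ _ => 1 / (size c : ℝ)

variable {S} in
/-- `E ‖P x - μ‖⁴`, with the Euclidean norm. -/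
def avgMoment (c : S.Component) : ℝ :=
  ∫ x, ‖WithLp.toLp 2 ((avgMatrix c).mulVec x - fun a : members c => S.mean a)‖ ^ 4 ∂(sampleLaw c)

variable {S} in
/-- `E ‖x - μ‖⁴`, with the Euclidean norm. -/
def fullMoment (c : S.Component) : ℝ :=
  ∫ x, ‖WithLp.toLp 2 (x - fun a : members c => S.mean a)‖ ^ 4 ∂(sampleLaw c)

variable {S} in
/-- The second largest modulus of the eigenvalues (with multiplicity) of the block of `W` that
belongs to the component; `0` if the component is a single agent. -/
def lambda2 (c : S.Component) : ℝ :=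
  (((S.W.submatrix ((↑) : members c → Fin N) (↑)).charpoly.roots.map
    (fun x : ℝ => |x|)).sort (· ≥ ·)).getD 1 0

/-! ### The algorithm -/

/-- Average of the samples `1, …, t`. -/
def empMean {Ω : Type*} (X : Fin N → ℕ → Ω → ℝ) (t : ℕ) (ω : Ω) (a : Fin N) : ℝ :=
  (∑ s ∈ Finset.Icc 1 t, X a s ω) / t

/-- The set of neighbours that `a` deems at time `t` to be in its own class, given the empirical
averages `xbar`. At time `t + 1` agent `a` compares its own average of `t + 1` samples with the
average of `t` samples received from its neighbour; at time `1` nothing has been received (the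
confidence interval of an average of no samples is the whole line) and nobody is removed. -/
def pruned (γ : ℝ) (xbar : ℕ → Fin N → ℝ) : ℕ → Fin N → Set (Fin N)
  | 0, a => S.G.neighborSet a
  | t + 1, a => {b | b ∈ pruned γ xbar t a ∧
      (1 ≤ t → |xbar (t + 1) a - xbar t b| - S.beta γ (t + 1) - S.beta γ t ≤ 0)}

/-- The consensus estimates: `est (t + 1) = (1 - α t) xbar (t + 1) + α t W_t (est t)`. -/
def est (α : ℕ → ℝ) (xbar : ℕ → Fin N → ℝ) (Wt : ℕ → Matrix (Fin N) (Fin N) ℝ) :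
    ℕ → Fin N → ℝ
  | 0 => S.init
  | t + 1 => (1 - α t) • xbar (t + 1) + α t • (Wt t).mulVec (est α xbar Wt t)

/-- `X` are the samples (sample number `t ≥ 1` of agent `a` is `X a t`) and `Wt` are the random
weight matrices of a run of the algorithm with confidence parameter `γ`. The weights are arbitrary
averaging weights supported on the neighbours that are currently kept, except that they are those
of `W` on the component `c` whenever all agents of `c` keep exactly their neighbours of the same
class. -/
structure IsRun {N : ℕ} {S : System N} (c : S.Component) (γ : ℝ) {Ω : Type*} [MeasurableSpace Ω]
    (P : Measure Ω) (X : Fin N → ℕ → Ω → ℝ) (Wt : ℕ → Ω → Matrix (Fin N) (Fin N) ℝ) : Prop where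
  measurable_sample : ∀ a t, Measurable (X a t)
  law_sample : ∀ a t, P.map (X a t) = S.D a
  indep_sample : iIndepFun (fun p : Fin N × ℕ => X p.1 p.2) P
  measurable_weight : ∀ t a b, Measurable fun ω => Wt t ω a b
  weight_nonneg : ∀ t ω a b, 0 ≤ Wt t ω a b
  weight_row_sum : ∀ t ω a, ∑ b, Wt t ω a b = 1
  weight_support : ∀ t ω a b, a ≠ b →
    b ∉ S.pruned γ (fun s => empMean X s ω) t a → Wt t ω a b = 0
  weight_settled : ∀ t ω,
    (∀ a ∈ members c,
      S.pruned γ (fun s => empMean X s ω) t a = S.simClass a ∩ S.G.neighborSet a) →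
    ∀ a ∈ members c, ∀ b, Wt t ω a b = S.W a b

variable {S} in
/-- For every run with memory parameters `α` and `γ = δ / (4 r n_c)`, and an agent `a` picked
uniformly in `c` independently of the run: with probability at least `1 - δ`, the estimate of `a`
is `ε`-accurate at all times `t > τ a`. -/
def AccurateAfter (c : S.Component) (α : ℕ → ℝ) (ε δ : ℝ) (τ : Fin N → ℝ) : Prop :=
  ∀ (Ω : Type u) [MeasurableSpace Ω] (P : Measure Ω) [IsProbabilityMeasure P]
    (X : Fin N → ℕ → Ω → ℝ) (Wt : ℕ → Ω → Matrix (Fin N) (Fin N) ℝ),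
    IsRun c (level c δ) P X Wt →
    ENNReal.ofReal (1 - δ) ≤
      ((uniformOn (members c : Set (Fin N))).prod P)
        {p | ∀ t : ℕ, τ p.1 < t →
          |S.est α (fun s => empMean X s p.2) (fun s => Wt s p.2) t p.1 - S.mean p.1| < ε}

/-! ### The convergence times -/

/-- `g(x) = x ln²(e x)`. -/
def g (x : ℝ) : ℝ := x * Real.log (Real.exp 1 * x) ^ 2

variable {S} in
/-- Averaging time for the memory `α_t = t / (t + 1)`. -/
def avgTime (c : S.Component) (C ε δ : ℝ) : ℝ :=
  g (C * (avgMoment c / (size c * ε ^ 4 * δ)))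

/-- `τ_a` for the memory `α_t = t / (t + 1)`. -/
def tau (C ε δ : ℝ) (a : Fin N) : ℝ :=
  max (S.zeta a δ : ℝ) (avgTime (S.comp a) C ε δ)

/-- `τ_a` for a constant memory `α`. -/
def tauConst (α C ε δ : ℝ) (a : Fin N) : ℝ :=
  max (S.zeta a δ : ℝ)
    (C * (fullMoment (S.comp a) / (size (S.comp a) * ε ^ 4 * δ)) *
      ((1 - α) ^ 2 / (1 - α * lambda2 (S.comp a)) ^ 2 *
          (1 + 1 / Real.log (1 / (α * lambda2 (S.comp a)))) ^ 2 +
        1 / (size (S.comp a) : ℝ) ^ 2 * (1 + 1 / Real.log (1 / α)) ^ 2))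

/-- The number of samples `⌈2 (κ + 3) σ⁴ / (δ ε⁴)⌉`. -/
def nTilde (ε δ : ℝ) : ℕ := ⌈2 * (S.κ + 3) * S.σ ^ 4 / (δ * ε ^ 4)⌉₊

end System

end ColME

end

/-!
The error of an estimate at time `t` has three sources: decisions on neighbours that are not yet
right, the mean deviation of the averages of the component, and the deviations from this mean,
which the consensus matrix damps. With probability at least `1 - 4 δ / 5` the path of all averages is regular
(`RegularPath`): they stay in their confidence intervals at all times, which follows from Markov's
inequality for the fourth moment and the convergence of `∑ 1 / (n (1 + log² n))`. On a regular path
the neighbourhoods settle once the widths are below a quarter of the gap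
(`pruned_eq_of_beta_lt_gap`), and from then on the errors of the component evolve by the block of
`W` alone (`est_sub_succ`). This block is symmetric and, the component being connected, fixes only
the constant vectors.

For the memory `t / (t + 1)`, `t` times the error follows `u (s + 1) = A u s + y (s + 1)`, where `y`
are the deviations. Its distance to the sum of the means of `y` stays bounded up to the sum of the
increments of `y`, by means of the resolvent of `A` on the vectors of sum zero
(`abs_sub_sum_average_le`); the eigenvalue `-1`, which `A` may have, does no harm. The increments
sum to order `√t`, so after division by `t` only the time average of the mean deviations matters for
small `ε`. Its fourth moment is of order `avgMoment / (n_c t²)`, and summing over `t` beyond the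
averaging time gives a small multiple of `δ` (`IsRun.measure_sum_avgDev_le`). The decisions settle
before time `ε g(x)`, because the squared logarithm in `g` dominates the one in the confidence width
(`one_add_log_sq_div_le`).

For a constant memory the recursion is unrolled over the second half of the time interval. The mean
deviations give the term with `1 / n_c²`. The residual deviations are bounded in norm, with weights
`(1 - α) (α λ₂)^(t - s)` of sum at most `(1 - α) / (1 - α λ₂)`, and the sum over the agents of the
bad probabilities is bounded by the fourth moment of this norm. Here the widths must be controlled
already from half of the identification time on. They are at most `2^(1/4)` times too large there,
which is made up for by averages that are already within an eighth of the gap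
(`RegularPath.pruned_eq_of_dev_le`).

The bounds for every `ε` with a constant that depends on the system follow from the ones for small
`ε`, by rescaling, and from the ones for `ε` beyond the spread of all means and initial values
(`accurateAfter_large`), where the decisions are irrelevant. The order of the averaging time holds
since `E ‖P x - μ‖⁴ ≤ (κ + 3) σ⁴` (`avgTime_le`).
-/

namespace ColME

/-! ### Elementary sums and inequalities -/

theorem antitoneOn_one_add_log_sq_div :
    AntitoneOn (fun x : ℝ => (1 + Real.log x ^ 2) / x) (Set.Ici 1) := by
  have hd : ∀ x ∈ Set.Ici (1 : ℝ), HasDerivAt (fun x : ℝ => (1 + Real.log x ^ 2) / x)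
      (-(Real.log x - 1) ^ 2 / x ^ 2) x := by
    intro x hx
    have hx0 : x ≠ 0 := by have : (1 : ℝ) ≤ x := hx; positivity
    have h := (((Real.hasDerivAt_log hx0).pow 2).const_add 1).div (hasDerivAt_id x) hx0
    refine h.congr_deriv ?_
    simp only [id, Pi.pow_apply]
    field_simp
    push_cast
    ring
  apply antitoneOn_of_deriv_nonpos (convex_Ici 1)
  · exact fun x hx => (hd x hx).continuousAt.continuousWithinAt
  · intro x hx
    rw [interior_Ici] at hx
    exact (hd x (Set.mem_Ici.2 (le_of_lt hx))).differentiableAt.differentiableWithinAt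
  · intro x hx
    rw [interior_Ici] at hx
    rw [(hd x (Set.mem_Ici.2 (le_of_lt hx))).deriv]
    rw [neg_div]
    have : 0 ≤ (Real.log x - 1) ^ 2 / x ^ 2 := by positivity
    linarith

/-- The function `1 / (x (1 + log² x))` is the derivative of `arctan (log x)`, so that the
confidence series telescopes. -/
theorem inv_mul_one_add_log_sq_le_arctan_sub {x : ℝ} (hx : 1 ≤ x) :
    1 / ((x + 1) * (1 + Real.log (x + 1) ^ 2)) ≤
      Real.arctan (Real.log (x + 1)) - Real.arctan (Real.log x) := by
  have hd : ∀ u : ℝ, 1 ≤ u → HasDerivAt (fun u => Real.arctan (Real.log u))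
      (1 / (u * (1 + Real.log u ^ 2))) u := by
    intro u hu
    have hu0 : u ≠ 0 := by positivity
    have h := (Real.hasDerivAt_arctan (Real.log u)).comp u (Real.hasDerivAt_log hu0)
    refine h.congr_deriv ?_
    rw [one_div, one_div, mul_inv, mul_comm]
  obtain ⟨u, hu, hu'⟩ := exists_hasDerivAt_eq_slope (fun u => Real.arctan (Real.log u))
    (fun u => 1 / (u * (1 + Real.log u ^ 2))) (by linarith : x < x + 1)
    (fun u hu => (hd u (hx.trans hu.1)).continuousAt.continuousWithinAt)
    (fun u hu => hd u (hx.trans hu.1.le))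
  rw [add_sub_cancel_left, div_one] at hu'
  rw [← hu']
  have h1 : 1 ≤ u := hx.trans hu.1.le
  have hl : 0 ≤ Real.log u := Real.log_nonneg h1
  have hl' : Real.log u ≤ Real.log (x + 1) := Real.log_le_log (by linarith) hu.2.le
  apply one_div_le_one_div_of_le (by positivity)
  have := hu.2.le
  gcongr

theorem sum_inv_mul_one_add_log_sq_le (k : ℕ) :
    ∑ n ∈ Finset.range k, 1 / (((n : ℝ) + 1) * (1 + Real.log ((n : ℝ) + 1) ^ 2)) ≤ 3 := by
  have key : ∀ k : ℕ, ∑ n ∈ Finset.range (k + 1),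
      1 / (((n : ℝ) + 1) * (1 + Real.log ((n : ℝ) + 1) ^ 2)) ≤
        1 + Real.arctan (Real.log (k + 1)) := by
    intro k
    induction k with
    | zero => simp
    | succ k ih =>
      rw [Finset.sum_range_succ]
      have h := inv_mul_one_add_log_sq_le_arctan_sub (x := (k : ℝ) + 1)
        (by have : (0 : ℝ) ≤ k := k.cast_nonneg
            linarith)
      push_cast
      linarith
  have hpi : ∀ x : ℝ, 1 + Real.arctan x ≤ 3 := fun x => by
    have := Real.arctan_lt_pi_div_two x
    have := Real.pi_lt_d2
    linarith
  rcases k with _ | k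
  · simp
  · exact (key k).trans (hpi _)

/-- The tail of the series `∑ 1 / t²`; the condition `x ≤ max 1 T` covers cut-offs below `1`. -/
theorem sum_inv_sq_tail_le {T x : ℝ} (hx : 0 < x) (hxT : x ≤ max 1 T) (k : ℕ) :
    ∑ t ∈ Finset.range k, (if T < t then 1 / (t : ℝ) ^ 2 else 0) ≤ 2 / x := by
  have key : ∑ t ∈ Finset.range k, (if T < t then 1 / (t : ℝ) ^ 2 else 0) ≤
      max 0 (2 / x - 2 / k) := by
    induction k with
    | zero => simp
    | succ k ih =>
      rw [Finset.sum_range_succ]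
      rcases Nat.eq_zero_or_pos k with rfl | hk
      · simp
      have hk' : (1 : ℝ) ≤ k := by exact_mod_cast hk
      have hmono : (2 : ℝ) / ((k + 1 : ℕ) : ℝ) ≤ 2 / k := by
        push_cast
        gcongr
        linarith
      split_ifs with h
      · have hxk : x ≤ k := hxT.trans (max_le hk' h.le)
        have h2 : (2 : ℝ) / k ≤ 2 / x := by gcongr
        rw [max_eq_right (by linarith)] at ih
        refine le_max_of_le_right ?_
        have : 1 / (k : ℝ) ^ 2 ≤ 2 / k - 2 / ((k + 1 : ℕ) : ℝ) := by
          push_cast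
          rw [div_sub_div _ _ (by positivity) (by positivity),
            div_le_div_iff₀ (by positivity) (by positivity)]
          nlinarith
        linarith
      · rw [add_zero]
        exact ih.trans (max_le_max le_rfl (by linarith))
  refine key.trans (max_le (by positivity) ?_)
  have : (0 : ℝ) ≤ 2 / k := by positivity
  linarith

theorem sum_inv_sqrt_le (t : ℕ) :
    ∑ s ∈ Finset.Icc 1 t, 1 / √(s : ℝ) ≤ 2 * √(t : ℝ) := by
  induction t with
  | zero => simp
  | succ t ih =>
    rw [Finset.sum_Icc_succ_top (by omega)]
    have h1 : 0 ≤ √(t : ℝ) := Real.sqrt_nonneg _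
    have h2 : 0 < √((t + 1 : ℕ) : ℝ) := Real.sqrt_pos.2 (by positivity)
    have h3 : √(t : ℝ) ^ 2 = t := Real.sq_sqrt (by positivity)
    have h4 : √((t + 1 : ℕ) : ℝ) ^ 2 = t + 1 := by
      rw [Real.sq_sqrt (by positivity)]; push_cast; ring
    have : 1 / √((t + 1 : ℕ) : ℝ) ≤ 2 * √((t + 1 : ℕ) : ℝ) - 2 * √(t : ℝ) := by
      rw [div_le_iff₀ h2]
      nlinarith [sq_nonneg (√((t + 1 : ℕ) : ℝ) - √(t : ℝ))]
    linarith

/-- If `b` grows backwards in time at most like `√(t / s)`, its average over `1, …, t` is at most twice its last value. -/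
theorem sum_le_of_le_mul_sqrt_div {b : ℕ → ℝ} {t : ℕ} (hb0 : 0 ≤ b t)
    (hb : ∀ s, 1 ≤ s → s ≤ t → b s ≤ b t * √((t : ℝ) / s)) :
    ∑ s ∈ Finset.Icc 1 t, b s ≤ 2 * t * b t := by
  calc ∑ s ∈ Finset.Icc 1 t, b s
      ≤ ∑ s ∈ Finset.Icc 1 t, b t * √(t : ℝ) * (1 / √(s : ℝ)) := by
        refine Finset.sum_le_sum fun s hs => ?_
        rw [Finset.mem_Icc] at hs
        refine (hb s hs.1 hs.2).trans (le_of_eq ?_)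
        rw [Real.sqrt_div (by positivity)]
        ring
    _ = b t * √(t : ℝ) * ∑ s ∈ Finset.Icc 1 t, 1 / √(s : ℝ) := by rw [Finset.mul_sum]
    _ ≤ b t * √(t : ℝ) * (2 * √(t : ℝ)) := by
        gcongr
        exact sum_inv_sqrt_le t
    _ = 2 * t * b t := by
        have : √(t : ℝ) * √(t : ℝ) = t := Real.mul_self_sqrt (by positivity)
        linear_combination 2 * b t * this

theorem sum_geometric_weights_le {θ : ℝ} (h0 : 0 ≤ θ) (h1 : θ < 1) (m t : ℕ) :
    ∑ s ∈ Finset.Ioc m t, θ ^ (t - s) ≤ 1 / (1 - θ) := by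
  rcases le_total t m with h | h
  · rw [Finset.Ioc_eq_empty (by omega)]
    simp only [Finset.sum_empty]
    have : 0 < 1 - θ := by linarith
    positivity
  have key : (1 - θ) * ∑ s ∈ Finset.Ioc m t, θ ^ (t - s) ≤ 1 := by
    induction t, h using Nat.le_induction with
    | base => simp
    | succ t hmt ih =>
      rw [← Finset.insert_Ioc_right_eq_Ioc_add_one (by omega), Finset.sum_insert (by simp)]
      have h2 : ∑ s ∈ Finset.Ioc m t, θ ^ (t + 1 - s) = θ * ∑ s ∈ Finset.Ioc m t, θ ^ (t - s) := by
        rw [Finset.mul_sum]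
        refine Finset.sum_congr rfl fun s hs => ?_
        rw [Finset.mem_Ioc] at hs
        rw [show t + 1 - s = t - s + 1 by omega, pow_succ]
        ring
      rw [h2]
      simp only [Nat.sub_self, pow_zero]
      nlinarith
  rw [le_div_iff₀ (by linarith)]
  linarith

theorem eventually_mul_pow_lt (K : ℝ) {y : ℝ} (hy : 0 < y) {k : ℕ} (hk : k ≠ 0) :
    ∀ᶠ ε in nhdsWithin (0 : ℝ) (Set.Ioi 0), K * ε ^ k < y := by
  have h : Filter.Tendsto (fun ε : ℝ => K * ε ^ k) (nhds 0) (nhds 0) := by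
    have : Continuous fun ε : ℝ => K * ε ^ k := by fun_prop
    simpa [hk] using this.tendsto 0
  exact (h.eventually (gt_mem_nhds hy)).filter_mono nhdsWithin_le_nhds

theorem exists_forall_le_of_eventually {p : ℝ → Prop}
    (h : ∀ᶠ ε in nhdsWithin (0 : ℝ) (Set.Ioi 0), p ε) :
    ∃ ε₀ : ℝ, 0 < ε₀ ∧ ∀ ε, 0 < ε → ε ≤ ε₀ → p ε := by
  obtain ⟨u, hu, hsub⟩ := mem_nhdsGT_iff_exists_Ioc_subset.1 h
  exact ⟨u, hu, fun ε h0 h1 => hsub ⟨h0, h1⟩⟩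

theorem sqrt_sqrt_pow_four {δ : ℝ} (hδ : 0 ≤ δ) : √√δ ^ 4 = δ := by
  rw [show √√δ ^ 4 = (√√δ ^ 2) ^ 2 by ring, Real.sq_sqrt (Real.sqrt_nonneg _), Real.sq_sqrt hδ]

/-! ### Fourth moments -/

section Moments

variable {Ω : Type*} [MeasurableSpace Ω] {P : Measure Ω}

theorem integrable_pow_of_memLp_four [IsProbabilityMeasure P] {f : Ω → ℝ} (hf : MemLp f 4 P)
    {k : ℕ} (hk : k ≤ 4) :
    Integrable (fun ω => f ω ^ k) P := by
  have h : MemLp f (k : ENNReal) P := hf.mono_exponent (by exact_mod_cast hk)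
  have h2 : Integrable (fun ω => ‖f ω‖ ^ k) P := h.integrable_norm_pow'
  refine h2.mono (hf.1.pow k) (Filter.Eventually.of_forall fun ω => ?_)
  simp

theorem memLp_four_iff_integrable_pow {f : Ω → ℝ} (hf : Measurable f) :
    MemLp f 4 P ↔ Integrable (fun ω => f ω ^ 4) P := by
  rw [← integrable_norm_rpow_iff hf.aestronglyMeasurable (by norm_num) (by norm_num)]
  refine integrable_congr (Filter.Eventually.of_forall fun ω => ?_)
  have : ((4 : ENNReal).toReal) = ((4 : ℕ) : ℝ) := by norm_num
  rw [this]
  simp only [Real.rpow_natCast, Real.norm_eq_abs]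
  exact Even.pow_abs (by decide) _

/-- Second and fourth moments of a sum of independent centred variables. Expanding the fourth
power, the terms in which some variable occurs exactly once vanish. -/
theorem moments_sum [IsProbabilityMeasure P] {ι : Type*} {Z : ι → Ω → ℝ}
    (hi : iIndepFun Z P) (hm : ∀ i, Measurable (Z i))
    (h4 : ∀ i, MemLp (Z i) 4 P) (h0 : ∀ i, ∫ ω, Z i ω ∂P = 0) (s : Finset ι) :
    ∫ ω, (∑ i ∈ s, Z i ω) ^ 2 ∂P = ∑ i ∈ s, ∫ ω, Z i ω ^ 2 ∂P ∧
    ∫ ω, (∑ i ∈ s, Z i ω) ^ 4 ∂P ≤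
      ∑ i ∈ s, ∫ ω, Z i ω ^ 4 ∂P + 3 * (∑ i ∈ s, ∫ ω, Z i ω ^ 2 ∂P) ^ 2 ∧
    ∑ i ∈ s, ∫ ω, Z i ω ^ 4 ∂P ≤ ∫ ω, (∑ i ∈ s, Z i ω) ^ 4 ∂P := by
  classical
  induction s using Finset.induction_on with
  | empty => simp
  | insert a s ha ih =>
    obtain ⟨ih2, ih4, ih4'⟩ := ih
    set S : Ω → ℝ := fun ω => ∑ i ∈ s, Z i ω with hS
    have hSm : Measurable S := Finset.measurable_fun_sum _ fun i _ => hm i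
    have hS4 : MemLp S 4 P := memLp_finsetSum _ fun i _ => h4 i
    have hind : IndepFun S (Z a) P := by
      have := hi.indepFun_finsetSum_of_notMem hm ha
      convert this using 1
      ext ω
      simp [hS]
    have hS0 : ∫ ω, S ω ∂P = 0 := by
      rw [hS, integral_finsetSum _ fun i _ => (h4 i).integrable (by norm_num)]
      exact Finset.sum_eq_zero fun i _ => h0 i
    have hpow : ∀ j k : ℕ, j ≤ 4 → k ≤ 4 →
        Integrable (fun ω => S ω ^ j * Z a ω ^ k) P ∧
        ∫ ω, S ω ^ j * Z a ω ^ k ∂P = (∫ ω, S ω ^ j ∂P) * ∫ ω, Z a ω ^ k ∂P := by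
      intro j k hj hk
      have hjk : IndepFun (fun ω => S ω ^ j) (fun ω => Z a ω ^ k) P :=
        hind.comp (φ := fun x : ℝ => x ^ j) (ψ := fun x : ℝ => x ^ k) (by fun_prop) (by fun_prop)
      refine ⟨hjk.integrable_mul (integrable_pow_of_memLp_four hS4 hj)
        (integrable_pow_of_memLp_four (h4 a) hk), ?_⟩
      exact hjk.integral_fun_mul_eq_mul_integral (hSm.pow_const _).aestronglyMeasurable
        ((hm a).pow_const _).aestronglyMeasurable
    have e2 : ∫ ω, (∑ i ∈ insert a s, Z i ω) ^ 2 ∂P =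
        ∫ ω, S ω ^ 2 ∂P + ∫ ω, Z a ω ^ 2 ∂P := by
      have : ∀ ω, (∑ i ∈ insert a s, Z i ω) ^ 2 =
          S ω ^ 2 + (2 * (S ω ^ 1 * Z a ω ^ 1) + Z a ω ^ 2) := by
        intro ω
        rw [Finset.sum_insert ha]
        simp only [hS]
        ring
      simp_rw [this]
      have i1 := (hpow 1 1 (by norm_num) (by norm_num)).1.const_mul 2
      have i2 := integrable_pow_of_memLp_four hS4 (k := 2) (by norm_num)
      have i3 := integrable_pow_of_memLp_four (h4 a) (k := 2) (by norm_num)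
      have j1 : Integrable (fun ω => 2 * (S ω ^ 1 * Z a ω ^ 1) + Z a ω ^ 2) P := i1.add i3
      rw [integral_add i2 j1, integral_add i1 i3, integral_const_mul,
        (hpow 1 1 (by norm_num) (by norm_num)).2]
      simp [hS0]
    have e4 : ∫ ω, (∑ i ∈ insert a s, Z i ω) ^ 4 ∂P =
        ∫ ω, S ω ^ 4 ∂P + 6 * ((∫ ω, S ω ^ 2 ∂P) * ∫ ω, Z a ω ^ 2 ∂P) + ∫ ω, Z a ω ^ 4 ∂P := by
      have : ∀ ω, (∑ i ∈ insert a s, Z i ω) ^ 4 =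
          S ω ^ 4 + (4 * (S ω ^ 3 * Z a ω ^ 1) + (6 * (S ω ^ 2 * Z a ω ^ 2) +
            (4 * (S ω ^ 1 * Z a ω ^ 3) + Z a ω ^ 4))) := by
        intro ω
        rw [Finset.sum_insert ha]
        simp only [hS]
        ring
      simp_rw [this]
      have i1 := (hpow 3 1 (by norm_num) (by norm_num)).1.const_mul 4
      have i2 := (hpow 2 2 (by norm_num) (by norm_num)).1.const_mul 6
      have i3 := (hpow 1 3 (by norm_num) (by norm_num)).1.const_mul 4
      have i4 := integrable_pow_of_memLp_four hS4 (k := 4) (by norm_num)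
      have i5 := integrable_pow_of_memLp_four (h4 a) (k := 4) (by norm_num)
      have j3 : Integrable (fun ω => 4 * (S ω ^ 1 * Z a ω ^ 3) + Z a ω ^ 4) P := i3.add i5
      have j2 : Integrable (fun ω => 6 * (S ω ^ 2 * Z a ω ^ 2) +
        (4 * (S ω ^ 1 * Z a ω ^ 3) + Z a ω ^ 4)) P := i2.add j3
      have j1 : Integrable (fun ω => 4 * (S ω ^ 3 * Z a ω ^ 1) + (6 * (S ω ^ 2 * Z a ω ^ 2) +
        (4 * (S ω ^ 1 * Z a ω ^ 3) + Z a ω ^ 4))) P := i1.add j2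
      rw [integral_add i4 j1, integral_add i1 j2, integral_add i2 j3, integral_add i3 i5,
        integral_const_mul, integral_const_mul,
        integral_const_mul, (hpow 3 1 (by norm_num) (by norm_num)).2,
        (hpow 2 2 (by norm_num) (by norm_num)).2, (hpow 1 3 (by norm_num) (by norm_num)).2]
      simp only [pow_one, hS0, h0 a]
      ring
    have p1 : 0 ≤ ∫ ω, Z a ω ^ 2 ∂P := integral_nonneg fun ω => sq_nonneg _
    have p2 : 0 ≤ ∑ i ∈ s, ∫ ω, Z i ω ^ 2 ∂P :=
      Finset.sum_nonneg fun i _ => integral_nonneg fun ω => sq_nonneg _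
    refine ⟨?_, ?_, ?_⟩
    · rw [e2, ih2, Finset.sum_insert ha, add_comm]
    · rw [e4, ih2, Finset.sum_insert ha, Finset.sum_insert ha]
      nlinarith [mul_nonneg p1 p2]
    · rw [e4, ih2, Finset.sum_insert ha]
      nlinarith [mul_nonneg p1 p2]

theorem sq_integral_le_integral_sq [IsProbabilityMeasure P] {f : Ω → ℝ} (hf : Integrable f P)
    (hf2 : Integrable (fun ω => f ω ^ 2) P) : (∫ ω, f ω ∂P) ^ 2 ≤ ∫ ω, f ω ^ 2 ∂P := by
  have h : 0 ≤ ∫ ω, (f ω - ∫ ω', f ω' ∂P) ^ 2 ∂P := integral_nonneg fun ω => sq_nonneg _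
  have e : ∀ ω, (f ω - ∫ ω', f ω' ∂P) ^ 2 =
      f ω ^ 2 - (2 * (∫ ω', f ω' ∂P) * f ω - (∫ ω', f ω' ∂P) ^ 2) := fun ω => by ring
  simp_rw [e] at h
  have j : Integrable (fun ω => 2 * (∫ ω', f ω' ∂P) * f ω - (∫ ω', f ω' ∂P) ^ 2) P :=
    (hf.const_mul _).sub (integrable_const _)
  rw [integral_sub hf2 j, integral_sub (hf.const_mul _) (integrable_const _),
    integral_const_mul] at h
  simp at h
  nlinarith

/-- Minkowski's inequality in `L⁴`, in terms of moments. -/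
theorem integral_pow_four_sum_le {ι : Type*} (s : Finset ι) {w b : ι → ℝ} {f : ι → Ω → ℝ}
    (hw : ∀ i ∈ s, 0 ≤ w i) (hb : ∀ i ∈ s, 0 < b i)
    (hi : ∀ i ∈ s, Integrable (fun ω => f i ω ^ 4) P)
    (hf : ∀ i ∈ s, ∫ ω, f i ω ^ 4 ∂P ≤ b i ^ 4) :
    ∫ ω, (∑ i ∈ s, w i * f i ω) ^ 4 ∂P ≤ (∑ i ∈ s, w i * b i) ^ 4 := by
  set Z := ∑ i ∈ s, w i * b i with hZ
  have hZ0 : 0 ≤ Z := Finset.sum_nonneg fun i h => mul_nonneg (hw i h) (hb i h).le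
  rcases hZ0.eq_or_lt with h0 | hpos
  · have hall : ∀ i ∈ s, w i = 0 := by
      intro i h
      have := (Finset.sum_eq_zero_iff_of_nonneg
        (fun i h => mul_nonneg (hw i h) (hb i h).le)).1 h0.symm i h
      exact (mul_eq_zero.1 this).resolve_right (hb i h).ne'
    have : ∀ ω, ∑ i ∈ s, w i * f i ω = 0 := fun ω =>
      Finset.sum_eq_zero fun i h => by rw [hall i h, zero_mul]
    simp only [this]
    simp
    positivity
  -- Jensen's inequality with the weights `w i * b i / Z`
  have hpt : ∀ ω, (∑ i ∈ s, w i * f i ω) ^ 4 ≤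
      Z ^ 4 * ∑ i ∈ s, (w i * b i / Z) * (1 / b i ^ 4 * f i ω ^ 4) := by
    intro ω
    have h := Real.pow_arith_mean_le_arith_mean_pow_of_even s (fun i => w i * b i / Z)
      (fun i => f i ω / b i)
      (fun i h => div_nonneg (mul_nonneg (hw i h) (hb i h).le) hpos.le)
      (by rw [← Finset.sum_div, ← hZ, div_self hpos.ne']) (n := 4) (by decide)
    have e1 : ∑ i ∈ s, w i * f i ω = Z * ∑ i ∈ s, w i * b i / Z * (f i ω / b i) := by
      rw [Finset.mul_sum]
      refine Finset.sum_congr rfl fun i hi => ?_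
      have := (hb i hi).ne'
      field_simp
    rw [e1, mul_pow]
    refine mul_le_mul_of_nonneg_left (h.trans (le_of_eq ?_)) (by positivity)
    refine Finset.sum_congr rfl fun i hi => ?_
    rw [div_pow]
    ring
  have hint : ∀ i ∈ s, Integrable (fun ω => (w i * b i / Z) * (1 / b i ^ 4 * f i ω ^ 4)) P :=
    fun i h => ((hi i h).const_mul _).const_mul _
  calc ∫ ω, (∑ i ∈ s, w i * f i ω) ^ 4 ∂P
      ≤ ∫ ω, Z ^ 4 * ∑ i ∈ s, (w i * b i / Z) * (1 / b i ^ 4 * f i ω ^ 4) ∂P := by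
        refine integral_mono_of_nonneg (Filter.Eventually.of_forall fun ω => ?_) ?_
          (Filter.Eventually.of_forall hpt)
        · exact Even.pow_nonneg (by decide) _
        · exact (integrable_finsetSum _ hint).const_mul _
    _ = Z ^ 4 * ∑ i ∈ s, (w i * b i / Z) * (1 / b i ^ 4 * ∫ ω, f i ω ^ 4 ∂P) := by
        rw [integral_const_mul, integral_finsetSum _ hint]
        simp_rw [integral_const_mul]
    _ ≤ Z ^ 4 * ∑ i ∈ s, w i * b i / Z := by
        refine mul_le_mul_of_nonneg_left (Finset.sum_le_sum fun i h => ?_) (by positivity)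
        refine mul_le_of_le_one_right (div_nonneg (mul_nonneg (hw i h) (hb i h).le) hpos.le) ?_
        rw [one_div, inv_mul_le_one₀ (pow_pos (hb i h) 4)]
        exact hf i h
    _ = Z ^ 4 := by rw [← Finset.sum_div, ← hZ, div_self hpos.ne', mul_one]

/-- Markov's inequality for the fourth moment and a union bound. -/
theorem measure_exists_le_of_moments [IsProbabilityMeasure P] {f : ℕ → Ω → ℝ} {I : ℕ → Prop}
    {u M q : ℕ → ℝ} {η : ℝ}
    (hi : ∀ t, I t → Integrable (fun ω => f t ω ^ 4) P) (hM : ∀ t, I t → ∫ ω, f t ω ^ 4 ∂P ≤ M t)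
    (hu : ∀ t, I t → 0 < u t) (hq0 : ∀ t, 0 ≤ q t) (hq : ∀ t, I t → M t / u t ^ 4 ≤ q t)
    (hη : ∀ k, ∑ t ∈ Finset.range k, q t ≤ η) :
    P {ω | ∃ t, I t ∧ u t ≤ |f t ω|} ≤ ENNReal.ofReal η := by
  classical
  have hsub : {ω | ∃ t, I t ∧ u t ≤ |f t ω|} ⊆ ⋃ t, {ω | I t ∧ u t ≤ |f t ω|} := by
    rintro ω ⟨t, h⟩
    exact Set.mem_iUnion.2 ⟨t, h⟩
  refine (measure_mono hsub).trans ((measure_iUnion_le _).trans ?_)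
  have hterm : ∀ t, P {ω | I t ∧ u t ≤ |f t ω|} ≤ ENNReal.ofReal (q t) := by
    intro t
    by_cases hI : I t
    · have hu4 : 0 < u t ^ 4 := pow_pos (hu t hI) 4
      have hmk := mul_meas_ge_le_integral_of_nonneg (μ := P) (f := fun ω => f t ω ^ 4)
        (Filter.Eventually.of_forall fun ω => Even.pow_nonneg (by decide) _) (hi t hI) (u t ^ 4)
      have hle : P.real {ω | u t ^ 4 ≤ f t ω ^ 4} ≤ q t := by
        refine le_trans ?_ (hq t hI)
        rw [le_div_iff₀ hu4, mul_comm]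
        exact hmk.trans (hM t hI)
      have hss : {ω | I t ∧ u t ≤ |f t ω|} ⊆ {ω | u t ^ 4 ≤ f t ω ^ 4} := by
        rintro ω ⟨-, h⟩
        have := pow_le_pow_left₀ (hu t hI).le h 4
        rwa [Even.pow_abs (by decide)] at this
      refine (measure_mono hss).trans ?_
      rw [← ENNReal.ofReal_toReal (measure_ne_top P {ω | u t ^ 4 ≤ f t ω ^ 4})]
      exact ENNReal.ofReal_le_ofReal hle
    · simp [hI]
  refine (ENNReal.tsum_le_tsum hterm).trans ?_
  rw [ENNReal.tsum_eq_iSup_nat]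
  refine iSup_le fun k => ?_
  rw [← ENNReal.ofReal_sum_of_nonneg fun t _ => hq0 t]
  exact ENNReal.ofReal_le_ofReal (hη k)

theorem measure_exists_finset_le {ι : Type*} (s : Finset ι) {B : ι → Set Ω} {η : ℝ}
    (h : ∀ i ∈ s, P (B i) ≤ ENNReal.ofReal η) :
    P {ω | ∃ i ∈ s, ω ∈ B i} ≤ ENNReal.ofReal (s.card * η) := by
  have hsub : {ω | ∃ i ∈ s, ω ∈ B i} ⊆ ⋃ i ∈ s, B i := by
    rintro ω ⟨i, hi, h⟩
    exact Set.mem_biUnion hi h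
  refine (measure_mono hsub).trans ((measure_biUnion_finset_le _ _).trans ?_)
  refine (Finset.sum_le_sum h).trans ?_
  rw [Finset.sum_const, nsmul_eq_mul, ENNReal.ofReal_mul (by positivity), ENNReal.ofReal_natCast]

end Moments

/-! ### Symmetric averaging matrices -/

section Matrices

variable {ι : Type*} [Fintype ι]

theorem abs_mulVec_le {A : Matrix ι ι ℝ} (h0 : ∀ a b, 0 ≤ A a b) (h1 : ∀ a, ∑ b, A a b = 1)
    {v : ι → ℝ} {M : ℝ} (hv : ∀ a, |v a| ≤ M) (a : ι) : |A.mulVec v a| ≤ M := by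
  calc |A.mulVec v a| ≤ ∑ b, |A a b * v b| := Finset.abs_sum_le_sum_abs _ _
    _ ≤ ∑ b, A a b * M := by
        refine Finset.sum_le_sum fun b _ => ?_
        rw [abs_mul, abs_of_nonneg (h0 a b)]
        exact mul_le_mul_of_nonneg_left (hv b) (h0 a b)
    _ = M := by rw [← Finset.sum_mul, h1, one_mul]

theorem sum_mulVec_eq {A : Matrix ι ι ℝ} (hs : A.IsSymm) (h1 : ∀ a, ∑ b, A a b = 1)
    (v : ι → ℝ) : ∑ a, A.mulVec v a = ∑ a, v a := by
  simp only [Matrix.mulVec, dotProduct]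
  rw [Finset.sum_comm]
  refine Finset.sum_congr rfl fun b _ => ?_
  rw [← Finset.sum_mul]
  have : ∑ a, A a b = 1 := by
    rw [← h1 b]
    exact Finset.sum_congr rfl fun a _ => hs.apply b a
  rw [this, one_mul]

/-- A fixed vector of a symmetric averaging matrix takes the same value at two indices joined by a
positive weight, because `∑ A a b (v a - v b)² = 0`. -/
theorem eq_of_mulVec_eq_self {A : Matrix ι ι ℝ} (hs : A.IsSymm) (h0 : ∀ a b, 0 ≤ A a b)
    (h1 : ∀ a, ∑ b, A a b = 1) {v : ι → ℝ} (hv : A.mulVec v = v) {a b : ι} (hab : 0 < A a b) :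
    v a = v b := by
  have e1 : ∑ a, ∑ b, A a b * v a ^ 2 = ∑ a, v a ^ 2 := by
    refine Finset.sum_congr rfl fun a _ => ?_
    rw [← Finset.sum_mul, h1, one_mul]
  have e2 : ∑ a, ∑ b, A a b * v b ^ 2 = ∑ a, v a ^ 2 := sum_mulVec_eq hs h1 fun b => v b ^ 2
  have e3 : ∑ a, ∑ b, A a b * (v a * v b) = ∑ a, v a ^ 2 := by
    refine Finset.sum_congr rfl fun a _ => ?_
    have : A.mulVec v a = v a := congrFun hv a
    calc ∑ b, A a b * (v a * v b) = v a * ∑ b, A a b * v b := by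
          rw [Finset.mul_sum]
          exact Finset.sum_congr rfl fun b _ => by ring
      _ = v a * v a := by
          congr 1
      _ = v a ^ 2 := by ring
  have h : ∑ a, ∑ b, A a b * (v a - v b) ^ 2 = 0 := by
    have : ∀ a b, A a b * (v a - v b) ^ 2 =
        A a b * v a ^ 2 + A a b * v b ^ 2 - 2 * (A a b * (v a * v b)) := fun a b => by ring
    simp_rw [this, Finset.sum_sub_distrib, Finset.sum_add_distrib, ← Finset.mul_sum]
    rw [e1, e2, e3]
    ring
  have hz := (Finset.sum_eq_zero_iff_of_nonneg fun a _ =>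
    Finset.sum_nonneg fun b _ => mul_nonneg (h0 a b) (sq_nonneg _)).1 h a (Finset.mem_univ _)
  have hz' := (Finset.sum_eq_zero_iff_of_nonneg fun b _ =>
    mul_nonneg (h0 a b) (sq_nonneg _)).1 hz b (Finset.mem_univ _)
  have := (mul_eq_zero.1 hz').resolve_left hab.ne'
  exact sub_eq_zero.1 (pow_eq_zero_iff (by norm_num) |>.1 this)

/-- The solution operator of `v - A v = y - mean y`: for an averaging matrix whose only fixed
vectors are constant, it is the inverse of `1 - A + (1 / n) 1 1ᵀ`. -/
theorem exists_resolvent [Nonempty ι] {A : Matrix ι ι ℝ} (hs : A.IsSymm)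
    (h1 : ∀ a, ∑ b, A a b = 1) (hfix : ∀ v : ι → ℝ, A.mulVec v = v → ∀ a b, v a = v b) :
    ∃ (Q : Matrix ι ι ℝ) (K : ℝ), 0 ≤ K ∧
      (∀ y a, Q.mulVec y a - A.mulVec (Q.mulVec y) a = y a - (∑ b, y b) / Fintype.card ι) ∧
      ∀ (y : ι → ℝ) (M : ℝ), (∀ a, |y a| ≤ M) → ∀ a, |Q.mulVec y a| ≤ K * M := by
  classical
  have hn : (Fintype.card ι : ℝ) ≠ 0 := by
    exact_mod_cast Fintype.card_ne_zero
  set J : Matrix ι ι ℝ := Matrix.of fun _ _ => 1 / (Fintype.card ι : ℝ) with hJ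
  have hJv : ∀ v a, J.mulVec v a = (∑ b, v b) / Fintype.card ι := by
    intro v a
    simp only [Matrix.mulVec, dotProduct, hJ, Matrix.of_apply]
    rw [← Finset.mul_sum]
    ring
  set B := 1 - A + J with hB
  have hBv : ∀ v a, B.mulVec v a = v a - A.mulVec v a + (∑ b, v b) / Fintype.card ι := by
    intro v a
    rw [hB, Matrix.add_mulVec, Matrix.sub_mulVec, Matrix.one_mulVec, Pi.add_apply, Pi.sub_apply,
      hJv]
  have hsum : ∀ v, ∑ a, B.mulVec v a = ∑ a, v a := by
    intro v
    simp_rw [hBv, Finset.sum_add_distrib, Finset.sum_sub_distrib, sum_mulVec_eq hs h1]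
    rw [Finset.sum_const, Finset.card_univ, nsmul_eq_mul]
    field_simp
    ring
  have hinj : Function.Injective B.mulVec := by
    intro v w hvw
    have h0 : B.mulVec (v - w) = 0 := by rw [Matrix.mulVec_sub, hvw, sub_self]
    have hs0 : ∑ a, (v - w) a = 0 := by rw [← hsum, h0]; simp
    have hf : A.mulVec (v - w) = v - w := by
      ext a
      have := hBv (v - w) a
      rw [h0, hs0] at this
      simp only [Pi.zero_apply, zero_div, add_zero] at this
      linarith
    have hc := hfix _ hf
    ext a
    have : (Fintype.card ι : ℝ) * (v - w) a = 0 := by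
      rw [← hs0, Finset.sum_congr rfl fun b _ => hc b a, Finset.sum_const, Finset.card_univ,
        nsmul_eq_mul]
    have := (mul_eq_zero.1 this).resolve_left hn
    rw [Pi.sub_apply] at this
    linarith
  have hu : IsUnit B := Matrix.mulVec_injective_iff_isUnit.1 hinj
  have hdet : IsUnit B.det := (Matrix.isUnit_iff_isUnit_det B).1 hu
  have hBQ : ∀ y, B.mulVec (B⁻¹.mulVec y) = y := fun y => by
    rw [Matrix.mulVec_mulVec, Matrix.mul_nonsing_inv B hdet, Matrix.one_mulVec]
  refine ⟨B⁻¹, ∑ a, ∑ b, |B⁻¹ a b|, ?_, ?_, ?_⟩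
  · exact Finset.sum_nonneg fun a _ => Finset.sum_nonneg fun b _ => abs_nonneg _
  · intro y a
    have e := hBv (B⁻¹.mulVec y) a
    have e' := hsum (B⁻¹.mulVec y)
    rw [hBQ] at e e'
    rw [← e'] at e
    linarith
  · intro y M hy a
    calc |B⁻¹.mulVec y a| ≤ ∑ b, |B⁻¹ a b * y b| := Finset.abs_sum_le_sum_abs _ _
      _ ≤ ∑ b, |B⁻¹ a b| * M := by
          refine Finset.sum_le_sum fun b _ => ?_
          rw [abs_mul]
          exact mul_le_mul_of_nonneg_left (hy b) (abs_nonneg _)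
      _ = (∑ b, |B⁻¹ a b|) * M := by rw [Finset.sum_mul]
      _ ≤ (∑ a, ∑ b, |B⁻¹ a b|) * M := by
          refine mul_le_mul_of_nonneg_right ?_ ((abs_nonneg _).trans (hy a))
          exact Finset.single_le_sum (f := fun a => ∑ b, |B⁻¹ a b|)
            (fun a _ => Finset.sum_nonneg fun b _ => abs_nonneg _) (Finset.mem_univ a)

section Spectrum

open Matrix

variable [DecidableEq ι]

theorem abs_eigenvalues_le_one {A : Matrix ι ι ℝ} (hA : A.IsHermitian) (h0 : ∀ a b, 0 ≤ A a b)
    (h1 : ∀ a, ∑ b, A a b = 1) (i : ι) : |hA.eigenvalues i| ≤ 1 := by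
  have : Nonempty ι := ⟨i⟩
  set v : ι → ℝ := (hA.eigenvectorBasis i).ofLp with hv
  have hAv : A.mulVec v = hA.eigenvalues i • v := hA.mulVec_eigenvectorBasis i
  obtain ⟨a, -, ha⟩ := Finset.exists_max_image Finset.univ (fun a => |v a|) Finset.univ_nonempty
  have hpos : 0 < |v a| := by
    by_contra hcon
    have hz : ∀ b, v b = 0 := fun b =>
      abs_eq_zero.1 (le_antisymm ((ha b (Finset.mem_univ b)).trans (not_lt.1 hcon)) (abs_nonneg _))
    have : hA.eigenvectorBasis i = 0 := by
      ext b
      exact hz b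
    exact hA.eigenvectorBasis.orthonormal.ne_zero i this
  have h := abs_mulVec_le h0 h1 (fun b => ha b (Finset.mem_univ b)) a
  rw [hAv, Pi.smul_apply, smul_eq_mul, abs_mul] at h
  exact le_of_mul_le_mul_right (by linarith) hpos

/-- The second largest modulus of the eigenvalues, with multiplicity. -/
noncomputable def secondModulus (A : Matrix ι ι ℝ) : ℝ :=
  ((A.charpoly.roots.map (fun x : ℝ => |x|)).sort (· ≥ ·)).getD 1 0

theorem roots_charpoly_eq_map_eigenvalues {A : Matrix ι ι ℝ} (hA : A.IsHermitian) :
    A.charpoly.roots.map (fun x : ℝ => |x|) =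
      Multiset.map (fun i => |hA.eigenvalues i|) Finset.univ.val := by
  rw [hA.roots_charpoly_eq_eigenvalues, Multiset.map_map]
  rfl

theorem secondModulus_mem_Icc {A : Matrix ι ι ℝ} (hA : A.IsHermitian) (h0 : ∀ a b, 0 ≤ A a b)
    (h1 : ∀ a, ∑ b, A a b = 1) : secondModulus A ∈ Set.Icc (0 : ℝ) 1 := by
  unfold secondModulus
  rw [roots_charpoly_eq_map_eigenvalues hA]
  set l := (Multiset.map (fun i => |hA.eigenvalues i|) Finset.univ.val).sort (· ≥ ·) with hl
  rcases lt_or_ge 1 l.length with h | h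
  · rw [List.getD_eq_getElem _ _ h]
    have hm : l[1] ∈ l := List.getElem_mem h
    generalize l[1] = x at hm ⊢
    rw [hl, Multiset.mem_sort, Multiset.mem_map] at hm
    obtain ⟨i, -, hi⟩ := hm
    rw [← hi]
    exact ⟨abs_nonneg _, abs_eigenvalues_le_one hA h0 h1 i⟩
  · rw [List.getD_eq_default _ _ h]
    simp

/-- The list of the moduli, in decreasing order, starts with a `1` that may be taken to be the one
of index `i₀`; all other moduli are at most the second entry. -/
theorem abs_eigenvalues_le_secondModulus {A : Matrix ι ι ℝ} (hA : A.IsHermitian)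
    (h0 : ∀ a b, 0 ≤ A a b) (h1 : ∀ a, ∑ b, A a b = 1) {i₀ i : ι}
    (hi₀ : hA.eigenvalues i₀ = 1) (hi : i ≠ i₀) : |hA.eigenvalues i| ≤ secondModulus A := by
  unfold secondModulus
  rw [roots_charpoly_eq_map_eigenvalues hA]
  have hsplit : Multiset.map (fun i => |hA.eigenvalues i|) (Finset.univ : Finset ι).val =
      1 ::ₘ Multiset.map (fun i => |hA.eigenvalues i|) (Finset.univ.erase i₀).val := by
    rw [← Finset.insert_erase (Finset.mem_univ i₀),
      Finset.insert_val_of_notMem (Finset.notMem_erase _ _), Multiset.map_cons, hi₀, abs_one]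
    simp
  rw [hsplit, Multiset.sort_cons]
  · set l := (Multiset.map (fun i => |hA.eigenvalues i|) (Finset.univ.erase i₀).val).sort (· ≥ ·)
      with hl
    have hmem : |hA.eigenvalues i| ∈ l := by
      rw [hl, Multiset.mem_sort, Multiset.mem_map]
      exact ⟨i, Finset.mem_erase.2 ⟨hi, Finset.mem_univ i⟩, rfl⟩
    have hp : l.Pairwise (· ≥ ·) := Multiset.pairwise_sort _ _
    rw [List.getD_cons_succ]
    rcases hl' : l with _ | ⟨x, l'⟩
    · rw [hl'] at hmem
      simp at hmem
    · rw [List.getD_cons_zero]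
      rw [hl'] at hmem hp
      rcases List.mem_cons.1 hmem with h | h
      · exact h.le
      · exact (List.pairwise_cons.1 hp).1 _ h
  · intro b hb
    rw [Multiset.mem_map] at hb
    obtain ⟨j, -, rfl⟩ := hb
    exact abs_eigenvalues_le_one hA h0 h1 j

/-- A symmetric averaging matrix whose only fixed vectors are constant contracts the vectors of
mean zero by its second eigenvalue modulus: the constants are spanned by one vector of an
eigenbasis, and the vectors of mean zero by the others. -/
theorem norm_mulVec_le_secondModulus {A : Matrix ι ι ℝ} (hs : A.IsSymm) (h0 : ∀ a b, 0 ≤ A a b)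
    (h1 : ∀ a, ∑ b, A a b = 1) (hfix : ∀ v : ι → ℝ, A.mulVec v = v → ∀ a b, v a = v b)
    {v : ι → ℝ} (hv : ∑ a, v a = 0) :
    ‖WithLp.toLp 2 (A.mulVec v)‖ ≤ secondModulus A * ‖WithLp.toLp 2 v‖ := by
  have hA : A.IsHermitian := by
    ext a b
    simpa using hs.apply a b
  rcases isEmpty_or_nonempty ι with hE | hE
  · have : (WithLp.toLp 2 (A.mulVec v)) = 0 := Subsingleton.elim _ _
    rw [this, norm_zero]
    exact mul_nonneg (secondModulus_mem_Icc hA h0 h1).1 (norm_nonneg _)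
  have hinner : ∀ (i : ι) (w : ι → ℝ), inner ℝ (hA.eigenvectorBasis i) (WithLp.toLp 2 w) =
      ∑ a, (hA.eigenvectorBasis i) a * w a := by
    intro i w
    rw [PiLp.inner_apply]
    exact Finset.sum_congr rfl fun a _ => by simp [mul_comm]
  have hcoef : ∀ (i : ι) (w : ι → ℝ),
      inner ℝ (hA.eigenvectorBasis i) (WithLp.toLp 2 (A.mulVec w)) =
        hA.eigenvalues i * inner ℝ (hA.eigenvectorBasis i) (WithLp.toLp 2 w) := by
    intro i w
    rw [hinner, hinner]
    have e1 : ∑ a, (hA.eigenvectorBasis i) a * A.mulVec w a =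
        ((hA.eigenvectorBasis i).ofLp) ⬝ᵥ A.mulVec w := rfl
    have e2 : ((hA.eigenvectorBasis i).ofLp) ᵥ* A =
        hA.eigenvalues i • (hA.eigenvectorBasis i).ofLp := by
      rw [← hA.mulVec_eigenvectorBasis i, ← Matrix.mulVec_transpose, hs.eq]
    rw [e1, Matrix.dotProduct_mulVec, e2, smul_dotProduct]
    rfl
  have hone : ∃ i₀,
      inner ℝ (hA.eigenvectorBasis i₀) (WithLp.toLp 2 (fun _ : ι => (1 : ℝ))) ≠ 0 := by
    by_contra! hcon
    have hn := hA.eigenvectorBasis.sum_sq_norm_inner_right (WithLp.toLp 2 (fun _ : ι => (1 : ℝ)))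
    simp only [hcon, norm_zero] at hn
    have : WithLp.toLp 2 (fun _ : ι => (1 : ℝ)) = 0 := by
      rw [← norm_eq_zero]
      have : ‖WithLp.toLp 2 (fun _ : ι => (1 : ℝ))‖ ^ 2 = 0 := by rw [← hn]; simp
      exact pow_eq_zero_iff (by norm_num) |>.1 this
    have h := congrArg (fun w : EuclideanSpace ℝ ι => w (Classical.arbitrary ι)) this
    simp at h
  obtain ⟨i₀, hi₀⟩ := hone
  have hA1 : A.mulVec (fun _ => (1 : ℝ)) = fun _ => 1 := by
    ext a
    simpa [Matrix.mulVec, dotProduct] using h1 a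
  have hev : hA.eigenvalues i₀ = 1 := by
    have h := hcoef i₀ (fun _ => 1)
    rw [hA1] at h
    exact (mul_right_cancel₀ hi₀ (by linarith : hA.eigenvalues i₀ * _ = 1 * _))
  have hconst := hfix (hA.eigenvectorBasis i₀).ofLp (by
    rw [hA.mulVec_eigenvectorBasis, hev, one_smul])
  have hz : inner ℝ (hA.eigenvectorBasis i₀) (WithLp.toLp 2 v) = 0 := by
    rw [hinner]
    calc ∑ a, (hA.eigenvectorBasis i₀) a * v a
        = ∑ a, (hA.eigenvectorBasis i₀) (Classical.arbitrary ι) * v a :=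
          Finset.sum_congr rfl fun a _ => by rw [hconst a (Classical.arbitrary ι)]
      _ = 0 := by rw [← Finset.mul_sum, hv, mul_zero]
  have hl := (secondModulus_mem_Icc hA h0 h1).1
  refine abs_le_of_sq_le_sq' ?_ (mul_nonneg hl (norm_nonneg _)) |>.2
  rw [mul_pow, ← hA.eigenvectorBasis.sum_sq_norm_inner_right (WithLp.toLp 2 (A.mulVec v)),
    ← hA.eigenvectorBasis.sum_sq_norm_inner_right (WithLp.toLp 2 v), Finset.mul_sum]
  refine Finset.sum_le_sum fun i _ => ?_
  rw [hcoef, norm_mul, mul_pow]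
  rcases eq_or_ne i i₀ with rfl | hi
  · rw [hz]; simp
  · have := abs_eigenvalues_le_secondModulus hA h0 h1 hev hi
    rw [Real.norm_eq_abs]
    gcongr

theorem norm_pow_mulVec_le_secondModulus {A : Matrix ι ι ℝ} (hs : A.IsSymm)
    (h0 : ∀ a b, 0 ≤ A a b) (h1 : ∀ a, ∑ b, A a b = 1)
    (hfix : ∀ v : ι → ℝ, A.mulVec v = v → ∀ a b, v a = v b)
    {v : ι → ℝ} (hv : ∑ a, v a = 0) (k : ℕ) :
    ‖WithLp.toLp 2 ((A ^ k).mulVec v)‖ ≤ secondModulus A ^ k * ‖WithLp.toLp 2 v‖ := by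
  have hA : A.IsHermitian := by
    ext a b
    simpa using hs.apply a b
  have hl := (secondModulus_mem_Icc hA h0 h1).1
  induction k generalizing v with
  | zero => simp
  | succ k ih =>
    rw [pow_succ, ← Matrix.mulVec_mulVec, pow_succ, mul_assoc]
    refine (ih (by rw [sum_mulVec_eq hs h1, hv])).trans ?_
    exact mul_le_mul_of_nonneg_left (norm_mulVec_le_secondModulus hs h0 h1 hfix hv) (by positivity)

end Spectrum

end Matrices

namespace System

variable {N : ℕ} {S : System N}

/-! ### Components and their consensus block -/

theorem mem_members {c : S.Component} {a : Fin N} : a ∈ members c ↔ S.comp a = c := by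
  simp [members]

theorem mean_eq_of_reachable {a b : Fin N} (h : S.classGraph.Reachable a b) :
    S.mean a = S.mean b := by
  obtain ⟨w⟩ := h
  induction w with
  | nil => rfl
  | cons hadj _ ih => exact hadj.2.trans ih

theorem reachable_of_mem {c : S.Component} {a b : Fin N} (ha : a ∈ members c)
    (hb : b ∈ members c) : S.classGraph.Reachable a b :=
  SimpleGraph.ConnectedComponent.exact ((mem_members.1 ha).trans (mem_members.1 hb).symm)

theorem mean_eq_of_mem {c : S.Component} {a b : Fin N} (ha : a ∈ members c)
    (hb : b ∈ members c) : S.mean a = S.mean b :=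
  mean_eq_of_reachable (reachable_of_mem ha hb)

theorem members_nonempty (c : S.Component) : (members c).Nonempty := by
  obtain ⟨a, ha⟩ := c.exists_rep
  exact ⟨a, mem_members.2 ha⟩

instance (c : S.Component) : Nonempty (members c) := (members_nonempty c).to_subtype

instance (a : Fin N) : IsProbabilityMeasure (S.D a) := S.isProbabilityMeasure a

theorem one_le_size (c : S.Component) : 1 ≤ size c := (members_nonempty c).card_pos

theorem card_members (c : S.Component) : Fintype.card (members c) = size c := Fintype.card_coe _

theorem kappa_nonneg (a : Fin N) : 0 ≤ S.κ := by
  have h : 0 ≤ S.κ * S.σ ^ 4 :=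
    le_trans (integral_nonneg fun x => Even.pow_nonneg (by decide) _) (S.fourth_moment_le a)
  exact nonneg_of_mul_nonneg_left h (pow_pos S.σ_pos 4)

theorem kappa_nonneg_of_component (c : S.Component) : 0 ≤ S.κ :=
  kappa_nonneg (members_nonempty c).choose

theorem simClass_eq_of_mem {c : S.Component} {a b : Fin N} (ha : a ∈ members c)
    (hb : b ∈ members c) : S.simClass a = S.simClass b := by
  simp only [simClass, mean_eq_of_mem ha hb]

theorem gap_eq_of_mem {c : S.Component} {a b : Fin N} (ha : a ∈ members c)
    (hb : b ∈ members c) : S.gap a = S.gap b := by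
  simp only [gap, simClass_eq_of_mem ha hb, mean_eq_of_mem ha hb]

/-- No weight leaves a component. -/
theorem W_eq_zero_of_notMem {c : S.Component} {a b : Fin N} (ha : a ∈ members c)
    (hb : b ∉ members c) : S.W a b = 0 := by
  by_contra hne
  have hab : a ≠ b := fun h => hb (h ▸ ha)
  have h := (S.W_pos_iff a b hab).1 (lt_of_le_of_ne (S.W_nonneg a b) (Ne.symm hne))
  have hadj : S.classGraph.Adj a b := ⟨h.1, h.2.symm⟩
  exact hb (mem_members.2 ((SimpleGraph.ConnectedComponent.sound hadj.reachable.symm).trans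
    (mem_members.1 ha)))

/-- The block of the consensus matrix indexed by a component. -/
def block (c : S.Component) : Matrix (members c) (members c) ℝ :=
  S.W.submatrix (↑) (↑)

theorem sum_W_mul (c : S.Component) (a : members c) (f : Fin N → ℝ) :
    ∑ b, S.W a b * f b = ∑ b : members c, block c a b * f b := by
  rw [← Finset.sum_subset (Finset.subset_univ (members c)), ← Finset.sum_coe_sort]
  · rfl
  · intro b _ hb
    rw [W_eq_zero_of_notMem a.2 hb, zero_mul]

theorem block_isSymm (c : S.Component) : (block c).IsSymm := S.W_symm.submatrix _

theorem block_nonneg (c : S.Component) (a b : members c) : 0 ≤ block c a b := S.W_nonneg _ _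

theorem block_row_sum (c : S.Component) (a : members c) : ∑ b, block c a b = 1 := by
  have h := sum_W_mul c a fun _ => 1
  simp only [mul_one] at h
  rw [← h, S.W_row_sum]

/-- The component is connected, so the block fixes constant vectors only. -/
theorem block_fixed (c : S.Component) (v : members c → ℝ) (hv : (block c).mulVec v = v)
    (a b : members c) : v a = v b := by
  have step : ∀ a b : members c, S.classGraph.Adj a b → v a = v b := by
    intro a b hab
    refine eq_of_mulVec_eq_self (block_isSymm c) (block_nonneg c) (block_row_sum c) hv ?_
    exact (S.W_pos_iff a b hab.ne).2 ⟨hab.1, hab.2.symm⟩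
  have walk : ∀ x y : Fin N, S.classGraph.Walk x y → ∀ (hx : x ∈ members c) (hy : y ∈ members c),
      v ⟨x, hx⟩ = v ⟨y, hy⟩ := by
    intro x y w
    induction w with
    | nil => intro _ _; rfl
    | @cons x z y hadj _ ih =>
      intro hx hy
      have hz : z ∈ members c := mem_members.2
        ((SimpleGraph.ConnectedComponent.sound hadj.reachable.symm).trans (mem_members.1 hx))
      exact (step ⟨x, hx⟩ ⟨z, hz⟩ hadj).trans (ih hz hy)
  obtain ⟨w⟩ := reachable_of_mem a.2 b.2
  exact walk a b w a.2 b.2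

theorem lambda2_eq_secondModulus (c : S.Component) : lambda2 c = secondModulus (block c) := rfl

theorem block_isHermitian (c : S.Component) : (block c).IsHermitian := by
  ext a b
  simpa using (block_isSymm c).apply a b

theorem lambda2_nonneg (c : S.Component) : 0 ≤ lambda2 c :=
  (secondModulus_mem_Icc (block_isHermitian c) (block_nonneg c) (block_row_sum c)).1

theorem lambda2_le_one (c : S.Component) : lambda2 c ≤ 1 :=
  (secondModulus_mem_Icc (block_isHermitian c) (block_nonneg c) (block_row_sum c)).2

/-- A positive real lower bound for the gap, which itself is infinite if there is only one
class. -/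
theorem exists_pos_le_gap (a : Fin N) :
    ∃ Δ : ℝ, 0 < Δ ∧ ∀ b, b ∉ S.simClass a → Δ ≤ |S.mean a - S.mean b| := by
  classical
  have hpos : ∀ b, b ∉ S.simClass a → 0 < |S.mean a - S.mean b| := fun b hb =>
    abs_pos.2 (sub_ne_zero.2 fun h => hb h.symm)
  rcases (Finset.univ.filter fun b => b ∉ S.simClass a).eq_empty_or_nonempty with h | h
  · refine ⟨1, one_pos, fun b hb => ?_⟩
    have := Finset.filter_eq_empty_iff.1 h (Finset.mem_univ b)
    exact absurd hb this
  · obtain ⟨b, hb, hmin⟩ := Finset.exists_min_image _ (fun b => |S.mean a - S.mean b|) h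
    exact ⟨_, hpos b (Finset.mem_filter.1 hb).2, fun b' hb' =>
      hmin b' (Finset.mem_filter.2 ⟨Finset.mem_univ _, hb'⟩)⟩

theorem ofReal_le_gap {a : Fin N} {Δ : ℝ} (h : ∀ b, b ∉ S.simClass a → Δ ≤ |S.mean a - S.mean b|) :
    ENNReal.ofReal Δ ≤ S.gap a :=
  le_iInf fun b => le_iInf fun hb => ENNReal.ofReal_le_ofReal (h b hb)

theorem gap_le {a b : Fin N} (hb : b ∉ S.simClass a) :
    S.gap a ≤ ENNReal.ofReal |S.mean a - S.mean b| :=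
  iInf_le_of_le b (iInf_le _ hb)

theorem gap_pos (a : Fin N) : 0 < S.gap a := by
  obtain ⟨Δ, hΔ, h⟩ := exists_pos_le_gap (S := S) a
  exact (ENNReal.ofReal_pos.2 hΔ).trans_le (ofReal_le_gap h)

/-! ### Confidence widths -/

theorem beta_nonneg (hκ : 0 ≤ S.κ) {γ : ℝ} (hγ : 0 < γ) (n : ℕ) : 0 ≤ S.beta γ n := by
  have := S.σ_pos
  unfold beta
  positivity

theorem beta_pow_four (hκ : 0 ≤ S.κ) {γ : ℝ} (hγ : 0 < γ) (n : ℕ) :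
    S.beta γ n ^ 4 = 2 * ((S.κ + 3) * S.σ ^ 4) / γ * ((1 + Real.log n ^ 2) / n) := by
  have := S.σ_pos
  have h4 : ∀ x : ℝ, 0 ≤ x → (x ^ ((1 : ℝ) / 4)) ^ 4 = x := fun x hx => by
    rw [← Real.rpow_natCast, ← Real.rpow_mul hx]
    norm_num
  unfold beta
  rw [mul_pow, h4 _ (by positivity), h4 _ (by positivity)]

theorem beta_pos (hκ : 0 ≤ S.κ) {γ : ℝ} (hγ : 0 < γ) {n : ℕ} (hn : 1 ≤ n) : 0 < S.beta γ n := by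
  have := S.σ_pos
  have hn' : (0 : ℝ) < n := by exact_mod_cast hn
  unfold beta
  positivity

theorem beta_anti (hκ : 0 ≤ S.κ) {γ : ℝ} (hγ : 0 < γ) {s t : ℕ} (hs : 1 ≤ s) (hst : s ≤ t) :
    S.beta γ t ≤ S.beta γ s := by
  have := S.σ_pos
  refine le_of_pow_le_pow_left₀ (n := 4) (by norm_num) (beta_nonneg hκ hγ s) ?_
  rw [beta_pow_four hκ hγ, beta_pow_four hκ hγ]
  refine mul_le_mul_of_nonneg_left ?_ (by positivity)
  exact antitoneOn_one_add_log_sq_div (by simpa using hs) (by simpa using hs.trans hst)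
    (by exact_mod_cast hst)

theorem beta_pow_four_le_mul_div (hκ : 0 ≤ S.κ) {γ : ℝ} (hγ : 0 < γ) {s t : ℕ} (hs : 1 ≤ s)
    (hst : s ≤ t) : S.beta γ s ^ 4 ≤ S.beta γ t ^ 4 * ((t : ℝ) / s) := by
  have := S.σ_pos
  have hs' : (1 : ℝ) ≤ s := by exact_mod_cast hs
  have hst' : (s : ℝ) ≤ t := by exact_mod_cast hst
  have ht' : (0 : ℝ) < t := by linarith
  rw [beta_pow_four hκ hγ, beta_pow_four hκ hγ, mul_assoc]
  refine mul_le_mul_of_nonneg_left ?_ (by positivity)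
  have hl : Real.log s ≤ Real.log t := Real.log_le_log (by linarith) hst'
  have hl0 : 0 ≤ Real.log s := Real.log_nonneg hs'
  rw [div_mul_div_cancel₀ ht'.ne']
  gcongr

theorem beta_le_mul_sqrt (hκ : 0 ≤ S.κ) {γ : ℝ} (hγ : 0 < γ) {s t : ℕ} (hs : 1 ≤ s)
    (hst : s ≤ t) : S.beta γ s ≤ S.beta γ t * √((t : ℝ) / s) := by
  have hs' : (0 : ℝ) < s := by exact_mod_cast hs
  have hst' : (1 : ℝ) ≤ t / s := by
    rw [one_le_div hs']
    exact_mod_cast hst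
  have h0 := beta_nonneg hκ hγ t
  refine le_of_pow_le_pow_left₀ (n := 4) (by norm_num) (by positivity) ?_
  refine (beta_pow_four_le_mul_div hκ hγ hs hst).trans ?_
  rw [mul_pow, show √((t : ℝ) / s) ^ 4 = (√((t : ℝ) / s) ^ 2) ^ 2 by ring,
    Real.sq_sqrt (by positivity)]
  refine mul_le_mul_of_nonneg_left ?_ (by positivity)
  nlinarith

theorem tendsto_beta (hκ : 0 ≤ S.κ) {γ : ℝ} (hγ : 0 < γ) :
    Filter.Tendsto (fun n => S.beta γ n ^ 4) Filter.atTop (nhds 0) := by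
  simp_rw [beta_pow_four hκ hγ]
  rw [show (0 : ℝ) = 2 * ((S.κ + 3) * S.σ ^ 4) / γ * 0 by ring]
  refine Filter.Tendsto.const_mul _ ?_
  have h1 : Filter.Tendsto (fun x : ℝ => (1 + Real.log x ^ 2) / x) Filter.atTop (nhds 0) := by
    have ha : Filter.Tendsto (fun x : ℝ => Real.log x ^ 2 / x) Filter.atTop (nhds 0) :=
      (Real.isLittleO_pow_log_id_atTop (n := 2)).tendsto_div_nhds_zero
    have hb := tendsto_inv_atTop_zero (𝕜 := ℝ)
    have := hb.add ha
    rw [add_zero] at this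
    refine this.congr fun x => ?_
    rw [add_div, one_div]
  exact h1.comp tendsto_natCast_atTop_atTop

theorem exists_beta_lt (hκ : 0 ≤ S.κ) {γ y : ℝ} (hγ : 0 < γ) (hy : 0 < y) :
    ∃ n : ℕ, 1 ≤ n ∧ S.beta γ n < y := by
  have h := (tendsto_beta hκ hγ).eventually (gt_mem_nhds (pow_pos hy 4))
  obtain ⟨n, hn, hn1⟩ := (h.and (Filter.eventually_ge_atTop 1)).exists
  exact ⟨n, hn1, lt_of_pow_lt_pow_left₀ 4 hy.le hn⟩

/-- The infimum that defines `nStar` is attained, because `β` tends to `0`. -/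
theorem nStar_spec (hκ : 0 ≤ S.κ) {γ : ℝ} (hγ : 0 < γ) {x : ENNReal} (hx : 0 < x) :
    1 ≤ S.nStar γ x ∧ ENNReal.ofReal (S.beta γ (S.nStar γ x)) < x := by
  have hne : {n : ℕ | 1 ≤ n ∧ ENNReal.ofReal (S.beta γ n) < x}.Nonempty := by
    obtain ⟨y, hy0, hyx⟩ := ENNReal.lt_iff_exists_nnreal_btwn.1 hx
    obtain ⟨n, hn, hn'⟩ := exists_beta_lt hκ hγ (y := (y : ℝ)) (by exact_mod_cast hy0)
    refine ⟨n, hn, lt_of_le_of_lt ?_ hyx⟩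
    rw [← ENNReal.ofReal_coe_nnreal]
    exact ENNReal.ofReal_le_ofReal hn'.le
  exact Nat.sInf_mem hne

theorem level_pos {c : S.Component} {δ : ℝ} (hδ : 0 < δ) : 0 < level c δ := by
  have h1 : (0 : ℝ) < S.r := by exact_mod_cast S.one_le_r
  have h2 : (0 : ℝ) < size c := by exact_mod_cast one_le_size c
  unfold level
  positivity

/-! ### Identification of the neighbours of the same class -/

theorem pruned_succ_subset (γ : ℝ) (xbar : ℕ → Fin N → ℝ) (a : Fin N) (t : ℕ) :
    S.pruned γ xbar (t + 1) a ⊆ S.pruned γ xbar t a := fun _ hb => hb.1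

theorem pruned_subset_neighborSet (γ : ℝ) (xbar : ℕ → Fin N → ℝ) (a : Fin N) (t : ℕ) :
    S.pruned γ xbar t a ⊆ S.G.neighborSet a := by
  induction t with
  | zero => exact subset_rfl
  | succ t ih => exact (pruned_succ_subset γ xbar a t).trans ih

/-- If all averages of `a` and its neighbours stay in their confidence intervals, and from time
`n + 1` on the intervals of `a` and of its neighbours of other classes are disjoint, then exactly
the neighbours of the same class are kept from time `n + 1` on. -/
theorem pruned_eq_of_separated {γ : ℝ} {xbar : ℕ → Fin N → ℝ} {a : Fin N} {n : ℕ} (hn : 1 ≤ n)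
    (hgood : ∀ b, b = a ∨ S.G.Adj a b → ∀ s, 1 ≤ s → |xbar s b - S.mean b| ≤ S.beta γ s)
    (hsep : ∀ b, S.G.Adj a b → b ∉ S.simClass a → ∀ s, n ≤ s →
      S.beta γ (s + 1) + S.beta γ s < |xbar (s + 1) a - xbar s b|)
    {t : ℕ} (ht : n + 1 ≤ t) :
    S.pruned γ xbar t a = S.simClass a ∩ S.G.neighborSet a := by
  apply Set.Subset.antisymm
  · intro b hb
    have hadj := pruned_subset_neighborSet γ xbar a t hb
    refine ⟨?_, hadj⟩
    by_contra hcl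
    obtain ⟨s, rfl⟩ : ∃ s, t = s + 1 := ⟨t - 1, by omega⟩
    have h1 := hb.2 (by omega)
    have h2 := hsep b hadj hcl s (by omega)
    linarith
  · rintro b ⟨hcl, hadj⟩
    clear ht
    induction t with
    | zero => exact hadj
    | succ t ih =>
      refine ⟨ih, fun ht => ?_⟩
      have h1 := abs_le.1 (hgood a (Or.inl rfl) (t + 1) (by omega))
      have h2 := abs_le.1 (hgood b (Or.inr hadj) t ht)
      have h3 : S.mean b = S.mean a := hcl
      have : |xbar (t + 1) a - xbar t b| ≤ S.beta γ (t + 1) + S.beta γ t :=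
        abs_le.2 ⟨by linarith, by linarith⟩
      linarith

/-- Confidence widths below a quarter of the gap make the intervals of different classes
disjoint. -/
theorem pruned_eq_of_beta_lt_gap (hκ : 0 ≤ S.κ) {γ : ℝ} (hγ : 0 < γ) {xbar : ℕ → Fin N → ℝ}
    {a : Fin N} {n : ℕ} (hn : 1 ≤ n)
    (hgood : ∀ b, b = a ∨ S.G.Adj a b → ∀ s, 1 ≤ s → |xbar s b - S.mean b| ≤ S.beta γ s)
    (hgap : ENNReal.ofReal (S.beta γ n) < S.gap a / 4) {t : ℕ} (ht : n + 1 ≤ t) :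
    S.pruned γ xbar t a = S.simClass a ∩ S.G.neighborSet a := by
  refine pruned_eq_of_separated hn hgood (fun b hadj hcl s hs => ?_) ht
  have h1 : ENNReal.ofReal (S.beta γ n) < ENNReal.ofReal (|S.mean a - S.mean b| / 4) := by
    refine hgap.trans_le ?_
    rw [ENNReal.ofReal_div_of_pos (by norm_num)]
    simpa using ENNReal.div_le_div_right (gap_le hcl) 4
  have h2 : S.beta γ n < |S.mean a - S.mean b| / 4 :=
    (ENNReal.ofReal_lt_ofReal_iff_of_nonneg (beta_nonneg hκ hγ n)).1 h1
  have h3 := beta_anti hκ hγ hn hs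
  have h4 := beta_anti hκ hγ (hn.trans hs) (Nat.le_succ s)
  have h5 := hgood a (Or.inl rfl) (s + 1) (by omega)
  have h6 := hgood b (Or.inr hadj) s (hn.trans hs)
  have h7 : |S.mean a - S.mean b| ≤
      |xbar (s + 1) a - S.mean a| + |xbar (s + 1) a - xbar s b| + |xbar s b - S.mean b| := by
    have : S.mean a - S.mean b = -(xbar (s + 1) a - S.mean a) + (xbar (s + 1) a - xbar s b) +
        (xbar s b - S.mean b) := by ring
    rw [this]
    refine (abs_add_three _ _ _).trans ?_
    rw [abs_neg]
  linarith

/-! ### Averaging in time -/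

/-- The scalar recursion of the estimates, without any mixing between agents. -/
def smooth (α y : ℕ → ℝ) : ℕ → ℝ
  | 0 => 0
  | t + 1 => (1 - α t) * y (t + 1) + α t * smooth α y t

theorem smooth_le {α y : ℕ → ℝ} (h0 : ∀ t, 0 ≤ α t) (h1 : ∀ t, α t ≤ 1) {M : ℝ} (hM : 0 ≤ M)
    (hy : ∀ s, 1 ≤ s → y s ≤ M) (t : ℕ) : smooth α y t ≤ M := by
  induction t with
  | zero => exact hM
  | succ t ih =>
    have e1 := mul_le_mul_of_nonneg_left (hy (t + 1) (by omega)) (sub_nonneg.2 (h1 t))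
    have e2 := mul_le_mul_of_nonneg_left ih (h0 t)
    simp only [smooth]
    linarith

/-- For the memory `t / (t + 1)` the recursion computes plain averages. -/
theorem mul_smooth_eq_sum (y : ℕ → ℝ) (t : ℕ) :
    (t : ℝ) * smooth (fun t => (t : ℝ) / (t + 1)) y t = ∑ s ∈ Finset.Icc 1 t, y s := by
  induction t with
  | zero => simp
  | succ t ih =>
    rw [Finset.sum_Icc_succ_top (by omega), ← ih]
    simp only [smooth]
    have : (t : ℝ) + 1 ≠ 0 := by positivity
    push_cast
    field_simp
    ring

/-- Every averaging of bounded deviations is bounded, whatever the weights. -/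
theorem abs_est_sub_le {α : ℕ → ℝ} (h0 : ∀ t, 0 ≤ α t) (h1 : ∀ t, α t ≤ 1)
    {xbar : ℕ → Fin N → ℝ} {Wt : ℕ → Matrix (Fin N) (Fin N) ℝ} (hW0 : ∀ t a b, 0 ≤ Wt t a b)
    (hW1 : ∀ t a, ∑ b, Wt t a b = 1) {m D : ℝ} {y : ℕ → ℝ} (hinit : ∀ b, |S.init b - m| ≤ D)
    (hx : ∀ s, 1 ≤ s → ∀ b, |xbar s b - m| ≤ D + y s) (t : ℕ) (b : Fin N) :
    |S.est α xbar Wt t b - m| ≤ D + smooth α y t := by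
  induction t generalizing b with
  | zero => simpa [est, smooth] using hinit b
  | succ t ih =>
    have e : S.est α xbar Wt (t + 1) b - m = (1 - α t) * (xbar (t + 1) b - m) +
        α t * (Wt t).mulVec (fun b => S.est α xbar Wt t b - m) b := by
      have : (Wt t).mulVec (fun b => S.est α xbar Wt t b - m) b =
          (Wt t).mulVec (S.est α xbar Wt t) b - m := by
        simp only [Matrix.mulVec, dotProduct, mul_sub, Finset.sum_sub_distrib]
        rw [← Finset.sum_mul, hW1, one_mul]
      rw [this]
      simp only [est, Pi.add_apply, Pi.smul_apply, smul_eq_mul]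
      ring
    rw [e]
    refine (abs_add_le _ _).trans ?_
    rw [abs_mul, abs_mul, abs_of_nonneg (h0 t), abs_of_nonneg (sub_nonneg.2 (h1 t))]
    have e1 := mul_le_mul_of_nonneg_left (hx (t + 1) (by omega) b) (sub_nonneg.2 (h1 t))
    have e2 := mul_le_mul_of_nonneg_left (abs_mulVec_le (hW0 t) (hW1 t) ih b) (h0 t)
    simp only [smooth]
    linarith

/-- Once the weights of the component are settled, its errors evolve by the block alone. -/
theorem est_sub_succ {c : S.Component} {α : ℕ → ℝ} {xbar : ℕ → Fin N → ℝ}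
    {Wt : ℕ → Matrix (Fin N) (Fin N) ℝ} {t : ℕ}
    (hW : ∀ a ∈ members c, ∀ b, Wt t a b = S.W a b) (m : ℝ) (a : members c) :
    S.est α xbar Wt (t + 1) a - m = (1 - α t) * (xbar (t + 1) a - m) +
      α t * (block c).mulVec (fun b : members c => S.est α xbar Wt t b - m) a := by
  have : (block c).mulVec (fun b : members c => S.est α xbar Wt t b - m) a =
      (Wt t).mulVec (S.est α xbar Wt t) a - m := by
    have e1 : (Wt t).mulVec (S.est α xbar Wt t) a = ∑ b, S.W a b * S.est α xbar Wt t b := by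
      simp only [Matrix.mulVec, dotProduct, hW a a.2]
    rw [e1, sum_W_mul]
    simp only [Matrix.mulVec, dotProduct, mul_sub, Finset.sum_sub_distrib]
    rw [← Finset.sum_mul, block_row_sum, one_mul]
  rw [this]
  simp only [est, Pi.add_apply, Pi.smul_apply, smul_eq_mul]
  ring

end System

/-! ### Moments of the samples -/

section SquareSums

variable {Ω : Type*} [MeasurableSpace Ω] {P : Measure Ω} {ι : Type*}

theorem integrable_sq_sum_sq [IsProbabilityMeasure P] {Z : ι → Ω → ℝ} (hm : ∀ i, Measurable (Z i))
    (h4 : ∀ i, MemLp (Z i) 4 P) (s : Finset ι) :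
    Integrable (fun ω => (∑ i ∈ s, Z i ω ^ 2) ^ 2) P := by
  have h : Integrable (fun ω => (s.card : ℝ) * ∑ i ∈ s, Z i ω ^ 4) P :=
    (integrable_finsetSum _ fun i _ => integrable_pow_of_memLp_four (h4 i) le_rfl).const_mul _
  refine h.mono' ?_ (Filter.Eventually.of_forall fun ω => ?_)
  · exact ((Finset.measurable_fun_sum _ fun i _ => (hm i).pow_const 2).pow_const
      2).aestronglyMeasurable
  · rw [Real.norm_of_nonneg (sq_nonneg _)]
    refine (sq_sum_le_card_mul_sum_sq (s := s) (f := fun i => Z i ω ^ 2)).trans (le_of_eq ?_)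
    congr 1
    exact Finset.sum_congr rfl fun i _ => by ring

theorem moments_le_integral_sq_sum_sq [IsProbabilityMeasure P] {Z : ι → Ω → ℝ}
    (hm : ∀ i, Measurable (Z i)) (h4 : ∀ i, MemLp (Z i) 4 P) (s : Finset ι) :
    ∑ i ∈ s, ∫ ω, Z i ω ^ 4 ∂P ≤ ∫ ω, (∑ i ∈ s, Z i ω ^ 2) ^ 2 ∂P ∧
    (∑ i ∈ s, ∫ ω, Z i ω ^ 2 ∂P) ^ 2 ≤ ∫ ω, (∑ i ∈ s, Z i ω ^ 2) ^ 2 ∂P := by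
  constructor
  · rw [← integral_finsetSum _ fun i _ => integrable_pow_of_memLp_four (h4 i) le_rfl]
    refine integral_mono (integrable_finsetSum _ fun i _ =>
      integrable_pow_of_memLp_four (h4 i) le_rfl) (integrable_sq_sum_sq hm h4 s) fun ω => ?_
    have h := Finset.sum_sq_le_sq_sum_of_nonneg (s := s) (f := fun i => Z i ω ^ 2)
      fun i _ => sq_nonneg _
    refine le_trans (le_of_eq (Finset.sum_congr rfl fun i _ => ?_)) h
    ring
  · have h2 : ∀ i ∈ s, Integrable (fun ω => Z i ω ^ 2) P := fun i _ =>
      integrable_pow_of_memLp_four (h4 i) (by norm_num)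
    rw [← integral_finsetSum _ h2]
    exact sq_integral_le_integral_sq (integrable_finsetSum _ h2) (integrable_sq_sum_sq hm h4 s)

/-- The square is expanded; off the diagonal the second moments factor by pairwise
independence. -/
theorem integral_sq_sum_sq_le [IsProbabilityMeasure P] {Z : ι → Ω → ℝ}
    (hm : ∀ i, Measurable (Z i)) (h4 : ∀ i, MemLp (Z i) 4 P)
    (hi : ∀ i j, i ≠ j → IndepFun (Z i) (Z j) P) (s : Finset ι) :
    ∫ ω, (∑ i ∈ s, Z i ω ^ 2) ^ 2 ∂P ≤
      ∑ i ∈ s, ∫ ω, Z i ω ^ 4 ∂P + (∑ i ∈ s, ∫ ω, Z i ω ^ 2 ∂P) ^ 2 := by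
  classical
  have hprod : ∀ i j, i ≠ j → Integrable (fun ω => Z i ω ^ 2 * Z j ω ^ 2) P ∧
      ∫ ω, Z i ω ^ 2 * Z j ω ^ 2 ∂P = (∫ ω, Z i ω ^ 2 ∂P) * ∫ ω, Z j ω ^ 2 ∂P := by
    intro i j hij
    have hjk : IndepFun (fun ω => Z i ω ^ 2) (fun ω => Z j ω ^ 2) P :=
      (hi i j hij).comp (φ := fun x : ℝ => x ^ 2) (ψ := fun x : ℝ => x ^ 2)
        (by fun_prop) (by fun_prop)
    exact ⟨hjk.integrable_mul (integrable_pow_of_memLp_four (h4 i) (by norm_num))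
      (integrable_pow_of_memLp_four (h4 j) (by norm_num)),
      hjk.integral_fun_mul_eq_mul_integral ((hm i).pow_const _).aestronglyMeasurable
        ((hm j).pow_const _).aestronglyMeasurable⟩
  have hsame : ∀ i ω, Z i ω ^ 2 * Z i ω ^ 2 = Z i ω ^ 4 := fun i ω => by ring
  have hint : ∀ i j, Integrable (fun ω => Z i ω ^ 2 * Z j ω ^ 2) P := by
    intro i j
    rcases eq_or_ne i j with rfl | hij
    · simp_rw [hsame]
      exact integrable_pow_of_memLp_four (h4 i) le_rfl
    · exact (hprod i j hij).1
  have hle : ∀ i j, ∫ ω, Z i ω ^ 2 * Z j ω ^ 2 ∂P ≤ (if i = j then ∫ ω, Z i ω ^ 4 ∂P else 0) +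
      (∫ ω, Z i ω ^ 2 ∂P) * ∫ ω, Z j ω ^ 2 ∂P := by
    intro i j
    have hnn : ∀ i, 0 ≤ ∫ ω, Z i ω ^ 2 ∂P := fun i => integral_nonneg fun ω => sq_nonneg _
    rcases eq_or_ne i j with rfl | hij
    · simp_rw [hsame, if_true]
      have := mul_nonneg (hnn i) (hnn i)
      linarith
    · rw [if_neg hij, (hprod i j hij).2, zero_add]
  calc ∫ ω, (∑ i ∈ s, Z i ω ^ 2) ^ 2 ∂P
      = ∫ ω, ∑ i ∈ s, ∑ j ∈ s, Z i ω ^ 2 * Z j ω ^ 2 ∂P := by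
        simp_rw [sq (∑ i ∈ s, Z i _ ^ 2), Finset.sum_mul_sum]
    _ = ∑ i ∈ s, ∑ j ∈ s, ∫ ω, Z i ω ^ 2 * Z j ω ^ 2 ∂P := by
        rw [integral_finsetSum _ fun i _ => integrable_finsetSum _ fun j _ => hint i j]
        exact Finset.sum_congr rfl fun i _ => integral_finsetSum _ fun j _ => hint i j
    _ ≤ ∑ i ∈ s, ∑ j ∈ s, ((if i = j then ∫ ω, Z i ω ^ 4 ∂P else 0) +
          (∫ ω, Z i ω ^ 2 ∂P) * ∫ ω, Z j ω ^ 2 ∂P) :=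
        Finset.sum_le_sum fun i _ => Finset.sum_le_sum fun j _ => hle i j
    _ = _ := by
        simp_rw [Finset.sum_add_distrib, sq (∑ i ∈ s, ∫ ω, Z i ω ^ 2 ∂P), Finset.sum_mul_sum]
        congr 1
        refine Finset.sum_congr rfl fun i hi => ?_
        rw [Finset.sum_ite_eq, if_pos hi]

end SquareSums

namespace System

variable {N : ℕ} {S : System N}

variable (S) in
/-- The variance of the law of an agent. -/
noncomputable def var (a : Fin N) : ℝ := ∫ x, (x - S.mean a) ^ 2 ∂(S.D a)

variable (S) in
/-- The fourth central moment of the law of an agent. -/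
noncomputable def fourth (a : Fin N) : ℝ := ∫ x, (x - S.mean a) ^ 4 ∂(S.D a)

/-- The sum of the variances of the agents of a component. -/
noncomputable def totalVar (c : S.Component) : ℝ := ∑ a ∈ members c, S.var a

/-- The sum of the fourth central moments of the agents of a component. -/
noncomputable def totalFourth (c : S.Component) : ℝ := ∑ a ∈ members c, S.fourth a

theorem var_nonneg (a : Fin N) : 0 ≤ S.var a := integral_nonneg fun _ => sq_nonneg _

theorem fourth_nonneg (a : Fin N) : 0 ≤ S.fourth a :=
  integral_nonneg fun _ => Even.pow_nonneg (by decide) _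

theorem totalVar_nonneg (c : S.Component) : 0 ≤ totalVar c :=
  Finset.sum_nonneg fun _ _ => var_nonneg _

theorem totalFourth_nonneg (c : S.Component) : 0 ≤ totalFourth c :=
  Finset.sum_nonneg fun _ _ => fourth_nonneg _

theorem var_sq_le (a : Fin N) : S.var a ^ 2 ≤ S.σ ^ 4 := by
  have h := pow_le_pow_left₀ (var_nonneg a) (S.variance_le a) 2
  linarith [show (S.σ ^ 2) ^ 2 = S.σ ^ 4 by ring]

theorem fourth_add_le (a : Fin N) : S.fourth a + 3 * S.var a ^ 2 ≤ (S.κ + 3) * S.σ ^ 4 := by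
  have h1 : S.fourth a ≤ S.κ * S.σ ^ 4 := S.fourth_moment_le a
  have h2 := var_sq_le (S := S) a
  linarith

theorem totalVar_pos {c : S.Component} (hc : Nondegenerate c) : 0 < totalVar c := by
  obtain ⟨a, ha, hpos⟩ := hc
  exact hpos.trans_le (Finset.single_le_sum (f := S.var) (fun b _ => var_nonneg b) ha)

theorem memLp_sub_mean (a : Fin N) : MemLp (fun x => x - S.mean a) 4 (S.D a) :=
  (S.memLp a).sub (memLp_const _)

theorem integral_sub_mean (a : Fin N) : ∫ x, (x - S.mean a) ∂(S.D a) = 0 := by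
  rw [integral_sub ((S.memLp a).integrable (by norm_num)) (integrable_const _)]
  simp [mean]

/-! ### One sample of each agent of a component -/

instance (c : S.Component) : IsProbabilityMeasure (sampleLaw c) := by
  unfold sampleLaw
  infer_instance

theorem memLp_coord (c : S.Component) (a : members c) :
    MemLp (fun x : members c → ℝ => x a - S.mean a) 4 (sampleLaw c) :=
  (memLp_sub_mean (S := S) a).comp_measurePreserving
    (measurePreserving_eval (fun a : members c => S.D a) a)

theorem integral_coord (c : S.Component) (a : members c) {f : ℝ → ℝ} (hf : Measurable f) :
    ∫ x, f (x a) ∂(sampleLaw c) = ∫ x, f x ∂(S.D a) := by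
  have h := (measurePreserving_eval (fun a : members c => S.D a) a)
  rw [← h.map_eq, integral_map (measurable_pi_apply a).aemeasurable hf.aestronglyMeasurable]
  rfl

theorem indep_coord (c : S.Component) :
    iIndepFun (fun (a : members c) (x : members c → ℝ) => x a - S.mean a) (sampleLaw c) :=
  iIndepFun_pi (X := fun (a : members c) (x : ℝ) => x - S.mean a) fun a => by fun_prop

/-- All coordinates of `P x - μ` are equal, because the agents of a component share their mean. -/
theorem avgMoment_eq (c : S.Component) :
    avgMoment c = (∫ x, (∑ a, (x a - S.mean a)) ^ 4 ∂(sampleLaw c)) / (size c : ℝ) ^ 2 := by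
  have hn : (size c : ℝ) ≠ 0 := by
    have := one_le_size c
    positivity
  unfold avgMoment
  rw [← integral_div]
  refine integral_congr_ae (Filter.Eventually.of_forall fun x => ?_)
  have e : ∀ a : members c, (avgMatrix c).mulVec x a - S.mean a =
      (∑ b, (x b - S.mean b)) / size c := by
    intro a
    have hmean : ∑ b : members c, S.mean b = size c * S.mean a := by
      rw [Finset.sum_congr rfl fun b _ => mean_eq_of_mem (c := c) b.2 a.2, Finset.sum_const,
        Finset.card_univ, card_members, nsmul_eq_mul]
    rw [Finset.sum_sub_distrib, hmean]
    simp only [Matrix.mulVec, dotProduct, avgMatrix, Matrix.of_apply, ← Finset.mul_sum]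
    field_simp
  have hsq : ‖WithLp.toLp 2 ((avgMatrix c).mulVec x - fun a : members c => S.mean a)‖ ^ 2 =
      (∑ b, (x b - S.mean b)) ^ 2 / size c := by
    rw [EuclideanSpace.norm_sq_eq]
    simp only [Pi.sub_apply, e, Real.norm_eq_abs, sq_abs]
    rw [Finset.sum_const, Finset.card_univ, card_members, nsmul_eq_mul]
    field_simp
  simp only
  rw [show ∀ y : ℝ, y ^ 4 = (y ^ 2) ^ 2 from fun y => by ring, hsq]
  ring

theorem fullMoment_eq (c : S.Component) :
    fullMoment c = ∫ x, (∑ a, (x a - S.mean a) ^ 2) ^ 2 ∂(sampleLaw c) := by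
  unfold fullMoment
  refine integral_congr_ae (Filter.Eventually.of_forall fun x => ?_)
  simp only
  rw [show ∀ y : ℝ, y ^ 4 = (y ^ 2) ^ 2 from fun y => by ring, EuclideanSpace.norm_sq_eq]
  simp only [Pi.sub_apply, Real.norm_eq_abs, sq_abs]

theorem sum_coord_moments (c : S.Component) :
    ∑ a : members c, ∫ x, (x a - S.mean a) ^ 4 ∂(sampleLaw c) = totalFourth c ∧
    ∑ a : members c, ∫ x, (x a - S.mean a) ^ 2 ∂(sampleLaw c) = totalVar c := by
  constructor
  · unfold totalFourth
    rw [← Finset.sum_coe_sort (members c)]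
    exact Finset.sum_congr rfl fun a _ =>
      integral_coord c a (f := fun x => (x - S.mean a) ^ 4) (by fun_prop)
  · unfold totalVar
    rw [← Finset.sum_coe_sort (members c)]
    exact Finset.sum_congr rfl fun a _ =>
      integral_coord c a (f := fun x => (x - S.mean a) ^ 2) (by fun_prop)

/-- The moment of the average of a component, up to constants: it controls the sums of the variances
and of the fourth moments. -/
theorem avgMoment_bounds (c : S.Component) :
    totalFourth c ≤ (size c : ℝ) ^ 2 * avgMoment c ∧
    totalVar c ^ 2 ≤ (size c : ℝ) ^ 2 * avgMoment c ∧
    (size c : ℝ) ^ 2 * avgMoment c ≤ totalFourth c + 3 * totalVar c ^ 2 := by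
  have hn : (size c : ℝ) ≠ 0 := by
    have := one_le_size c
    positivity
  have hm : ∀ a : members c, Measurable fun x : members c → ℝ => x a - S.mean a :=
    fun a => by fun_prop
  have h0 : ∀ a : members c, ∫ x, (x a - S.mean a) ∂(sampleLaw c) = 0 := fun a =>
    (integral_coord c a (f := fun x => x - S.mean a) (by fun_prop)).trans (integral_sub_mean _)
  obtain ⟨h2, h4, h4'⟩ := moments_sum (indep_coord c) hm (memLp_coord c) h0 Finset.univ
  obtain ⟨e4, e2⟩ := sum_coord_moments c
  rw [e2] at h2
  rw [e4, e2] at h4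
  rw [e4] at h4'
  have e : (size c : ℝ) ^ 2 * avgMoment c =
      ∫ x, (∑ a, (x a - S.mean a)) ^ 4 ∂(sampleLaw c) := by
    rw [avgMoment_eq]
    field_simp
  rw [e]
  refine ⟨h4', ?_, h4⟩
  have hS : MemLp (fun x : members c → ℝ => ∑ a, (x a - S.mean a)) 4 (sampleLaw c) :=
    memLp_finsetSum _ fun a _ => memLp_coord c a
  have hpow : ∀ y : ℝ, y ^ 4 = (y ^ 2) ^ 2 := fun y => by ring
  rw [← h2]
  simp_rw [hpow]
  refine sq_integral_le_integral_sq (integrable_pow_of_memLp_four hS (by norm_num)) ?_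
  simp_rw [← hpow]
  exact integrable_pow_of_memLp_four hS le_rfl

theorem fullMoment_bounds (c : S.Component) :
    totalFourth c ≤ fullMoment c ∧ totalVar c ^ 2 ≤ fullMoment c := by
  have hm : ∀ a : members c, Measurable fun x : members c → ℝ => x a - S.mean a :=
    fun a => by fun_prop
  obtain ⟨h4, h2⟩ := moments_le_integral_sq_sum_sq hm (memLp_coord c) Finset.univ
  obtain ⟨e4, e2⟩ := sum_coord_moments c
  rw [fullMoment_eq]
  rw [e4] at h4
  rw [e2] at h2
  exact ⟨h4, h2⟩

/-! ### The samples of a run -/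

variable (S) in
/-- Deviation of the average of the first `t` samples of an agent from its mean. -/
noncomputable def dev {Ω : Type*} (X : Fin N → ℕ → Ω → ℝ) (t : ℕ) (ω : Ω) (a : Fin N) : ℝ :=
  empMean X t ω a - S.mean a

variable (S) in
/-- Deviation of a single sample, indexed by agent and time. -/
noncomputable def noise {Ω : Type*} (X : Fin N → ℕ → Ω → ℝ) (p : Fin N × ℕ) (ω : Ω) : ℝ :=
  X p.1 p.2 ω - S.mean p.1

theorem dev_eq {Ω : Type*} (X : Fin N → ℕ → Ω → ℝ) {t : ℕ} (ht : 1 ≤ t) (ω : Ω) (a : Fin N) :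
    S.dev X t ω a = (∑ s ∈ Finset.Icc 1 t, S.noise X (a, s) ω) / t := by
  have : (t : ℝ) ≠ 0 := by positivity
  simp only [dev, noise, empMean, Finset.sum_sub_distrib, Finset.sum_const, Nat.card_Icc,
    nsmul_eq_mul]
  rw [Nat.add_sub_cancel, sub_div, mul_div_cancel_left₀ _ this]

/-- The average deviation of the agents of a component. -/
noncomputable def avgDev {Ω : Type*} (c : S.Component) (X : Fin N → ℕ → Ω → ℝ) (t : ℕ) (ω : Ω) :
    ℝ :=
  (∑ a ∈ members c, S.dev X t ω a) / size c

section Run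

variable {c : S.Component} {γ : ℝ} {Ω : Type*} [MeasurableSpace Ω] {P : Measure Ω}
  {X : Fin N → ℕ → Ω → ℝ} {Wt : ℕ → Ω → Matrix (Fin N) (Fin N) ℝ}

theorem IsRun.measurable_noise (h : IsRun c γ P X Wt) (p : Fin N × ℕ) :
    Measurable (S.noise X p) := (h.measurable_sample p.1 p.2).sub_const _

theorem IsRun.integral_noise (h : IsRun c γ P X Wt) (p : Fin N × ℕ) {f : ℝ → ℝ}
    (hf : Measurable f) : ∫ ω, f (S.noise X p ω) ∂P = ∫ x, f (x - S.mean p.1) ∂(S.D p.1) := by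
  have hg : Measurable fun x => f (x - S.mean p.1) := hf.comp (measurable_id.sub_const _)
  rw [← h.law_sample p.1 p.2, integral_map (h.measurable_sample _ _).aemeasurable
    hg.aestronglyMeasurable]
  rfl

theorem IsRun.memLp_noise (h : IsRun c γ P X Wt) (p : Fin N × ℕ) : MemLp (S.noise X p) 4 P := by
  have h1 := memLp_sub_mean (S := S) p.1
  rw [← h.law_sample p.1 p.2, memLp_map_measure_iff h1.1 (h.measurable_sample _ _).aemeasurable]
    at h1
  exact h1

theorem IsRun.indep_noise (h : IsRun c γ P X Wt) : iIndepFun (S.noise X) P :=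
  h.indep_sample.comp (fun p x => x - S.mean p.1) fun p => by fun_prop

theorem IsRun.moments_sum_noise [IsProbabilityMeasure P] (h : IsRun c γ P X Wt)
    (A : Finset (Fin N)) (t : ℕ) :
    ∫ ω, (∑ a ∈ A, ∑ s ∈ Finset.Icc 1 t, S.noise X (a, s) ω) ^ 2 ∂P = t * ∑ a ∈ A, S.var a ∧
    ∫ ω, (∑ a ∈ A, ∑ s ∈ Finset.Icc 1 t, S.noise X (a, s) ω) ^ 4 ∂P ≤
      t * ∑ a ∈ A, S.fourth a + 3 * (t * ∑ a ∈ A, S.var a) ^ 2 := by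
  obtain ⟨h2, h4, -⟩ := moments_sum h.indep_noise h.measurable_noise h.memLp_noise
    (fun p => (h.integral_noise p (f := id) measurable_id).trans (integral_sub_mean _))
    (A ×ˢ Finset.Icc 1 t)
  have e : ∀ f : Fin N → ℝ, ∑ a ∈ A, ∑ _s ∈ Finset.Icc 1 t, f a = t * ∑ a ∈ A, f a := by
    intro f
    simp [Finset.mul_sum]
  have e2 : ∀ p, ∫ ω, S.noise X p ω ^ 2 ∂P = S.var p.1 := fun p =>
    h.integral_noise p (f := fun x => x ^ 2) (by fun_prop)
  have e4 : ∀ p, ∫ ω, S.noise X p ω ^ 4 ∂P = S.fourth p.1 := fun p =>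
    h.integral_noise p (f := fun x => x ^ 4) (by fun_prop)
  simp_rw [Finset.sum_product, e2, e4, e] at h2 h4
  exact ⟨h2, h4⟩

theorem IsRun.measurable_dev (h : IsRun c γ P X Wt) (t : ℕ) (a : Fin N) :
    Measurable fun ω => S.dev X t ω a := by
  unfold dev empMean
  exact ((Finset.measurable_fun_sum _ fun s _ => h.measurable_sample a s).div_const _).sub_const _

theorem IsRun.memLp_dev [IsProbabilityMeasure P] (h : IsRun c γ P X Wt) {t : ℕ} (ht : 1 ≤ t)
    (a : Fin N) : MemLp (fun ω => S.dev X t ω a) 4 P := by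
  have hs : MemLp (fun ω => ∑ s ∈ Finset.Icc 1 t, S.noise X (a, s) ω) 4 P :=
    memLp_finsetSum _ fun s _ => h.memLp_noise (a, s)
  have e : (fun ω => S.dev X t ω a) =
      fun ω => (t : ℝ)⁻¹ * ∑ s ∈ Finset.Icc 1 t, S.noise X (a, s) ω := by
    ext ω
    rw [dev_eq X ht]
    ring
  rw [e]
  exact hs.const_mul _

theorem IsRun.integral_dev_sq [IsProbabilityMeasure P] (h : IsRun c γ P X Wt) {t : ℕ}
    (ht : 1 ≤ t) (a : Fin N) : ∫ ω, S.dev X t ω a ^ 2 ∂P = S.var a / t := by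
  have := (h.moments_sum_noise {a} t).1
  simp only [Finset.sum_singleton] at this
  simp_rw [dev_eq X ht, div_pow]
  rw [integral_div, this]
  have : (t : ℝ) ≠ 0 := by positivity
  field_simp

/-- The fourth moment of a sum of `t` independent centred blocks, divided by `t⁴`. -/
theorem div_pow_four_le {t : ℕ} (ht : 1 ≤ t) {I m v : ℝ} (hm : 0 ≤ m)
    (hI : I ≤ t * m + 3 * (t * v) ^ 2) : I / (t : ℝ) ^ 4 ≤ (m + 3 * v ^ 2) / (t : ℝ) ^ 2 := by
  have ht' : (1 : ℝ) ≤ t := by exact_mod_cast ht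
  rw [div_le_div_iff₀ (by positivity) (by positivity)]
  have h1 : (t : ℝ) * m ≤ (t : ℝ) ^ 2 * m := by
    refine mul_le_mul_of_nonneg_right ?_ hm
    nlinarith
  calc I * (t : ℝ) ^ 2 ≤ ((t : ℝ) ^ 2 * m + 3 * (t * v) ^ 2) * (t : ℝ) ^ 2 := by
        gcongr
        linarith
    _ = (m + 3 * v ^ 2) * (t : ℝ) ^ 4 := by ring

theorem IsRun.integral_dev_pow_four_le [IsProbabilityMeasure P] (h : IsRun c γ P X Wt) {t : ℕ}
    (ht : 1 ≤ t) (a : Fin N) :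
    ∫ ω, S.dev X t ω a ^ 4 ∂P ≤ (S.fourth a + 3 * S.var a ^ 2) / (t : ℝ) ^ 2 := by
  have := (h.moments_sum_noise {a} t).2
  simp only [Finset.sum_singleton] at this
  simp_rw [dev_eq X ht, div_pow]
  rw [integral_div]
  exact div_pow_four_le ht (fourth_nonneg a) this

theorem IsRun.memLp_avgDev [IsProbabilityMeasure P] (h : IsRun c γ P X Wt) {t : ℕ} (ht : 1 ≤ t) :
    MemLp (avgDev c X t) 4 P := by
  have hs : MemLp (fun ω => ∑ a ∈ members c, S.dev X t ω a) 4 P :=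
    memLp_finsetSum _ fun a _ => h.memLp_dev ht a
  have e : avgDev c X t = fun ω => (size c : ℝ)⁻¹ * ∑ a ∈ members c, S.dev X t ω a := by
    ext ω
    rw [avgDev]
    ring
  rw [e]
  exact hs.const_mul _

theorem IsRun.integral_avgDev_pow_four_le [IsProbabilityMeasure P] (h : IsRun c γ P X Wt) {t : ℕ}
    (ht : 1 ≤ t) : ∫ ω, avgDev c X t ω ^ 4 ∂P ≤
      (totalFourth c + 3 * totalVar c ^ 2) / (size c : ℝ) ^ 4 / (t : ℝ) ^ 2 := by
  have := (h.moments_sum_noise (members c) t).2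
  have e : ∀ ω, avgDev c X t ω ^ 4 =
      (∑ a ∈ members c, ∑ s ∈ Finset.Icc 1 t, S.noise X (a, s) ω) ^ 4 / (t : ℝ) ^ 4 /
        (size c : ℝ) ^ 4 := by
    intro ω
    simp_rw [avgDev, dev_eq X ht, ← Finset.sum_div, div_pow]
  simp_rw [e]
  rw [integral_div, integral_div, div_right_comm _ _ ((t : ℝ) ^ 2)]
  exact div_le_div_of_nonneg_right (div_pow_four_le ht (totalFourth_nonneg c) this) (by positivity)

theorem IsRun.indep_dev (h : IsRun c γ P X Wt) {t : ℕ} (ht : 1 ≤ t) {a b : Fin N} (hab : a ≠ b) :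
    IndepFun (fun ω => S.dev X t ω a) (fun ω => S.dev X t ω b) P := by
  have hd : Disjoint (({a} : Finset (Fin N)) ×ˢ Finset.Icc 1 t) ({b} ×ˢ Finset.Icc 1 t) := by
    rw [Finset.disjoint_product]
    left
    simpa using hab
  have hI := h.indep_noise.indepFun_finset _ _ hd h.measurable_noise
  have hcomp := hI.comp
    (φ := fun v => (∑ p, v p) / (t : ℝ)) (ψ := fun v => (∑ p, v p) / (t : ℝ))
    (by fun_prop) (by fun_prop)
  have e : ∀ a, (fun v : (({a} : Finset (Fin N)) ×ˢ Finset.Icc 1 t : Finset _) → ℝ =>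
      (∑ p, v p) / (t : ℝ)) ∘ (fun ω p => S.noise X p ω) = fun ω => S.dev X t ω a := by
    intro a
    ext ω
    simp only [Function.comp]
    rw [dev_eq X ht, Finset.sum_coe_sort (({a} : Finset (Fin N)) ×ˢ Finset.Icc 1 t)
      (fun p => S.noise X p ω), Finset.sum_product, Finset.sum_singleton]
  rw [e a, e b] at hcomp
  exact hcomp

theorem IsRun.integral_sq_sum_dev_sq_le [IsProbabilityMeasure P] (h : IsRun c γ P X Wt) {t : ℕ}
    (ht : 1 ≤ t) : ∫ ω, (∑ a ∈ members c, S.dev X t ω a ^ 2) ^ 2 ∂P ≤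
      (totalFourth c + 4 * totalVar c ^ 2) / (t : ℝ) ^ 2 := by
  refine (integral_sq_sum_sq_le (h.measurable_dev t) (h.memLp_dev ht)
    (fun a b hab => h.indep_dev ht hab) (members c)).trans ?_
  have h1 : ∑ a ∈ members c, ∫ ω, S.dev X t ω a ^ 4 ∂P ≤
      (totalFourth c + 3 * totalVar c ^ 2) / (t : ℝ) ^ 2 := by
    refine (Finset.sum_le_sum fun a _ => h.integral_dev_pow_four_le ht a).trans ?_
    rw [← Finset.sum_div, Finset.sum_add_distrib, ← Finset.mul_sum]
    have := Finset.sum_sq_le_sq_sum_of_nonneg (s := members c) (f := S.var) fun a _ => var_nonneg a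
    have e : totalFourth c = ∑ a ∈ members c, S.fourth a := rfl
    have e' : totalVar c = ∑ a ∈ members c, S.var a := rfl
    rw [e, e']
    gcongr
  simp_rw [h.integral_dev_sq ht, ← Finset.sum_div, div_pow]
  have e' : totalVar c = ∑ a ∈ members c, S.var a := rfl
  rw [← e']
  refine (add_le_add h1 le_rfl).trans (le_of_eq ?_)
  ring

/-- The anytime confidence bound: an average leaves some confidence interval of level `γ` with
probability at most `3 γ / 2`. -/
theorem IsRun.measure_beta_lt_dev_le [IsProbabilityMeasure P] (h : IsRun c γ P X Wt) {γ' : ℝ}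
    (hγ' : 0 < γ') (a : Fin N) :
    P {ω | ∃ s, 1 ≤ s ∧ S.beta γ' s ≤ |S.dev X s ω a|} ≤ ENNReal.ofReal (3 / 2 * γ') := by
  have hκ := kappa_nonneg (S := S) a
  have hσ := S.σ_pos
  refine measure_exists_le_of_moments (M := fun s => (S.κ + 3) * S.σ ^ 4 / (s : ℝ) ^ 2)
    (q := fun s => γ' / 2 * (1 / ((s : ℝ) * (1 + Real.log s ^ 2))))
    (fun s hs => integrable_pow_of_memLp_four (h.memLp_dev hs a) le_rfl) (fun s hs => ?_)
    (fun s hs => beta_pos hκ hγ' hs) (fun s => by positivity) (fun s hs => ?_) (fun k => ?_)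
  · refine (h.integral_dev_pow_four_le hs a).trans ?_
    have := fourth_add_le (S := S) a
    gcongr
  · have hs' : (0 : ℝ) < s := by exact_mod_cast hs
    rw [beta_pow_four hκ hγ']
    refine le_of_eq ?_
    have h3 : (S.κ + 3) * S.σ ^ 4 ≠ 0 := by positivity
    have h4 : (1 + Real.log s ^ 2) ≠ 0 := by positivity
    field_simp
  · rw [← Finset.mul_sum]
    have h1 : ∑ s ∈ Finset.range k, 1 / ((s : ℝ) * (1 + Real.log s ^ 2)) ≤
        ∑ s ∈ Finset.range k, 1 / (((s : ℝ) + 1) * (1 + Real.log ((s : ℝ) + 1) ^ 2)) := by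
      rcases k with _ | k
      · simp
      rw [Finset.sum_range_succ', Finset.sum_range_succ]
      simp only [Nat.cast_zero, zero_mul, div_zero, add_zero]
      push_cast
      have : 0 ≤ 1 / (((k : ℝ) + 1) * (1 + Real.log ((k : ℝ) + 1) ^ 2)) := by positivity
      linarith
    have := h1.trans (sum_inv_mul_one_add_log_sq_le k)
    nlinarith

/-- A single sample at time `s` is of order `√s`, simultaneously for all `s`: the fourth moment
makes the probabilities summable. -/
theorem IsRun.measure_sqrt_le_noise_le [IsProbabilityMeasure P] (h : IsRun c γ P X Wt) {K : ℝ}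
    (hK : 0 < K) (a : Fin N) :
    P {ω | ∃ s : ℕ, 1 ≤ s ∧ K * √(s : ℝ) ≤ |S.noise X (a, s) ω|} ≤
      ENNReal.ofReal (2 * (S.κ * S.σ ^ 4) / K ^ 4) := by
  have hκ := kappa_nonneg (S := S) a
  have hσ := S.σ_pos
  refine measure_exists_le_of_moments (M := fun _ => S.κ * S.σ ^ 4)
    (q := fun s => S.κ * S.σ ^ 4 / K ^ 4 * (if (0 : ℝ) < s then 1 / (s : ℝ) ^ 2 else 0))
    (fun s hs => integrable_pow_of_memLp_four (h.memLp_noise (a, s)) le_rfl) (fun s hs => ?_)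
    (fun s hs => ?_) (fun s => ?_) (fun s hs => ?_) (fun k => ?_)
  · rw [h.integral_noise (a, s) (f := fun x => x ^ 4) (by fun_prop)]
    exact S.fourth_moment_le a
  · have hs' : (0 : ℝ) < s := by exact_mod_cast hs
    positivity
  · split_ifs <;> positivity
  · have hs' : (0 : ℝ) < s := by exact_mod_cast hs
    rw [if_pos hs', mul_pow, show √(s : ℝ) ^ 4 = (√(s : ℝ) ^ 2) ^ 2 by ring,
      Real.sq_sqrt hs'.le]
    refine le_of_eq ?_
    field_simp
  · rw [← Finset.mul_sum]
    have h1 := sum_inv_sq_tail_le (T := 0) (x := 1) one_pos (le_max_left _ _) k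
    refine (mul_le_mul_of_nonneg_left h1 (by positivity)).trans (le_of_eq ?_)
    ring

end Run

/-! ### Reductions of the accuracy statement -/

theorem uniformOn_members_compl (c : S.Component) :
    uniformOn (members c : Set (Fin N)) (members c : Set (Fin N))ᶜ = 0 :=
  (uniformOn_eq_zero_iff (members c).finite_toSet).2 (Set.inter_compl_self _)

theorem uniformOn_members_singleton {c : S.Component} {a : Fin N} (ha : a ∈ members c) :
    uniformOn (members c : Set (Fin N)) {a} = (size c : ENNReal)⁻¹ := by
  classical
  have h := uniformOn_apply_finset (s := members c) (t := {a})
  rw [Finset.coe_singleton] at h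
  rw [h, Finset.inter_singleton_of_mem ha, Finset.card_singleton]
  simp [size]

/-- It suffices to bound, on average over the agents of the component, the probability of bad
events off which the estimates are accurate. -/
theorem accurateAfter_of_bad {c : S.Component} {α : ℕ → ℝ} {ε δ : ℝ} {τ : Fin N → ℝ}
    (hδ : 0 ≤ δ)
    (H : ∀ (Ω : Type u) [MeasurableSpace Ω] (P : Measure Ω) [IsProbabilityMeasure P]
      (X : Fin N → ℕ → Ω → ℝ) (Wt : ℕ → Ω → Matrix (Fin N) (Fin N) ℝ),
      IsRun c (level c δ) P X Wt → ∃ B : Fin N → Set Ω,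
        ∑ a ∈ members c, P (B a) ≤ ENNReal.ofReal (size c * δ) ∧
        ∀ a ∈ members c, ∀ ω ∉ B a, ∀ t : ℕ, τ a < t →
          |S.est α (fun s => empMean X s ω) (fun s => Wt s ω) t a - S.mean a| < ε) :
    AccurateAfter.{u} c α ε δ τ := by
  intro Ω _ P _ X Wt hrun
  obtain ⟨B, hB, hgood⟩ := H Ω P X Wt hrun
  have hU : IsProbabilityMeasure (uniformOn (members c : Set (Fin N))) :=
    isProbabilityMeasure_uniformOn (members c).finite_toSet (members_nonempty c)
  set G : Set (Fin N × Ω) := {p | ∀ t : ℕ, τ p.1 < t →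
    |S.est α (fun s => empMean X s p.2) (fun s => Wt s p.2) t p.1 - S.mean p.1| < ε} with hG
  set U := (uniformOn (members c : Set (Fin N))).prod P with hUP
  have hsub : Gᶜ ⊆ ((members c : Set (Fin N))ᶜ ×ˢ Set.univ) ∪
      ⋃ a ∈ members c, ({a} : Set (Fin N)) ×ˢ B a := by
    rintro ⟨a, ω⟩ hp
    by_cases ha : a ∈ members c
    · right
      refine Set.mem_biUnion ha ⟨rfl, ?_⟩
      by_contra hω
      exact hp fun t ht => hgood a ha ω hω t ht
    · left
      exact ⟨ha, trivial⟩
  have hn : (size c : ENNReal) ≠ 0 := by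
    have := one_le_size c
    exact_mod_cast (by omega : size c ≠ 0)
  have hbad : U Gᶜ ≤ ENNReal.ofReal δ := by
    refine (measure_mono hsub).trans ((measure_union_le _ _).trans ?_)
    rw [hUP, Measure.prod_prod, uniformOn_members_compl, zero_mul, zero_add]
    refine (measure_biUnion_finset_le _ _).trans ?_
    have : ∀ a ∈ members c, ((uniformOn (members c : Set (Fin N))).prod P) ({a} ×ˢ B a) =
        (size c : ENNReal)⁻¹ * P (B a) := fun a ha => by
      rw [Measure.prod_prod, uniformOn_members_singleton ha]
    rw [Finset.sum_congr rfl this, ← Finset.mul_sum]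
    refine (mul_le_mul_right hB _).trans ?_
    rw [ENNReal.ofReal_mul (by positivity), ENNReal.ofReal_natCast, ← mul_assoc,
      ENNReal.inv_mul_cancel hn (ENNReal.natCast_ne_top _), one_mul]
  have hone : (1 : ENNReal) ≤ U G + U Gᶜ := by
    have h := measure_union_le (μ := U) G Gᶜ
    rwa [Set.union_compl_self, measure_univ] at h
  rw [ENNReal.ofReal_sub _ hδ, ENNReal.ofReal_one]
  exact tsub_le_iff_right.2 (hone.trans (add_le_add le_rfl hbad))

theorem AccurateAfter.mono {c : S.Component} {α : ℕ → ℝ} {ε ε' δ : ℝ} {τ τ' : Fin N → ℝ}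
    (h : AccurateAfter.{u} c α ε δ τ) (hε : ε ≤ ε') (hτ : ∀ a ∈ members c, τ a ≤ τ' a) :
    AccurateAfter.{u} c α ε' δ τ' := by
  intro Ω _ P _ X Wt hrun
  refine (h Ω P X Wt hrun).trans ?_
  set U := (uniformOn (members c : Set (Fin N))).prod P with hUP
  have h0 : U ((members c : Set (Fin N))ᶜ ×ˢ Set.univ) = 0 := by
    rw [hUP, Measure.prod_prod, uniformOn_members_compl, zero_mul]
  rw [← add_zero (U {p | ∀ t : ℕ, τ' p.1 < t → _}), ← h0]
  refine (measure_mono ?_).trans (measure_union_le _ _)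
  rintro ⟨a, ω⟩ hp
  by_cases ha : a ∈ members c
  · left
    intro t ht
    exact (hp t ((hτ a ha).trans_lt ht)).trans_le hε
  · right
    exact ⟨ha, trivial⟩

/-- From an absolute constant at small accuracies, and large constants at large accuracies, to one
constant for all accuracies. -/
theorem exists_const_of_small_of_large {c : S.Component} {α : ℕ → ℝ} {q C₀ : ℝ} {T : ℝ → ℝ}
    {τ : ℝ → ℝ → ℝ → Fin N → ℝ} (hC₀ : 0 < C₀) (hq : 0 < q)
    (hτ : ∀ C ε δ a, a ∈ members c →
      τ C ε δ a = max (S.zeta a δ : ℝ) (T (C * (q / (ε ^ 4 * δ)))))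
    (hT : ∀ x y, 1 ≤ x → x ≤ y → T x ≤ T y)
    (small : ∃ ε₀ : ℝ, 0 < ε₀ ∧ ∀ ε δ : ℝ, 0 < ε → ε ≤ ε₀ → 0 < δ → δ < 1 →
      AccurateAfter.{u} c α ε δ (τ C₀ ε δ))
    (large : ∃ ε₁ : ℝ, 0 < ε₁ ∧ ∃ C₁ : ℝ, 0 < C₁ ∧ ∀ C, C₁ ≤ C → ∀ ε δ : ℝ, ε₁ ≤ ε → 0 < δ →
      δ < 1 → AccurateAfter.{u} c α ε δ (τ C ε δ)) :
    ∃ C : ℝ, 0 < C ∧ ∀ ε δ : ℝ, 0 < ε → 0 < δ → δ < 1 →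
      AccurateAfter.{u} c α ε δ (τ C ε δ) := by
  obtain ⟨ε₀, hε₀, hsmall⟩ := small
  obtain ⟨ε₁, hε₁, C₁, hC₁, hlarge⟩ := large
  set ε₂ := min ε₀ (min 1 (C₀ * q)) with hε₂
  have h2pos : 0 < ε₂ := lt_min hε₀ (lt_min one_pos (mul_pos hC₀ hq))
  have h2one : ε₂ ≤ 1 := (min_le_right _ _).trans (min_le_left _ _)
  have h2q : ε₂ ^ 4 ≤ C₀ * q :=
    (pow_le_of_le_one h2pos.le h2one (by norm_num)).trans
      ((min_le_right _ _).trans (min_le_right _ _))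
  refine ⟨max C₁ (max C₀ (C₀ * ε₁ ^ 4 / ε₂ ^ 4)), lt_max_of_lt_left hC₁, ?_⟩
  set C := max C₁ (max C₀ (C₀ * ε₁ ^ 4 / ε₂ ^ 4)) with hC
  intro ε δ hε hδ hδ1
  rcases le_total ε₁ ε with h | h
  · exact hlarge C (le_max_left _ _) ε δ h hδ hδ1
  · have hmin : 0 < min ε ε₂ := lt_min hε h2pos
    refine (hsmall (min ε ε₂) δ hmin ((min_le_right _ _).trans (min_le_left _ _)) hδ hδ1).mono
      (min_le_left _ _) fun a ha => ?_
    rw [hτ _ _ _ a ha, hτ _ _ _ a ha]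
    refine max_le_max le_rfl (hT _ _ ?_ ?_)
    · have hm4 : min ε ε₂ ^ 4 ≤ C₀ * q :=
        (pow_le_pow_left₀ hmin.le (min_le_right _ _) 4).trans h2q
      rw [← mul_div_assoc, one_le_div (by positivity)]
      nlinarith [pow_pos hmin 4]
    · have hkey : C₀ / min ε ε₂ ^ 4 ≤ C / ε ^ 4 := by
        rcases le_total ε ε₂ with h' | h'
        · rw [min_eq_left h']
          have : C₀ ≤ C := (le_max_left _ _).trans (le_max_right _ _)
          gcongr
        · rw [min_eq_right h']
          have h3 : C₀ * ε₁ ^ 4 / ε₂ ^ 4 ≤ C := (le_max_right _ _).trans (le_max_right _ _)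
          rw [le_div_iff₀ (by positivity)]
          refine le_trans ?_ h3
          rw [div_mul_eq_mul_div]
          gcongr
      have e : ∀ A e : ℝ, A * (q / (e ^ 4 * δ)) = A / e ^ 4 * (q / δ) := fun A e => by
        rw [div_mul_div_comm, mul_div_assoc]
      rw [e, e]
      gcongr

/-! ### Large accuracies -/

/-- The memory forgets slowly growing errors: averages of `1 / √s` are of order `1 / √t`. -/
def ForgetsAtRate (α : ℕ → ℝ) : Prop :=
  ∃ (b : ℕ → ℝ) (K : ℝ), 0 < K ∧ (∀ t, 0 < b t) ∧
    (∀ t : ℕ, (1 - α t) * (1 / √((t + 1 : ℕ) : ℝ)) + α t * b t ≤ b (t + 1)) ∧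
    ∀ t : ℕ, 1 ≤ t → b t ≤ K / √(t : ℝ)

theorem forgetsAtRate_average : ForgetsAtRate fun t => (t : ℝ) / (t + 1) := by
  refine ⟨fun t => 3 / √((t : ℝ) + 1), 3, by norm_num, fun t => by positivity, fun t => ?_,
    fun t ht => ?_⟩
  · push_cast
    have hu : (0 : ℝ) < (t : ℝ) + 1 := by positivity
    have ht : (0 : ℝ) ≤ t := t.cast_nonneg
    have e : (1 - (t : ℝ) / (t + 1)) * (1 / √((t : ℝ) + 1)) +
        (t : ℝ) / (t + 1) * (3 / √((t : ℝ) + 1)) = (1 + 3 * t) / ((t + 1) * √((t : ℝ) + 1)) := by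
      have : √((t : ℝ) + 1) ≠ 0 := by positivity
      field_simp
      ring
    rw [e, div_le_div_iff₀ (by positivity) (by positivity)]
    refine abs_le_of_sq_le_sq' ?_ (by positivity) |>.2
    rw [mul_pow, mul_pow, mul_pow, Real.sq_sqrt (by positivity), Real.sq_sqrt (by positivity)]
    nlinarith [mul_nonneg ht ht]
  · have : (0 : ℝ) < t := by exact_mod_cast ht
    have h1 : 0 < √(t : ℝ) := Real.sqrt_pos.2 this
    have h2 : √(t : ℝ) ≤ √((t : ℝ) + 1) := Real.sqrt_le_sqrt (by linarith)
    exact div_le_div_of_nonneg_left (by norm_num) h1 h2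

theorem forgetsAtRate_const {α : ℝ} (h0 : 0 < α) (h1 : α < 1) : ForgetsAtRate fun _ => α := by
  -- a shift `A` of time such that `√((x + 1) / x) ≤ (1 + α) / (2 α)` for all `x ≥ A`
  set A : ℝ := 4 * α ^ 2 / (1 - α) with hA
  have hA0 : 0 < A := by
    have : 0 < 1 - α := by linarith
    positivity
  have hAα : A * (1 - α) = 4 * α ^ 2 := div_mul_cancel₀ _ (by linarith)
  have hAs : 0 < √(A + 1) := Real.sqrt_pos.2 (by linarith)
  refine ⟨fun t => 2 * √(A + 1) / √((t : ℝ) + A), 2 * √(A + 1), by positivity,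
    fun t => by positivity, fun t => ?_, fun t ht => ?_⟩
  · push_cast
    have ht : (0 : ℝ) ≤ t := t.cast_nonneg
    have hx : 0 < √((t : ℝ) + A) := Real.sqrt_pos.2 (by linarith)
    have hx1 : 0 < √((t : ℝ) + 1 + A) := Real.sqrt_pos.2 (by linarith)
    have hx2 : 0 < √((t : ℝ) + 1) := Real.sqrt_pos.2 (by linarith)
    have ea : 1 / √((t : ℝ) + 1) ≤ √(A + 1) / √((t : ℝ) + 1 + A) := by
      rw [div_le_div_iff₀ hx2 hx1, one_mul, ← Real.sqrt_mul (by linarith)]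
      refine Real.sqrt_le_sqrt ?_
      nlinarith
    have eb : α * (1 / √((t : ℝ) + A)) ≤ (1 + α) / 2 * (1 / √((t : ℝ) + 1 + A)) := by
      rw [mul_one_div, mul_one_div, div_le_div_iff₀ hx hx1]
      refine abs_le_of_sq_le_sq' ?_ (by positivity) |>.2
      rw [mul_pow, mul_pow, Real.sq_sqrt (by linarith), Real.sq_sqrt (by linarith)]
      nlinarith [mul_nonneg ht (sq_nonneg (1 - α)), mul_nonneg ht h0.le, mul_pos hA0 h0,
        mul_pos hA0 (sub_pos.2 h1)]
    have e1 := mul_le_mul_of_nonneg_left ea (by linarith : 0 ≤ 1 - α)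
    have e2 := mul_le_mul_of_nonneg_left eb (by positivity : 0 ≤ 2 * √(A + 1))
    calc (1 - α) * (1 / √((t : ℝ) + 1)) + α * (2 * √(A + 1) / √((t : ℝ) + A))
        = (1 - α) * (1 / √((t : ℝ) + 1)) + 2 * √(A + 1) * (α * (1 / √((t : ℝ) + A))) := by ring
      _ ≤ (1 - α) * (√(A + 1) / √((t : ℝ) + 1 + A)) +
          2 * √(A + 1) * ((1 + α) / 2 * (1 / √((t : ℝ) + 1 + A))) := add_le_add e1 e2
      _ = 2 * √(A + 1) / √((t : ℝ) + 1 + A) := by ring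
  · have : (0 : ℝ) < t := by exact_mod_cast ht
    have h1 : 0 < √(t : ℝ) := Real.sqrt_pos.2 this
    have h2 : √(t : ℝ) ≤ √((t : ℝ) + A) := Real.sqrt_le_sqrt (by linarith)
    exact div_le_div_of_nonneg_left (by positivity) h1 h2

section Run

variable {c : S.Component} {γ : ℝ} {Ω : Type*} [MeasurableSpace Ω] {P : Measure Ω}
  {X : Fin N → ℕ → Ω → ℝ} {Wt : ℕ → Ω → Matrix (Fin N) (Fin N) ℝ}

variable (S) in
/-- The sum of the absolute deviations of all agents. -/
noncomputable def absDev {Ω : Type*} (X : Fin N → ℕ → Ω → ℝ) (t : ℕ) (ω : Ω) : ℝ :=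
  ∑ a, |S.dev X t ω a|

theorem IsRun.memLp_absDev [IsProbabilityMeasure P] (h : IsRun c γ P X Wt) {t : ℕ} (ht : 1 ≤ t) :
    MemLp (S.absDev X t) 4 P :=
  memLp_finsetSum _ fun a _ => (h.memLp_dev ht a).abs

theorem IsRun.integral_absDev_pow_four_le [IsProbabilityMeasure P] (h : IsRun c γ P X Wt) {L : ℝ}
    (hL : 0 < L) (hL4 : (S.κ + 3) * S.σ ^ 4 ≤ L ^ 4) {t : ℕ} (ht : 1 ≤ t) :
    ∫ ω, S.absDev X t ω ^ 4 ∂P ≤ (N * (L * (1 / √(t : ℝ)))) ^ 4 := by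
  have ht' : (0 : ℝ) < t := by exact_mod_cast ht
  have hs := integral_pow_four_sum_le (P := P) Finset.univ (w := fun _ => 1)
    (b := fun _ : Fin N => L * (1 / √(t : ℝ))) (f := fun a ω => |S.dev X t ω a|)
    (fun _ _ => zero_le_one) (fun _ _ => by positivity)
    (fun a _ => integrable_pow_of_memLp_four (h.memLp_dev ht a).abs le_rfl) (fun a _ => by
      simp_rw [Even.pow_abs (n := 4) (by decide)]
      refine (h.integral_dev_pow_four_le ht a).trans ?_
      rw [mul_pow, div_pow, one_pow, show √(t : ℝ) ^ 4 = (√(t : ℝ) ^ 2) ^ 2 by ring,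
        Real.sq_sqrt ht'.le, mul_one_div]
      have := (fourth_add_le (S := S) a).trans hL4
      gcongr)
  simpa [absDev] using hs

theorem IsRun.smooth_absDev [IsProbabilityMeasure P] (h : IsRun c γ P X Wt) {α : ℕ → ℝ}
    (h0 : ∀ t, 0 ≤ α t) (h1 : ∀ t, α t ≤ 1) {b : ℕ → ℝ} (hb : ∀ t, 0 < b t)
    (hrec : ∀ t : ℕ, (1 - α t) * (1 / √((t + 1 : ℕ) : ℝ)) + α t * b t ≤ b (t + 1)) {L : ℝ}
    (hL : 0 < L) (hL4 : (S.κ + 3) * S.σ ^ 4 ≤ L ^ 4) (hN : 0 < N) (t : ℕ) :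
    MemLp (fun ω => smooth α (fun s => S.absDev X s ω) t) 4 P ∧
    ∫ ω, smooth α (fun s => S.absDev X s ω) t ^ 4 ∂P ≤ (N * L * b t) ^ 4 := by
  have hN' : (0 : ℝ) < N := by exact_mod_cast hN
  induction t with
  | zero =>
    have := hb 0
    simp only [smooth]
    exact ⟨MemLp.zero, by simp; positivity⟩
  | succ t ih =>
    obtain ⟨ihm, ihi⟩ := ih
    have hy := h.memLp_absDev (t := t + 1) (by omega)
    refine ⟨(hy.const_mul _).add (ihm.const_mul _), ?_⟩
    have hs := integral_pow_four_sum_le (P := P) Finset.univ (w := ![1 - α t, α t])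
      (b := ![N * (L * (1 / √((t + 1 : ℕ) : ℝ))), N * L * b t])
      (f := ![S.absDev X (t + 1), fun ω => smooth α (fun s => S.absDev X s ω) t])
      (by intro i _; fin_cases i
          · exact sub_nonneg.2 (h1 t)
          · exact h0 t)
      (by intro i _; fin_cases i
          · show 0 < N * (L * (1 / √((t + 1 : ℕ) : ℝ)))
            positivity
          · show 0 < N * L * b t
            have := hb t
            positivity)
      (by intro i _; fin_cases i
          · exact integrable_pow_of_memLp_four hy le_rfl
          · exact integrable_pow_of_memLp_four ihm le_rfl)
      (by intro i _; fin_cases i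
          · exact h.integral_absDev_pow_four_le hL hL4 (t := t + 1) (by omega)
          · exact ihi)
    simp only [Fin.sum_univ_two, Matrix.cons_val_zero, Matrix.cons_val_one] at hs
    refine hs.trans (pow_le_pow_left₀ ?_ ?_ 4)
    · have := hb t
      have := h0 t
      have := sub_nonneg.2 (h1 t)
      positivity
    · have := mul_le_mul_of_nonneg_left (hrec t) (by positivity : (0 : ℝ) ≤ N * L)
      refine le_trans (le_of_eq ?_) this
      ring

end Run

/-- A bound on the distance of all initial estimates and all means from a given number. -/
theorem exists_spread (m : ℝ) :
    ∃ D : ℝ, 0 ≤ D ∧ (∀ b, |S.init b - m| ≤ D) ∧ ∀ b, |S.mean b - m| ≤ D := by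
  refine ⟨∑ b, |S.init b - m| + ∑ b, |S.mean b - m|, by positivity, fun b => ?_, fun b => ?_⟩
  · have h := Finset.single_le_sum (f := fun b => |S.init b - m|) (fun b _ => abs_nonneg _)
      (Finset.mem_univ b)
    exact h.trans (le_add_of_nonneg_right (by positivity))
  · have h := Finset.single_le_sum (f := fun b => |S.mean b - m|) (fun b _ => abs_nonneg _)
      (Finset.mem_univ b)
    exact h.trans (le_add_of_nonneg_left (by positivity))

theorem abs_dev_le_absDev {Ω : Type*} (X : Fin N → ℕ → Ω → ℝ) (t : ℕ) (ω : Ω) (a : Fin N) :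
    |S.dev X t ω a| ≤ S.absDev X t ω :=
  Finset.single_le_sum (f := fun a => |S.dev X t ω a|) (fun _ _ => abs_nonneg _)
    (Finset.mem_univ a)

theorem IsRun.abs_est_sub_le_smooth {c : S.Component} {γ : ℝ} {Ω : Type*} [MeasurableSpace Ω]
    {P : Measure Ω} {X : Fin N → ℕ → Ω → ℝ} {Wt : ℕ → Ω → Matrix (Fin N) (Fin N) ℝ}
    (h : IsRun c γ P X Wt) {α : ℕ → ℝ} (h0 : ∀ t, 0 ≤ α t) (h1 : ∀ t, α t ≤ 1) {m D : ℝ}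
    (hinit : ∀ b, |S.init b - m| ≤ D) (hmean : ∀ b, |S.mean b - m| ≤ D) (ω : Ω) (t : ℕ)
    (a : Fin N) : |S.est α (fun s => empMean X s ω) (fun s => Wt s ω) t a - m| ≤
      D + smooth α (fun s => S.absDev X s ω) t := by
  refine abs_est_sub_le h0 h1 (fun t => h.weight_nonneg t ω) (fun t => h.weight_row_sum t ω)
    hinit (fun s _ b => ?_) t a
  have e : empMean X s ω b - m = (S.mean b - m) + S.dev X s ω b := by
    simp only [dev]
    ring
  rw [e]
  exact (abs_add_le _ _).trans (add_le_add (hmean b) (abs_dev_le_absDev X s ω b))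

/-- At accuracies coarser than the spread of the means and of the initial estimates, neither the
identification nor the weights matter: the time averages of all deviations are small. -/
theorem accurateAfter_large {c : S.Component} {α : ℕ → ℝ} (h0 : ∀ t, 0 ≤ α t)
    (h1 : ∀ t, α t ≤ 1) (hα : ForgetsAtRate α) {q : ℝ} (hq : 0 < q) {T : ℝ → ℝ}
    {τ : ℝ → ℝ → ℝ → Fin N → ℝ}
    (hτ : ∀ C ε δ a, a ∈ members c →
      τ C ε δ a = max (S.zeta a δ : ℝ) (T (C * (q / (ε ^ 4 * δ)))))
    (hT : ∀ x, 0 < x → x ≤ max 1 (T x)) :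
    ∃ ε₁ : ℝ, 0 < ε₁ ∧ ∃ C₁ : ℝ, 0 < C₁ ∧ ∀ C, C₁ ≤ C → ∀ ε δ : ℝ, ε₁ ≤ ε → 0 < δ → δ < 1 →
      AccurateAfter.{u} c α ε δ (τ C ε δ) := by
  obtain ⟨a₀, ha₀⟩ := members_nonempty c
  obtain ⟨D, hD, hinit, hmean⟩ := exists_spread (S := S) (S.mean a₀)
  obtain ⟨b, K, hK, hb, hrec, hbK⟩ := hα
  have hκ := kappa_nonneg (S := S) a₀
  have hσ := S.σ_pos
  have hN : 0 < N := a₀.pos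
  have hN' : (0 : ℝ) < N := by exact_mod_cast hN
  set L := 1 + (S.κ + 3) * S.σ ^ 4 with hLdef
  have hL1 : 1 ≤ L := le_add_of_nonneg_right (by positivity)
  have hL4 : (S.κ + 3) * S.σ ^ 4 ≤ L ^ 4 :=
    (le_add_of_nonneg_left zero_le_one).trans (le_self_pow₀ hL1 (by norm_num))
  have hL : 0 < L := by linarith
  refine ⟨2 * D + 1, by positivity, 32 * (N * L * K) ^ 4 / q, by positivity,
    fun C hC ε δ hε hδ hδ1 => accurateAfter_of_bad hδ.le ?_⟩
  intro Ω _ P _ X Wt hrun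
  have hε0 : 0 < ε := by linarith
  have hC0 : 0 < C := lt_of_lt_of_le (by positivity) hC
  set x := C * (q / (ε ^ 4 * δ)) with hx
  have hx0 : 0 < x := by positivity
  refine ⟨fun _ => {ω | ∃ t : ℕ, (T x < t ∧ 1 ≤ t) ∧
    ε / 2 ≤ |smooth α (fun s => S.absDev X s ω) t|}, ?_, fun a ha ω hω t ht => ?_⟩
  · have hP : P {ω | ∃ t : ℕ, (T x < t ∧ 1 ≤ t) ∧
        ε / 2 ≤ |smooth α (fun s => S.absDev X s ω) t|} ≤ ENNReal.ofReal δ := by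
      refine measure_exists_le_of_moments (M := fun t : ℕ => (N * L * K) ^ 4 / (t : ℝ) ^ 2)
        (q := fun t : ℕ => 16 * (N * L * K) ^ 4 / ε ^ 4 *
          (if T x < t then 1 / (t : ℝ) ^ 2 else 0))
        (fun t _ => integrable_pow_of_memLp_four
          (hrun.smooth_absDev h0 h1 hb hrec hL hL4 hN t).1 le_rfl)
        (fun t ht => ?_) (fun _ _ => by positivity) (fun t => by split_ifs <;> positivity)
        (fun t ht => ?_) (fun k => ?_)
      · refine (hrun.smooth_absDev h0 h1 hb hrec hL hL4 hN t).2.trans ?_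
        have ht' : (0 : ℝ) < t := by exact_mod_cast ht.2
        have hbt := hb t
        have e : (N * L * K) ^ 4 / (t : ℝ) ^ 2 = (N * L * (K / √(t : ℝ))) ^ 4 := by
          rw [← mul_div_assoc, div_pow, show √(t : ℝ) ^ 4 = (√(t : ℝ) ^ 2) ^ 2 by ring,
            Real.sq_sqrt ht'.le]
        rw [e]
        have := hbK t ht.2
        gcongr
      · rw [if_pos ht.1]
        have ht' : (0 : ℝ) < t := by exact_mod_cast ht.2
        refine le_of_eq ?_
        field_simp
        norm_num
      · rw [← Finset.mul_sum]
        refine (mul_le_mul_of_nonneg_left (sum_inv_sq_tail_le hx0 (hT x hx0) k)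
          (by positivity)).trans ?_
        rw [div_le_iff₀ hq] at hC
        rw [hx, div_mul_div_comm, div_le_iff₀ (by positivity)]
        have e : δ * (ε ^ 4 * (C * (q / (ε ^ 4 * δ)))) = C * q := by field_simp
        rw [e]
        linarith
    rw [Finset.sum_const, nsmul_eq_mul, ENNReal.ofReal_mul (by positivity),
      ENNReal.ofReal_natCast]
    exact mul_le_mul_right hP _
  · rw [hτ _ _ _ a ha, max_lt_iff] at ht
    have h1t : 1 ≤ t := by
      have h1 : (0 : ℝ) ≤ S.zeta a δ := Nat.cast_nonneg _
      have : (0 : ℝ) < t := lt_of_le_of_lt h1 ht.1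
      exact_mod_cast this
    have hlt : |smooth α (fun s => S.absDev X s ω) t| < ε / 2 := by
      by_contra hcon
      exact hω ⟨t, ⟨ht.2, h1t⟩, not_lt.1 hcon⟩
    have hle := hrun.abs_est_sub_le_smooth h0 h1 hinit hmean ω t a
    rw [mean_eq_of_mem ha ha₀]
    have := le_abs_self (smooth α (fun s => S.absDev X s ω) t)
    linarith

/-! ### The convergence time `g` -/

theorem le_g {x : ℝ} (hx : 1 ≤ x) : x ≤ g x := by
  have hl : Real.log (Real.exp 1 * x) = 1 + Real.log x := by
    rw [Real.log_mul (Real.exp_ne_zero _) (by positivity), Real.log_exp]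
  have := Real.log_nonneg hx
  rw [g, hl]
  nlinarith [mul_nonneg (by linarith : 0 ≤ x) (by positivity : 0 ≤ 2 * Real.log x + Real.log x ^ 2)]

theorem g_mono {x y : ℝ} (hx : 1 ≤ x) (hxy : x ≤ y) : g x ≤ g y := by
  have hl : ∀ z : ℝ, 1 ≤ z → Real.log (Real.exp 1 * z) = 1 + Real.log z := fun z hz => by
    rw [Real.log_mul (Real.exp_ne_zero _) (by positivity), Real.log_exp]
  have h1 := Real.log_nonneg hx
  have h2 := Real.log_le_log (by linarith) hxy
  have hy : 0 ≤ y := by linarith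
  rw [g, g, hl x hx, hl y (hx.trans hxy)]
  gcongr

theorem le_max_one_g (x : ℝ) : x ≤ max 1 (g x) := by
  rcases le_total 1 x with h | h
  · exact (le_g h).trans (le_max_right _ _)
  · exact h.trans (le_max_left _ _)

theorem mul_sq_one_sub_log_le {θ : ℝ} (h0 : 0 < θ) (h1 : θ ≤ 1) :
    θ * (1 - Real.log θ) ^ 2 ≤ 4 := by
  have hs : 0 < √θ := Real.sqrt_pos.2 h0
  have hs1 : √θ ≤ 1 := Real.sqrt_le_one.2 h1
  have hsq : √θ ^ 2 = θ := Real.sq_sqrt h0.le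
  have hlog : Real.log θ = 2 * Real.log √θ := by
    conv_lhs => rw [← hsq]
    rw [Real.log_pow]
    norm_num
  have hl : 1 - (√θ)⁻¹ ≤ Real.log √θ := Real.one_sub_inv_le_log_of_pos hs
  have hl0 : Real.log θ ≤ 0 := Real.log_nonpos h0.le h1
  have h2 : √θ * (1 - Real.log θ) ≤ 2 := by
    rw [hlog]
    have : √θ * (√θ)⁻¹ = 1 := mul_inv_cancel₀ hs.ne'
    nlinarith
  have h3 : 0 ≤ √θ * (1 - Real.log θ) := mul_nonneg hs.le (by linarith)
  calc θ * (1 - Real.log θ) ^ 2 = (√θ * (1 - Real.log θ)) ^ 2 := by rw [mul_pow, hsq]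
    _ ≤ 2 ^ 2 := by gcongr
    _ = 4 := by norm_num

/-- The function `g` is not monotone near `0`, but it is of the order of its argument up to
logarithms. -/
theorem g_le_of_le_mul {K x v : ℝ} (hK : 0 < K) (hx0 : 0 ≤ x) (hv : 0 ≤ v) (hx : x ≤ K * v) :
    g x ≤ 4 * K * (1 + |Real.log K|) ^ 2 * v * (1 + |Real.log v|) ^ 2 := by
  rcases hx0.eq_or_lt with rfl | hpos
  · simp only [g, zero_mul]
    positivity
  have hKv : 0 < K * v := hpos.trans_le hx
  have hv' : 0 < v := pos_of_mul_pos_right hKv hK.le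
  set θ := x / (K * v) with hθ
  have hθ0 : 0 < θ := by positivity
  have hθ1 : θ ≤ 1 := (div_le_one hKv).2 hx
  have hxθ : x = θ * (K * v) := (div_mul_cancel₀ _ hKv.ne').symm
  have hlogθ : Real.log θ ≤ 0 := Real.log_nonpos hθ0.le hθ1
  have hl : Real.log (Real.exp 1 * x) = 1 + Real.log θ + Real.log K + Real.log v := by
    rw [Real.log_mul (Real.exp_ne_zero _) hpos.ne', Real.log_exp, hxθ,
      Real.log_mul hθ0.ne' hKv.ne', Real.log_mul hK.ne' hv'.ne']
    ring
  have habs : |Real.log (Real.exp 1 * x)| ≤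
      (1 - Real.log θ) * (1 + |Real.log K|) * (1 + |Real.log v|) := by
    rw [hl]
    have a1 := abs_nonneg (Real.log K)
    have a2 := abs_nonneg (Real.log v)
    have a3 : 0 ≤ -Real.log θ := by linarith
    have b1 := abs_le.1 (le_refl |Real.log K|)
    have b2 := abs_le.1 (le_refl |Real.log v|)
    have e : (1 - Real.log θ) * (1 + |Real.log K|) * (1 + |Real.log v|) =
        1 + -Real.log θ + |Real.log K| + |Real.log v| + (-Real.log θ * |Real.log K| +
          -Real.log θ * |Real.log v| + |Real.log K| * |Real.log v| +
          -Real.log θ * |Real.log K| * |Real.log v|) := by ring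
    have : 0 ≤ -Real.log θ * |Real.log K| + -Real.log θ * |Real.log v| +
        |Real.log K| * |Real.log v| + -Real.log θ * |Real.log K| * |Real.log v| := by positivity
    rw [e]
    exact abs_le.2 ⟨by linarith, by linarith⟩
  calc g x = x * |Real.log (Real.exp 1 * x)| ^ 2 := by rw [g, sq_abs]
    _ ≤ x * ((1 - Real.log θ) * (1 + |Real.log K|) * (1 + |Real.log v|)) ^ 2 := by gcongr
    _ = (θ * (1 - Real.log θ) ^ 2) * (K * (1 + |Real.log K|) ^ 2 * v * (1 + |Real.log v|) ^ 2) := by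
        rw [hxθ]
        ring
    _ ≤ 4 * (K * (1 + |Real.log K|) ^ 2 * v * (1 + |Real.log v|) ^ 2) := by
        have := mul_sq_one_sub_log_le hθ0 hθ1
        gcongr
    _ = _ := by ring

theorem avgMoment_nonneg (c : S.Component) : 0 ≤ avgMoment c :=
  integral_nonneg fun _ => by positivity

theorem avgMoment_le (c : S.Component) : avgMoment c ≤ (S.κ + 3) * S.σ ^ 4 := by
  have hn : (1 : ℝ) ≤ size c := by exact_mod_cast one_le_size c
  have hκ := kappa_nonneg_of_component c
  have hσ := S.σ_pos
  have h1 := (avgMoment_bounds c).2.2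
  have h4 : totalFourth c ≤ size c * (S.κ * S.σ ^ 4) := by
    have := Finset.sum_le_card_nsmul (members c) S.fourth _ fun a _ => S.fourth_moment_le a
    rwa [nsmul_eq_mul] at this
  have h2 : totalVar c ≤ size c * S.σ ^ 2 := by
    have := Finset.sum_le_card_nsmul (members c) S.var _ fun a _ => S.variance_le a
    rwa [nsmul_eq_mul] at this
  have h2' := pow_le_pow_left₀ (totalVar_nonneg c) h2 2
  have h3 : size c * (S.κ * S.σ ^ 4) ≤ (size c : ℝ) ^ 2 * (S.κ * S.σ ^ 4) := by
    refine mul_le_mul_of_nonneg_right ?_ (by positivity)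
    nlinarith
  have hfin : (size c : ℝ) ^ 2 * avgMoment c ≤ (size c : ℝ) ^ 2 * ((S.κ + 3) * S.σ ^ 4) := by
    refine h1.trans ?_
    have e : ((size c : ℝ) * S.σ ^ 2) ^ 2 = (size c : ℝ) ^ 2 * S.σ ^ 4 := by ring
    rw [e] at h2'
    nlinarith
  exact le_of_mul_le_mul_left hfin (by positivity)

theorem avgTime_le {C : ℝ} (hC : 0 < C) (c : S.Component) {ε δ : ℝ} (hε : 0 < ε) (hδ : 0 < δ) :
    avgTime c C ε δ ≤ 4 * C * (1 + |Real.log C|) ^ 2 * ((S.nTilde ε δ : ℝ) / size c) *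
      (1 + |Real.log ((S.nTilde ε δ : ℝ) / size c)|) ^ 2 := by
  have hn : (1 : ℝ) ≤ size c := by exact_mod_cast one_le_size c
  have hκ := kappa_nonneg_of_component c
  have hσ := S.σ_pos
  have hA := avgMoment_nonneg c
  refine g_le_of_le_mul hC (by positivity) (by positivity) ?_
  refine mul_le_mul_of_nonneg_left ?_ hC.le
  have hceil : 2 * (S.κ + 3) * S.σ ^ 4 / (δ * ε ^ 4) ≤ S.nTilde ε δ := Nat.le_ceil _
  calc avgMoment c / (size c * ε ^ 4 * δ) ≤ 2 * (S.κ + 3) * S.σ ^ 4 / (size c * ε ^ 4 * δ) := by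
        have h := avgMoment_le c
        have : 0 ≤ (S.κ + 3) * S.σ ^ 4 := by positivity
        gcongr
        linarith
    _ = 2 * (S.κ + 3) * S.σ ^ 4 / (δ * ε ^ 4) / size c := by
        field_simp
    _ ≤ S.nTilde ε δ / size c := by gcongr

/-! ### Regular paths -/

/-- The confidence parameter at which all agents are in their confidence intervals except with
probability a small multiple of `δ`. -/
noncomputable def jointLevel (N : ℕ) (δ : ℝ) : ℝ := δ / (64 * N)

variable (S) in
/-- A constant of the system for bounds on deviations that hold for all agents simultaneously,
except with probability a small multiple of `δ`. -/
noncomputable def devConst : ℝ := 1 + 128 * N * ((S.κ + 3) * S.σ ^ 4)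

/-- The paths on which all deviations are as small as they are with high probability. The fourth
root of `δ` is written as an iterated square root. -/
structure RegularPath (c : S.Component) (δ : ℝ) {Ω : Type*} (X : Fin N → ℕ → Ω → ℝ) (ω : Ω) :
    Prop where
  /-- the agents of the component and their neighbours are in the intervals of the algorithm -/
  dev_le : ∀ a ∈ members c, ∀ b, b = a ∨ S.G.Adj a b → ∀ s, 1 ≤ s →
    |S.dev X s ω b| ≤ S.beta (level c δ) s
  /-- all agents are in slightly larger intervals -/
  dev_le_joint : ∀ b s, 1 ≤ s → |S.dev X s ω b| ≤ S.beta (jointLevel N δ) s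
  /-- single samples grow slowly -/
  noise_le : ∀ (b : Fin N) (s : ℕ), 1 ≤ s → |S.noise X (b, s) ω| ≤ S.devConst / √√δ * √(s : ℝ)

theorem one_le_devConst (hκ : 0 ≤ S.κ) : 1 ≤ S.devConst := by
  have := S.σ_pos
  exact le_add_of_nonneg_right (by positivity)

theorem le_devConst_pow_four (hκ : 0 ≤ S.κ) :
    128 * N * ((S.κ + 3) * S.σ ^ 4) ≤ S.devConst ^ 4 :=
  le_trans (le_add_of_nonneg_left zero_le_one)
    (le_self_pow₀ (one_le_devConst hκ) (by norm_num : 4 ≠ 0))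

/-- The agents of a component and their neighbours. -/
theorem exists_finset_closed_nbhd (c : S.Component) :
    ∃ A : Finset (Fin N), (A.card : ℝ) ≤ 2 * S.r * size c ∧
      ∀ a ∈ members c, ∀ b, b = a ∨ S.G.Adj a b → b ∈ A := by
  classical
  refine ⟨(members c).biUnion fun a => insert a (Finset.univ.filter fun b => S.G.Adj a b), ?_, ?_⟩
  · have hcard := Finset.card_biUnion_le_card_mul (members c)
      (fun a => insert a (Finset.univ.filter fun b => S.G.Adj a b)) (2 * S.r) fun a _ => by
        have h1 : (Finset.univ.filter fun b => S.G.Adj a b).card ≤ S.r := by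
          refine le_trans (le_of_eq ?_) (S.degree_le a)
          rw [← Set.ncard_coe_finset]
          congr 1
          ext b
          simp
        have h2 := Finset.card_insert_le a (Finset.univ.filter fun b => S.G.Adj a b)
        have h3 := S.one_le_r
        omega
    have : (2 * S.r * size c : ℝ) = ((members c).card * (2 * S.r) : ℕ) := by
      push_cast [size]
      ring
    rw [this]
    exact_mod_cast hcard
  · intro a ha b hb
    refine Finset.mem_biUnion.2 ⟨a, ha, ?_⟩
    rw [Finset.mem_insert, Finset.mem_filter]
    exact hb.imp id fun h => ⟨Finset.mem_univ _, h⟩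

/-- At most `2 r n_c` agents are involved in the decisions of the component, whence probability
`3 δ / 4` by the choice of the level; the other two requirements take up less than `δ / 20`. -/
theorem IsRun.measure_not_regularPath_le {c : S.Component} {δ : ℝ} (hδ : 0 < δ) {Ω : Type*}
    [MeasurableSpace Ω] {P : Measure Ω} [IsProbabilityMeasure P] {X : Fin N → ℕ → Ω → ℝ}
    {Wt : ℕ → Ω → Matrix (Fin N) (Fin N) ℝ} (h : IsRun c (level c δ) P X Wt) :
    P {ω | ¬ RegularPath c δ X ω} ≤ ENNReal.ofReal (4 / 5 * δ) := by
  obtain ⟨a₀, -⟩ := members_nonempty c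
  have hκ := kappa_nonneg (S := S) a₀
  have hσ := S.σ_pos
  have hN : (0 : ℝ) < N := by exact_mod_cast a₀.pos
  have hr : (0 : ℝ) < S.r := by exact_mod_cast S.one_le_r
  have hn : (0 : ℝ) < size c := by exact_mod_cast one_le_size c
  have hd : 0 < √√δ := Real.sqrt_pos.2 (Real.sqrt_pos.2 hδ)
  have hj : 0 < jointLevel N δ := by unfold jointLevel; positivity
  have hK : 0 < S.devConst / √√δ :=
    div_pos (lt_of_lt_of_le one_pos (one_le_devConst hκ)) hd
  obtain ⟨A, hA, hmem⟩ := exists_finset_closed_nbhd c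
  have hsub : {ω | ¬ RegularPath c δ X ω} ⊆
      ({ω | ∃ b ∈ A, ω ∈ {ω | ∃ s, 1 ≤ s ∧ S.beta (level c δ) s ≤ |S.dev X s ω b|}} ∪
      {ω | ∃ b ∈ Finset.univ, ω ∈ {ω | ∃ s, 1 ≤ s ∧
        S.beta (jointLevel N δ) s ≤ |S.dev X s ω b|}}) ∪
      {ω | ∃ b ∈ Finset.univ, ω ∈ {ω | ∃ s : ℕ, 1 ≤ s ∧
        S.devConst / √√δ * √(s : ℝ) ≤ |S.noise X (b, s) ω|}} := by
    intro ω hω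
    by_contra hcon
    simp only [Set.mem_union, Set.mem_ofPred_eq, not_or, not_exists, not_and, not_le,
      Finset.mem_univ, true_imp_iff] at hcon
    exact hω ⟨fun a ha b hb s hs => (hcon.1.1 b (hmem a ha b hb) s hs).le,
      fun b s hs => (hcon.1.2 b s hs).le, fun b s hs => (hcon.2 b s hs).le⟩
  refine (measure_mono hsub).trans ((measure_union_le _ _).trans
    (add_le_add ((measure_union_le _ _).trans (add_le_add
      (measure_exists_finset_le A fun b _ => h.measure_beta_lt_dev_le (level_pos hδ) b)
      (measure_exists_finset_le Finset.univ fun b _ => h.measure_beta_lt_dev_le hj b)))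
      (measure_exists_finset_le Finset.univ fun b _ => h.measure_sqrt_le_noise_le hK b)) |>.trans
      ?_)
  have hl := level_pos (c := c) hδ
  rw [← ENNReal.ofReal_add (by positivity) (by positivity),
    ← ENNReal.ofReal_add (by positivity) (by positivity)]
  refine ENNReal.ofReal_le_ofReal ?_
  have e1 : (A.card : ℝ) * (3 / 2 * level c δ) ≤ 3 / 4 * δ := by
    calc (A.card : ℝ) * (3 / 2 * level c δ) ≤ 2 * S.r * size c * (3 / 2 * level c δ) := by gcongr
      _ = 3 / 4 * δ := by
        unfold level
        field_simp
  have e2 : ((Finset.univ : Finset (Fin N)).card : ℝ) * (3 / 2 * jointLevel N δ) = 3 / 128 * δ := by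
    unfold jointLevel
    rw [Finset.card_univ, Fintype.card_fin]
    field_simp
    norm_num
  have e3 : ((Finset.univ : Finset (Fin N)).card : ℝ) *
      (2 * (S.κ * S.σ ^ 4) / (S.devConst / √√δ) ^ 4) ≤ 1 / 64 * δ := by
    rw [Finset.card_univ, Fintype.card_fin, div_pow, sqrt_sqrt_pow_four hδ.le]
    have h1 := le_devConst_pow_four (S := S) hκ
    have h2 : 0 < S.devConst ^ 4 := pow_pos (lt_of_lt_of_le one_pos (one_le_devConst hκ)) 4
    rw [div_div_eq_mul_div, mul_div_assoc', div_le_iff₀ h2]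
    have h3 : (N : ℝ) * (S.κ * S.σ ^ 4) ≤ N * ((S.κ + 3) * S.σ ^ 4) := by
      gcongr
      linarith
    have h4 : 128 * (N * (S.κ * S.σ ^ 4)) ≤ S.devConst ^ 4 := by linarith
    nlinarith
  linarith

section Paths

variable {c : S.Component} {δ : ℝ} {Ω : Type*} {X : Fin N → ℕ → Ω → ℝ} {ω : Ω}

theorem jointLevel_pos (c : S.Component) (hδ : 0 < δ) : 0 < jointLevel N δ := by
  have hN : (0 : ℝ) < N := by exact_mod_cast (members_nonempty c).choose.pos
  unfold jointLevel
  positivity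

theorem beta_jointLevel_le (c : S.Component) (hδ : 0 < δ) {s : ℕ} (hs : 1 ≤ s) :
    S.beta (jointLevel N δ) s ≤ S.devConst / √√δ := by
  have hκ := kappa_nonneg_of_component c
  have hσ := S.σ_pos
  have hj := jointLevel_pos c hδ
  have hN : (0 : ℝ) < N := by exact_mod_cast (members_nonempty c).choose.pos
  have hd : 0 < √√δ := Real.sqrt_pos.2 (Real.sqrt_pos.2 hδ)
  have h1 := one_le_devConst (S := S) hκ
  refine (beta_anti hκ hj le_rfl hs).trans ?_
  refine le_of_pow_le_pow_left₀ (n := 4) (by norm_num) (by positivity) ?_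
  rw [beta_pow_four hκ hj, div_pow, sqrt_sqrt_pow_four hδ.le]
  simp only [Nat.cast_one, Real.log_one, jointLevel]
  have h2 := le_devConst_pow_four (S := S) hκ
  calc _ = 128 * N * ((S.κ + 3) * S.σ ^ 4) / δ := by
        field_simp
        norm_num
    _ ≤ _ := by gcongr

/-- The two levels differ by a factor that does not depend on `δ`, and so do their widths. -/
theorem beta_jointLevel_le_mul (c : S.Component) (hδ : 0 < δ) (s : ℕ) :
    S.beta (jointLevel N δ) s ≤ 16 * N * S.beta (level c δ) s := by
  have hκ := kappa_nonneg_of_component c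
  have hσ := S.σ_pos
  have hN : (1 : ℝ) ≤ N := by exact_mod_cast (members_nonempty c).choose.pos
  have hr : (1 : ℝ) ≤ S.r := by exact_mod_cast S.one_le_r
  have hn : (1 : ℝ) ≤ size c := by exact_mod_cast one_le_size c
  have hb := beta_nonneg hκ (level_pos (c := c) hδ) s
  refine le_of_pow_le_pow_left₀ (n := 4) (by norm_num) (by positivity) ?_
  rw [mul_pow, beta_pow_four hκ (jointLevel_pos c hδ), beta_pow_four hκ (level_pos hδ),
    ← mul_assoc ((16 * (N : ℝ)) ^ 4)]
  refine mul_le_mul_of_nonneg_right ?_ (by positivity)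
  have e1 : 2 * ((S.κ + 3) * S.σ ^ 4) / jointLevel N δ =
      128 * N * (((S.κ + 3) * S.σ ^ 4) / δ) := by
    unfold jointLevel
    field_simp
    norm_num
  have e2 : 2 * ((S.κ + 3) * S.σ ^ 4) / level c δ =
      8 * (S.r * size c) * (((S.κ + 3) * S.σ ^ 4) / δ) := by
    unfold level
    field_simp
    norm_num
  rw [e1, e2, ← mul_assoc]
  refine mul_le_mul_of_nonneg_right ?_ (by positivity)
  have h1 : (1 : ℝ) ≤ S.r * size c := by nlinarith
  have h2 : 16 * (N : ℝ) ≤ (16 * N) ^ 4 := le_self_pow₀ (by linarith) (by norm_num : 4 ≠ 0)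
  have h3 : 16 * (N : ℝ) ≤ (16 * N) ^ 4 * (S.r * size c) :=
    h2.trans (le_mul_of_one_le_right (by positivity) h1)
  linarith

theorem RegularPath.absDev_le (h : RegularPath c δ X ω) {s : ℕ} (hs : 1 ≤ s) :
    S.absDev X s ω ≤ N * S.beta (jointLevel N δ) s := by
  have := Finset.sum_le_card_nsmul Finset.univ (fun a => |S.dev X s ω a|) _
    fun b _ => h.dev_le_joint b s hs
  rwa [nsmul_eq_mul, Finset.card_univ, Fintype.card_fin] at this

theorem RegularPath.abs_avgDev_le (h : RegularPath c δ X ω) {s : ℕ} (hs : 1 ≤ s) :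
    |avgDev c X s ω| ≤ S.beta (jointLevel N δ) s := by
  have hn : (0 : ℝ) < size c := by exact_mod_cast one_le_size c
  rw [avgDev, abs_div, abs_of_pos hn, div_le_iff₀ hn]
  refine (Finset.abs_sum_le_sum_abs _ _).trans ?_
  have := Finset.sum_le_card_nsmul (members c) (fun a => |S.dev X s ω a|) _
    fun b _ => h.dev_le_joint b s hs
  rwa [nsmul_eq_mul, mul_comm] at this

/-- Consecutive averages are close: `dev (s + 1) - dev s = (noise (s + 1) - dev s) / (s + 1)`. -/
theorem RegularPath.abs_dev_succ_sub_le (h : RegularPath c δ X ω) {s : ℕ} (hs : 1 ≤ s)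
    (b : Fin N) :
    |S.dev X (s + 1) ω b - S.dev X s ω b| ≤
      2 * (S.devConst / √√δ) * (1 / √((s + 1 : ℕ) : ℝ)) := by
  have hs' : (0 : ℝ) < s := by exact_mod_cast hs
  have hκ := kappa_nonneg (S := S) b
  have h1 := one_le_devConst (S := S) hκ
  set K := S.devConst / √√δ with hK
  have hK0 : 0 ≤ K := by positivity
  have hmono : ∀ k : ℕ, k ≤ s + 1 → √(k : ℝ) ≤ √((s + 1 : ℕ) : ℝ) := fun k hk =>
    Real.sqrt_le_sqrt (by exact_mod_cast hk)
  have hdev : |S.dev X s ω b| ≤ K * √((s + 1 : ℕ) : ℝ) := by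
    rw [dev_eq X hs, abs_div, abs_of_pos hs', div_le_iff₀ hs']
    refine (Finset.abs_sum_le_sum_abs _ _).trans ?_
    have := Finset.sum_le_card_nsmul (Finset.Icc 1 s) (fun k => |S.noise X (b, k) ω|)
      (K * √((s + 1 : ℕ) : ℝ)) fun k hk => by
        rw [Finset.mem_Icc] at hk
        exact (h.noise_le b k hk.1).trans (mul_le_mul_of_nonneg_left (hmono k (by omega)) hK0)
    rw [nsmul_eq_mul, Nat.card_Icc, Nat.add_sub_cancel] at this
    linarith
  have hnoise : |S.noise X (b, s + 1) ω| ≤ K * √((s + 1 : ℕ) : ℝ) := h.noise_le b (s + 1) (by omega)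
  have hpos : (0 : ℝ) < ((s + 1 : ℕ) : ℝ) := by positivity
  have e : S.dev X (s + 1) ω b - S.dev X s ω b =
      (S.noise X (b, s + 1) ω - S.dev X s ω b) / ((s + 1 : ℕ) : ℝ) := by
    rw [dev_eq X (by omega : 1 ≤ s + 1), dev_eq X hs, Finset.sum_Icc_succ_top (by omega)]
    push_cast
    field_simp
    ring
  rw [e, abs_div, abs_of_pos hpos, div_le_iff₀ hpos]
  have hsq : √((s + 1 : ℕ) : ℝ) * √((s + 1 : ℕ) : ℝ) = ((s + 1 : ℕ) : ℝ) :=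
    Real.mul_self_sqrt hpos.le
  have hsp : 0 < √((s + 1 : ℕ) : ℝ) := Real.sqrt_pos.2 hpos
  have e2 : 2 * K * (1 / √((s + 1 : ℕ) : ℝ)) * ((s + 1 : ℕ) : ℝ) =
      2 * (K * √((s + 1 : ℕ) : ℝ)) := by
    calc _ = 2 * K * (1 / √((s + 1 : ℕ) : ℝ)) *
          (√((s + 1 : ℕ) : ℝ) * √((s + 1 : ℕ) : ℝ)) := by rw [hsq]
      _ = _ := by field_simp
  rw [e2]
  exact (abs_sub _ _).trans (by linarith)

theorem RegularPath.pruned_eq (h : RegularPath c δ X ω) (hδ : 0 < δ) {a₀ : Fin N}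
    (ha₀ : a₀ ∈ members c) {n : ℕ} (hn : 1 ≤ n)
    (hgap : ENNReal.ofReal (S.beta (level c δ) n) < S.gap a₀ / 4) {t : ℕ} (ht : n + 1 ≤ t)
    {a : Fin N} (ha : a ∈ members c) :
    S.pruned (level c δ) (fun s => empMean X s ω) t a = S.simClass a ∩ S.G.neighborSet a :=
  pruned_eq_of_beta_lt_gap (kappa_nonneg a) (level_pos hδ) hn (h.dev_le a ha)
    (by rwa [gap_eq_of_mem ha ha₀]) ht

end Paths

end System

/-! ### Averaging memory: the consensus recursion -/

/-- The linear recursion `u (s + 1) = A u s + y (s + 1)` follows the sums of the averages of the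
inputs. With `Q` as in `exists_resolvent`, the remainder `u t - ∑ average (y s) - Q (y t)` changes
by `A Q (y t - y (t + 1))` in a step; no spectral gap is needed, so `A` may have the
eigenvalue `-1`. -/
theorem abs_sub_sum_average_le {ι : Type*} [Fintype ι] {A Q : Matrix ι ι ℝ} {K : ℝ}
    (h0 : ∀ a b, 0 ≤ A a b) (h1 : ∀ a, ∑ b, A a b = 1)
    (hQ : ∀ y a, Q.mulVec y a - A.mulVec (Q.mulVec y) a = y a - (∑ b, y b) / Fintype.card ι)
    (hK : ∀ (y : ι → ℝ) (M : ℝ), (∀ a, |y a| ≤ M) → ∀ a, |Q.mulVec y a| ≤ K * M)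
    {u y : ℕ → ι → ℝ} {z : ℕ → ℝ} {U Y : ℝ} {r t : ℕ} (hrt : r ≤ t)
    (hu : ∀ s, r ≤ s → s < t → ∀ a, u (s + 1) a = A.mulVec (u s) a + y (s + 1) a)
    (hU : ∀ a, |u r a| ≤ U) (hY : ∀ s, r ≤ s → ∀ a, |y s a| ≤ Y)
    (hz : ∀ s, r ≤ s → ∀ a, |y (s + 1) a - y s a| ≤ z s) (a : ι) :
    |u t a - ∑ s ∈ Finset.Ioc r t, (∑ b, y s b) / Fintype.card ι| ≤
      U + K * (2 * Y + ∑ s ∈ Finset.Ico r t, z s) := by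
  have key : ∀ a, |u t a - ∑ s ∈ Finset.Ioc r t, (∑ b, y s b) / Fintype.card ι -
      Q.mulVec (y t) a| ≤ U + K * (Y + ∑ s ∈ Finset.Ico r t, z s) := by
    induction t, hrt using Nat.le_induction with
    | base =>
      intro a
      simp only [Finset.Ioc_self, Finset.sum_empty, sub_zero, Finset.Ico_self, add_zero]
      exact (abs_sub _ _).trans (add_le_add (hU a) (hK _ _ (hY r le_rfl) a))
    | succ t hrt ih =>
      intro a
      have ih' := ih fun s hs hst => hu s hs (by omega)
      set p := ∑ s ∈ Finset.Ioc r t, (∑ b, y s b) / (Fintype.card ι : ℝ) with hp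
      set d : ι → ℝ := fun a => u t a - p - Q.mulVec (y t) a with hd
      have hsum : ∑ s ∈ Finset.Ioc r (t + 1), (∑ b, y s b) / (Fintype.card ι : ℝ) =
          p + (∑ b, y (t + 1) b) / Fintype.card ι := by
        rw [← Finset.insert_Ioc_right_eq_Ioc_add_one (by omega), Finset.sum_insert (by simp),
          add_comm]
      have hAu : A.mulVec (u t) a = A.mulVec d a + p + A.mulVec (Q.mulVec (y t)) a := by
        have : u t = d + (fun _ => p) + Q.mulVec (y t) := by
          ext a
          simp only [hd, Pi.add_apply]
          ring
        conv_lhs => rw [this]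
        rw [Matrix.mulVec_add, Matrix.mulVec_add, Pi.add_apply, Pi.add_apply]
        congr 2
        simp only [Matrix.mulVec, dotProduct]
        rw [← Finset.sum_mul, h1, one_mul]
      have hdiff : A.mulVec (Q.mulVec (y t)) a - A.mulVec (Q.mulVec (y (t + 1))) a =
          A.mulVec (Q.mulVec (y t - y (t + 1))) a := by
        rw [Matrix.mulVec_sub, Matrix.mulVec_sub, Pi.sub_apply]
      have e : u (t + 1) a - (p + (∑ b, y (t + 1) b) / Fintype.card ι) -
          Q.mulVec (y (t + 1)) a = A.mulVec d a + A.mulVec (Q.mulVec (y t - y (t + 1))) a := by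
        rw [hu t hrt (by omega) a, hAu, ← hdiff]
        linarith [hQ (y (t + 1)) a]
      rw [hsum, e, Finset.sum_Ico_succ_top hrt]
      refine (abs_add_le _ _).trans ?_
      have b1 := abs_mulVec_le h0 h1 (v := d) ih' a
      have b2 := abs_mulVec_le h0 h1 (hK (y t - y (t + 1)) (z t) fun a => by
        rw [Pi.sub_apply, abs_sub_comm]
        exact hz t hrt a) a
      linarith
  have h2 := hK _ _ (hY t hrt) a
  have h3 := key a
  have e : u t a - ∑ s ∈ Finset.Ioc r t, (∑ b, y s b) / (Fintype.card ι : ℝ) =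
      (u t a - ∑ s ∈ Finset.Ioc r t, (∑ b, y s b) / Fintype.card ι - Q.mulVec (y t) a) +
        Q.mulVec (y t) a := by ring
  rw [e]
  refine (abs_add_le _ _).trans ?_
  linarith

namespace System

variable {N : ℕ} {S : System N}

theorem avgDev_eq {Ω : Type*} (c : S.Component) (X : Fin N → ℕ → Ω → ℝ) (t : ℕ) (ω : Ω) :
    (∑ a : members c, S.dev X t ω a) / Fintype.card (members c) = avgDev c X t ω := by
  rw [card_members, Finset.sum_coe_sort (members c) (fun a => S.dev X t ω a)]
  rfl

/-- The averaging memory on a regular path whose neighbourhoods are settled from time `n + 1`. -/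
theorem IsRun.mul_abs_est_sub_le {c : S.Component} {δ : ℝ} (hδ : 0 < δ) {Ω : Type*}
    [MeasurableSpace Ω] {P : Measure Ω} {X : Fin N → ℕ → Ω → ℝ}
    {Wt : ℕ → Ω → Matrix (Fin N) (Fin N) ℝ} (h : IsRun c (level c δ) P X Wt)
    {Q : Matrix (members c) (members c) ℝ} {K : ℝ}
    (hQ : ∀ y a, Q.mulVec y a - (block c).mulVec (Q.mulVec y) a =
      y a - (∑ b, y b) / Fintype.card (members c))
    (hK0 : 0 ≤ K)
    (hK : ∀ (y : members c → ℝ) (M : ℝ), (∀ a, |y a| ≤ M) → ∀ a, |Q.mulVec y a| ≤ K * M)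
    {a₀ : Fin N} (ha₀ : a₀ ∈ members c) {D : ℝ} (hinit : ∀ b, |S.init b - S.mean a₀| ≤ D)
    (hmean : ∀ b, |S.mean b - S.mean a₀| ≤ D) {Δ : ℝ} (hΔ0 : 0 < Δ)
    (hΔ : ENNReal.ofReal Δ ≤ S.gap a₀)
    {ω : Ω} (hω : RegularPath c δ X ω) {n : ℕ} (hn : 1 ≤ n)
    (hβ : S.beta (level c δ) n < Δ / 4) {t : ℕ} (ht : n + 1 ≤ t) {a : Fin N}
    (ha : a ∈ members c) :
    t * |S.est (fun t => (t : ℝ) / (t + 1)) (fun s => empMean X s ω) (fun s => Wt s ω) t a -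
        S.mean a₀| ≤ |∑ s ∈ Finset.Icc 1 t, avgDev c X s ω| +
      (n + 1 : ℕ) * (D + 16 * N ^ 2 * Δ) +
      K * (2 * (S.devConst / √√δ) + 4 * (S.devConst / √√δ) * √(t : ℝ)) := by
  have hκ := kappa_nonneg (S := S) a
  have hl := level_pos (c := c) hδ
  have hj := jointLevel_pos c hδ
  have hN : (1 : ℝ) ≤ N := by exact_mod_cast a.pos
  have hd : 0 < √√δ := Real.sqrt_pos.2 (Real.sqrt_pos.2 hδ)
  have hdc := one_le_devConst (S := S) hκ
  set b := S.beta (jointLevel N δ) (n + 1) with hb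
  have hb0 : 0 ≤ b := beta_nonneg hκ hj _
  have hbΔ : b ≤ 4 * N * Δ := by
    have h1 := beta_jointLevel_le_mul c hδ (n + 1)
    have h2 := beta_anti hκ hl hn (Nat.le_succ n)
    have h3 : 16 * N * S.beta (level c δ) (n + 1) ≤ 16 * N * (Δ / 4) := by
      gcongr
      exact h2.trans hβ.le
    linarith
  -- the average of the confidence widths up to time `n + 1` is of the order of the last one
  have hsumβ : ∑ s ∈ Finset.Icc 1 (n + 1), S.beta (jointLevel N δ) s ≤ 2 * (n + 1 : ℕ) * b :=
    sum_le_of_le_mul_sqrt_div hb0 fun s hs hs' => beta_le_mul_sqrt hκ hj hs hs'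
  have hsumAbs : ∑ s ∈ Finset.Icc 1 (n + 1), S.absDev X s ω ≤ N * (2 * (n + 1 : ℕ) * b) := by
    refine le_trans (Finset.sum_le_sum fun s hs => hω.absDev_le (Finset.mem_Icc.1 hs).1) ?_
    rw [← Finset.mul_sum]
    gcongr
  have hsumAvg : |∑ s ∈ Finset.Icc 1 (n + 1), avgDev c X s ω| ≤ 2 * (n + 1 : ℕ) * b :=
    ((Finset.abs_sum_le_sum_abs _ _).trans (Finset.sum_le_sum fun s hs =>
      hω.abs_avgDev_le (Finset.mem_Icc.1 hs).1)).trans hsumβ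
  set e : ℕ → members c → ℝ := fun s a => S.est (fun t => (t : ℝ) / (t + 1))
    (fun s => empMean X s ω) (fun s => Wt s ω) s a - S.mean a₀ with he
  have hα0 : ∀ t : ℕ, 0 ≤ (t : ℝ) / (t + 1) := fun t => by positivity
  have hα1 : ∀ t : ℕ, (t : ℝ) / (t + 1) ≤ 1 := fun t => by
    rw [div_le_one (by positivity)]
    linarith
  have hgap : ENNReal.ofReal (S.beta (level c δ) n) < S.gap a₀ / 4 := by
    refine lt_of_lt_of_le ((ENNReal.ofReal_lt_ofReal_iff (by positivity)).2 hβ) ?_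
    rw [ENNReal.ofReal_div_of_pos (by norm_num)]
    simpa using ENNReal.div_le_div_right hΔ 4
  have hmain := abs_sub_sum_average_le (u := fun s a => (s : ℝ) * e s a)
    (y := fun s a => S.dev X s ω a) (z := fun s =>
      2 * (S.devConst / √√δ) * (1 / √((s + 1 : ℕ) : ℝ)))
    (U := (n + 1 : ℕ) * D + N * (2 * (n + 1 : ℕ) * b)) (Y := S.devConst / √√δ)
    (block_nonneg c) (block_row_sum c) hQ hK ht ?_ ?_ ?_ ?_ ⟨a, ha⟩
  · have hsplit : ∑ s ∈ Finset.Icc 1 t, avgDev c X s ω =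
        ∑ s ∈ Finset.Icc 1 (n + 1), avgDev c X s ω +
          ∑ s ∈ Finset.Ioc (n + 1) t, avgDev c X s ω := by
      have := Finset.sum_Ioc_consecutive (fun s => avgDev c X s ω) (Nat.zero_le (n + 1)) ht
      have hI : ∀ k, Finset.Icc 1 k = Finset.Ioc 0 k := fun k => by
        ext
        simp only [Finset.mem_Icc, Finset.mem_Ioc]
        omega
      rw [hI, hI, this]
    simp only [avgDev_eq] at hmain
    have hz : ∑ s ∈ Finset.Ico (n + 1) t,
        2 * (S.devConst / √√δ) * (1 / √((s + 1 : ℕ) : ℝ)) ≤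
        4 * (S.devConst / √√δ) * √(t : ℝ) := by
      rw [← Finset.mul_sum]
      have h1 : ∑ s ∈ Finset.Ico (n + 1) t, 1 / √((s + 1 : ℕ) : ℝ) ≤ 2 * √(t : ℝ) := by
        rw [Finset.sum_Ico_add' (fun s : ℕ => 1 / √(s : ℝ)) (n + 1) t 1]
        refine le_trans (Finset.sum_le_sum_of_subset_of_nonneg (fun s hs => ?_)
          fun s _ _ => by positivity) (sum_inv_sqrt_le t)
        rw [Finset.mem_Ico] at hs
        rw [Finset.mem_Icc]
        omega
      have := mul_le_mul_of_nonneg_left h1 (by positivity : 0 ≤ 2 * (S.devConst / √√δ))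
      linarith
    have hz' := mul_le_mul_of_nonneg_left hz hK0
    have hgoal : (t : ℝ) * |e t ⟨a, ha⟩| = |(t : ℝ) * e t ⟨a, ha⟩| := by
      rw [abs_mul, Nat.abs_cast]
    show (t : ℝ) * |e t ⟨a, ha⟩| ≤ _
    rw [hgoal]
    have h3 : |(t : ℝ) * e t ⟨a, ha⟩| ≤ |(t : ℝ) * e t ⟨a, ha⟩ -
        ∑ s ∈ Finset.Ioc (n + 1) t, avgDev c X s ω| +
        (|∑ s ∈ Finset.Icc 1 t, avgDev c X s ω| +
          |∑ s ∈ Finset.Icc 1 (n + 1), avgDev c X s ω|) := by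
      have e1 : (t : ℝ) * e t ⟨a, ha⟩ = ((t : ℝ) * e t ⟨a, ha⟩ -
        ∑ s ∈ Finset.Ioc (n + 1) t, avgDev c X s ω) + (∑ s ∈ Finset.Icc 1 t, avgDev c X s ω -
          ∑ s ∈ Finset.Icc 1 (n + 1), avgDev c X s ω) := by
        rw [hsplit]
        ring
      conv_lhs => rw [e1]
      exact (abs_add_le _ _).trans (add_le_add le_rfl (abs_sub _ _))
    have h4 : N * (2 * (n + 1 : ℕ) * b) + 2 * (n + 1 : ℕ) * b ≤
        ((n + 1 : ℕ) : ℝ) * (16 * N ^ 2 * Δ) := by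
      have h5 : (N + 1) * b ≤ 8 * N ^ 2 * Δ := by
        calc ((N : ℝ) + 1) * b ≤ (2 * N) * (4 * N * Δ) := by
              gcongr
              linarith
          _ = 8 * N ^ 2 * Δ := by ring
      have := mul_le_mul_of_nonneg_left h5 (by positivity : (0 : ℝ) ≤ 2 * (n + 1 : ℕ))
      linarith
    linarith
  · intro s hs hst a
    have hW := h.weight_settled s ω fun a ha => hω.pruned_eq hδ ha₀ hn hgap hs ha
    have hrec := est_sub_succ (S := S) (α := fun t => (t : ℝ) / (t + 1))
      (xbar := fun s => empMean X s ω) (Wt := fun s => Wt s ω) hW (S.mean a₀) a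
    have hmul : (block c).mulVec (fun a => (s : ℝ) * e s a) a =
        s * (block c).mulVec (e s) a := by
      have : (fun a => (s : ℝ) * e s a) = (s : ℝ) • e s := rfl
      rw [this, Matrix.mulVec_smul, Pi.smul_apply, smul_eq_mul]
    have hes : e (s + 1) a = (1 - (s : ℝ) / (s + 1)) * (empMean X (s + 1) ω a - S.mean a₀) +
      (s : ℝ) / (s + 1) * (block c).mulVec (e s) a := hrec
    show ((s + 1 : ℕ) : ℝ) * e (s + 1) a = _
    rw [hmul, hes, dev, mean_eq_of_mem a.2 ha₀]
    push_cast
    have : (s : ℝ) + 1 ≠ 0 := by positivity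
    field_simp
    ring
  · intro a
    show |((n + 1 : ℕ) : ℝ) * e (n + 1) a| ≤ _
    rw [abs_mul, Nat.abs_cast]
    have h1 := h.abs_est_sub_le_smooth hα0 hα1 hinit hmean ω (n + 1) a
    have h2 := mul_le_mul_of_nonneg_left h1 (by positivity : (0 : ℝ) ≤ ((n + 1 : ℕ) : ℝ))
    rw [mul_add, mul_smooth_eq_sum] at h2
    exact h2.trans (by linarith)
  · intro s hs a
    exact (hω.dev_le_joint a s (by omega)).trans (beta_jointLevel_le c hδ (by omega))
  · intro s hs a
    exact hω.abs_dev_succ_sub_le (by omega) a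

/-- The squared logarithm in `g` compensates for the one in the confidence width. -/
theorem one_add_log_sq_div_le {x θ : ℝ} (hx : 1 ≤ x) (hθ : 0 < θ) (hθ1 : θ ≤ 1)
    (h1 : 1 ≤ θ * g x) : (1 + Real.log (θ * g x) ^ 2) / (θ * g x) ≤ 9 / (θ * x) := by
  have hl0 := Real.log_nonneg hx
  have hl : Real.log (Real.exp 1 * x) = 1 + Real.log x := by
    rw [Real.log_mul (Real.exp_ne_zero _) (by positivity), Real.log_exp]
  have hg : g x = x * (1 + Real.log x) ^ 2 := by rw [g, hl]
  have hg0 : 0 < g x := lt_of_lt_of_le (by linarith) (le_g hx)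
  have hlog : Real.log (θ * g x) ≤ 3 * Real.log x := by
    have h2 : Real.log (θ * g x) ≤ Real.log (g x) :=
      Real.log_le_log (by positivity) (mul_le_of_le_one_left hg0.le hθ1)
    have h3 : Real.log (g x) = Real.log x + 2 * Real.log (1 + Real.log x) := by
      rw [hg, Real.log_mul (by positivity) (by positivity), Real.log_pow]
      norm_num
    have h4 := Real.log_le_sub_one_of_pos (by linarith : 0 < 1 + Real.log x)
    linarith
  have hlog0 := Real.log_nonneg h1
  have h5 : 1 + Real.log (θ * g x) ^ 2 ≤ 9 * (1 + Real.log x) ^ 2 := by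
    have := pow_le_pow_left₀ hlog0 hlog 2
    nlinarith
  rw [div_le_div_iff₀ (by positivity) (by positivity)]
  calc (1 + Real.log (θ * g x) ^ 2) * (θ * x) ≤ 9 * (1 + Real.log x) ^ 2 * (θ * x) := by gcongr
    _ = 9 * (θ * g x) := by rw [hg]; ring

theorem avgMoment_pos {c : S.Component} (hc : Nondegenerate c) : 0 < avgMoment c := by
  have h1 := (avgMoment_bounds c).2.1
  have h2 := pow_pos (totalVar_pos hc) 2
  exact pos_of_mul_pos_right (h2.trans_le h1) (by positivity)

/-- The averages of the mean deviation of the component are small at all times after `T`. -/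
theorem IsRun.measure_sum_avgDev_le {c : S.Component} (hc : Nondegenerate c) {γ : ℝ} {Ω : Type*}
    [MeasurableSpace Ω] {P : Measure Ω} [IsProbabilityMeasure P] {X : Fin N → ℕ → Ω → ℝ}
    {Wt : ℕ → Ω → Matrix (Fin N) (Fin N) ℝ} (h : IsRun c γ P X Wt) {ε T x : ℝ} (hε : 0 < ε)
    (hx : 0 < x) (hxT : x ≤ max 1 T) :
    P {ω | ∃ t : ℕ, (T < t ∧ 1 ≤ t) ∧
        ε / 2 ≤ |∑ s ∈ Finset.Icc 1 t, 1 / (t : ℝ) * avgDev c X s ω|} ≤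
      ENNReal.ofReal (2048 * (avgMoment c / size c) / ε ^ 4 / x) := by
  have hn : (1 : ℝ) ≤ size c := by exact_mod_cast one_le_size c
  have hV := totalVar_pos hc
  have hF := totalFourth_nonneg c
  set w := (totalFourth c + 3 * totalVar c ^ 2) / (size c : ℝ) ^ 4 with hw
  have hw0 : 0 < w := by positivity
  have hv4 := sqrt_sqrt_pow_four hw0.le
  have hv0 : 0 < √√w := Real.sqrt_pos.2 (Real.sqrt_pos.2 hw0)
  have hs4 : ∀ t : ℕ, √(t : ℝ) ^ 4 = (t : ℝ) ^ 2 := fun t => by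
    rw [show √(t : ℝ) ^ 4 = (√(t : ℝ) ^ 2) ^ 2 by ring, Real.sq_sqrt (by positivity)]
  have hint : ∀ t : ℕ, 1 ≤ t →
      MemLp (fun ω => ∑ s ∈ Finset.Icc 1 t, 1 / (t : ℝ) * avgDev c X s ω) 4 P := fun t _ =>
    memLp_finsetSum _ fun s hs => (h.memLp_avgDev (Finset.mem_Icc.1 hs).1).const_mul _
  have hwq : w ≤ 4 * (avgMoment c / size c) := by
    obtain ⟨b1, b2, -⟩ := avgMoment_bounds c
    have hA := avgMoment_nonneg c
    rw [hw, ← mul_div_assoc, div_le_div_iff₀ (by positivity) (by positivity)]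
    have h3 : (size c : ℝ) ^ 2 * avgMoment c * size c ≤ avgMoment c * (size c : ℝ) ^ 4 := by
      have : (size c : ℝ) ^ 3 ≤ (size c : ℝ) ^ 4 := pow_le_pow_right₀ hn (by norm_num)
      nlinarith
    calc (totalFourth c + 3 * totalVar c ^ 2) * (size c : ℝ)
        ≤ (4 * ((size c : ℝ) ^ 2 * avgMoment c)) * size c := by
          gcongr
          linarith
      _ ≤ 4 * avgMoment c * (size c : ℝ) ^ 4 := by linarith
  refine measure_exists_le_of_moments (M := fun t : ℕ => 16 * w / (t : ℝ) ^ 2)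
    (q := fun t : ℕ => 256 * w / ε ^ 4 * (if T < t then 1 / (t : ℝ) ^ 2 else 0))
    (fun t ht => integrable_pow_of_memLp_four (hint t ht.2) le_rfl)
    (fun t ht => ?_) (fun _ _ => by positivity) (fun t => by split_ifs <;> positivity)
    (fun t ht => ?_) (fun k => ?_)
  · have ht' : (0 : ℝ) < t := by exact_mod_cast ht.2
    refine (integral_pow_four_sum_le _ (b := fun s : ℕ => √√w * (1 / √(s : ℝ)))
      (fun s _ => by positivity) (fun s hs => ?_) (fun s hs => ?_) (fun s hs => ?_)).trans ?_
    · have : (0 : ℝ) < s := by exact_mod_cast (Finset.mem_Icc.1 hs).1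
      positivity
    · exact integrable_pow_of_memLp_four (h.memLp_avgDev (Finset.mem_Icc.1 hs).1) le_rfl
    · refine (h.integral_avgDev_pow_four_le (Finset.mem_Icc.1 hs).1).trans (le_of_eq ?_)
      rw [mul_pow, div_pow, one_pow, hs4, hv4, mul_one_div]
    · have hsp : 0 < √(t : ℝ) := Real.sqrt_pos.2 ht'
      have e : 16 * w / (t : ℝ) ^ 2 = (1 / (t : ℝ) * (√√w * (2 * √(t : ℝ)))) ^ 4 := by
        rw [mul_pow, mul_pow, mul_pow, hs4, hv4]
        field_simp
        norm_num
      rw [e]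
      have hsum : ∑ s ∈ Finset.Icc 1 t, 1 / (t : ℝ) * (√√w * (1 / √(s : ℝ))) =
          1 / (t : ℝ) * (√√w * ∑ s ∈ Finset.Icc 1 t, 1 / √(s : ℝ)) := by
        rw [Finset.mul_sum, Finset.mul_sum]
      rw [hsum]
      have := sum_inv_sqrt_le t
      gcongr
  · rw [if_pos ht.1]
    have ht' : (0 : ℝ) < t := by exact_mod_cast ht.2
    refine le_of_eq ?_
    field_simp
    norm_num
  · rw [← Finset.mul_sum]
    refine (mul_le_mul_of_nonneg_left (sum_inv_sq_tail_le hx hxT k) (by positivity)).trans ?_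
    have e : 256 * w / ε ^ 4 * (2 / x) = 512 * w / ε ^ 4 / x := by
      field_simp
      norm_num
    rw [e]
    have : 512 * w ≤ 2048 * (avgMoment c / size c) := by linarith
    gcongr

/-- The deterministic errors of the averaging memory, multiplied by `t`, are at most `3 t ε / 8` once
`t ε⁴ d⁴ ≥ c₀`, if `ε` is small compared with `c₀`. -/
theorem average_remainder_le {t ε d c₀ K k₁ k₂ L n : ℝ} (ht : 0 ≤ t) (hε : 0 < ε)
    (hd : 0 < d) (hd1 : d ≤ 1) (hk₂ : 0 ≤ k₂)
    (hc : c₀ ≤ t * ε ^ 4 * d ^ 4)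
    (h1 : 16 * (K * k₁) * ε ^ 3 ≤ c₀) (h2 : (32 * (K * k₁)) ^ 2 * ε ^ 2 ≤ c₀)
    (h3 : 32 * k₂ * ε ^ 3 ≤ c₀) (hn : n ≤ L + 2) (hL : 16 * k₂ * L ≤ ε * t) :
    n * k₂ + K * (2 * (k₁ / d) + 4 * (k₁ / d) * √t) ≤ 3 / 8 * (t * ε) := by
  have hd4 : d ^ 4 ≤ d := pow_le_of_le_one hd.le hd1 (by norm_num)
  have hd42 : d ^ 4 ≤ d ^ 2 := pow_le_pow_of_le_one hd.le hd1 (by norm_num)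
  have hd41 : d ^ 4 ≤ 1 := hd4.trans hd1
  have hε3 : 0 < ε ^ 3 := by positivity
  have a1 : 16 * (K * k₁) ≤ t * ε * d := by
    refine le_of_mul_le_mul_right ?_ hε3
    calc 16 * (K * k₁) * ε ^ 3 ≤ t * ε ^ 4 * d ^ 4 := h1.trans hc
      _ ≤ t * ε ^ 4 * d := by gcongr
      _ = t * ε * d * ε ^ 3 := by ring
  have a2 : 32 * (K * k₁) ≤ √t * ε * d := by
    refine abs_le_of_sq_le_sq' ?_ (by positivity) |>.2
    rw [mul_pow (√t * ε), mul_pow √t, Real.sq_sqrt ht]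
    refine le_of_mul_le_mul_right ?_ (by positivity : 0 < ε ^ 2)
    calc (32 * (K * k₁)) ^ 2 * ε ^ 2 ≤ t * ε ^ 4 * d ^ 4 := h2.trans hc
      _ ≤ t * ε ^ 4 * d ^ 2 := by gcongr
      _ = t * ε ^ 2 * d ^ 2 * ε ^ 2 := by ring
  have a3 : 32 * k₂ ≤ t * ε := by
    refine le_of_mul_le_mul_right ?_ hε3
    calc 32 * k₂ * ε ^ 3 ≤ t * ε ^ 4 * d ^ 4 := h3.trans hc
      _ ≤ t * ε ^ 4 * 1 := by gcongr
      _ = t * ε * ε ^ 3 := by ring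
  have b1 : K * (2 * (k₁ / d)) ≤ t * ε / 8 := by
    have : K * (2 * (k₁ / d)) = 2 * (K * k₁) / d := by ring
    rw [this, div_le_iff₀ hd]
    linarith
  have b2 : K * (4 * (k₁ / d) * √t) ≤ t * ε / 8 := by
    have e : K * (4 * (k₁ / d) * √t) = 4 * (K * k₁) * √t / d := by ring
    rw [e, div_le_iff₀ hd]
    have := mul_le_mul_of_nonneg_right a2 (Real.sqrt_nonneg t)
    have e2 : √t * ε * d * √t = t * ε * d := by
      calc √t * ε * d * √t = (√t * √t) * ε * d := by ring
        _ = t * ε * d := by rw [Real.mul_self_sqrt ht]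
    linarith
  have b3 : n * k₂ ≤ t * ε / 8 := by
    have := mul_le_mul_of_nonneg_right hn hk₂
    linarith
  linarith

theorem tau_eq {c : S.Component} {a : Fin N} (ha : a ∈ members c) (C ε δ : ℝ) :
    S.tau C ε δ a = max (S.zeta a δ : ℝ) (g (C * (avgMoment c / size c / (ε ^ 4 * δ)))) := by
  rw [tau, avgTime, mem_members.1 ha]
  congr 3
  ring

/-- The neighbourhoods are settled after a multiple of `ε g(x)` steps, where `x` is the argument
of `g` in the averaging time, and the errors made until then are forgotten after `g(x)` steps up
to a small multiple of `ε`. What remains is the time average of the mean deviations of the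
component. -/
theorem accurateAfter_average_small {c : S.Component} (hc : Nondegenerate c) :
    ∃ ε₀ : ℝ, 0 < ε₀ ∧ ∀ ε δ : ℝ, 0 < ε → ε ≤ ε₀ → 0 < δ → δ < 1 →
      AccurateAfter.{u} c (fun t => (t : ℝ) / (t + 1)) ε δ (S.tau 1000000 ε δ) := by
  obtain ⟨a₀, ha₀⟩ := members_nonempty c
  have hκ := kappa_nonneg (S := S) a₀
  have hσ := S.σ_pos
  have hN : (1 : ℝ) ≤ N := by exact_mod_cast a₀.pos
  have hr : (1 : ℝ) ≤ S.r := by exact_mod_cast S.one_le_r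
  have hn : (1 : ℝ) ≤ size c := by exact_mod_cast one_le_size c
  have hdc := one_le_devConst (S := S) hκ
  obtain ⟨D, hD, hinit, hmean⟩ := exists_spread (S := S) (S.mean a₀)
  obtain ⟨Δ, hΔ, hΔle⟩ := exists_pos_le_gap (S := S) a₀
  obtain ⟨Q, K, hK0, hQ, hK⟩ := exists_resolvent (block_isSymm c) (block_row_sum c) (block_fixed c)
  have hA := avgMoment_pos hc
  set q := avgMoment c / size c with hq
  have hq0 : 0 < q := by positivity
  set c₀ := 1000000 * q with hc₀
  have hc₀0 : 0 < c₀ := by positivity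
  set k₂ := D + 16 * N ^ 2 * Δ + 1 with hk₂
  have hk₂1 : 1 ≤ k₂ := by
    have : 0 ≤ 16 * (N : ℝ) ^ 2 * Δ := by positivity
    linarith
  have hk₂0 : 0 < k₂ := by linarith
  set B := 8 * S.r * size c * ((S.κ + 3) * S.σ ^ 4) with hB
  obtain ⟨ε₀, hε₀, hcond⟩ := exists_forall_le_of_eventually
    ((eventually_mul_pow_lt 1 one_pos (one_ne_zero)).and <|
      (eventually_mul_pow_lt (16 * (K * S.devConst)) hc₀0 (by norm_num : 3 ≠ 0)).and <|
      (eventually_mul_pow_lt ((32 * (K * S.devConst)) ^ 2) hc₀0 (by norm_num : 2 ≠ 0)).and <|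
      (eventually_mul_pow_lt (32 * k₂) hc₀0 (by norm_num : 3 ≠ 0)).and <|
      (eventually_mul_pow_lt 1 hc₀0 (by norm_num : 4 ≠ 0)).and <|
      (eventually_mul_pow_lt (B * (144 * k₂ / c₀)) (pow_pos (by positivity : 0 < Δ / 4) 4)
        (by norm_num : 3 ≠ 0)))
  refine ⟨ε₀, hε₀, fun ε δ hε hεε₀ hδ hδ1 => accurateAfter_of_bad hδ.le ?_⟩
  obtain ⟨e1, e2, e3, e4, e5, e6⟩ := hcond ε hε hεε₀
  simp only [pow_one, one_mul] at e1 e5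
  intro Ω _ P _ X Wt hrun
  set d := √√δ with hd
  have hd0 : 0 < d := Real.sqrt_pos.2 (Real.sqrt_pos.2 hδ)
  have hd1 : d ≤ 1 := Real.sqrt_le_one.2 (Real.sqrt_le_one.2 hδ1.le)
  have hd4 : d ^ 4 = δ := sqrt_sqrt_pow_four hδ.le
  set x := c₀ / (ε ^ 4 * δ) with hx
  have hx0 : 0 < x := by positivity
  have hx1 : 1 ≤ x := by
    rw [hx, one_le_div (by positivity)]
    have : ε ^ 4 * δ ≤ ε ^ 4 := mul_le_of_le_one_right (by positivity) hδ1.le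
    linarith
  have hgx : x ≤ g x := le_g hx1
  have hτ : ∀ a ∈ members c, S.tau 1000000 ε δ a = max (S.zeta a δ : ℝ) (g x) := by
    intro a ha
    rw [tau_eq ha, hx, hc₀, ← mul_div_assoc]
  -- the neighbourhoods are settled after a small multiple of `ε g(x)` steps
  set θ := ε / (16 * k₂) with hθ
  have hθ0 : 0 < θ := by positivity
  have hθ1 : θ ≤ 1 := (div_le_one (by positivity)).2 (by linarith)
  have hθx : θ * x = c₀ / (16 * k₂ * ε ^ 3 * δ) := by
    rw [hθ, hx]
    field_simp
  have hL1 : 1 ≤ θ * g x := by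
    have h1 : 1 ≤ θ * x := by
      rw [hθx, one_le_div (by positivity)]
      have : 16 * k₂ * ε ^ 3 * δ ≤ 16 * k₂ * ε ^ 3 := mul_le_of_le_one_right (by positivity) hδ1.le
      have : 0 < k₂ * ε ^ 3 := by positivity
      linarith
    exact h1.trans (by gcongr)
  set m := ⌈θ * g x⌉₊ with hm
  have hm1 : 1 ≤ m := Nat.one_le_ceil_iff.2 (by linarith)
  have hml : θ * g x ≤ m := Nat.le_ceil _
  have hmu : (m : ℝ) < θ * g x + 1 := Nat.ceil_lt_add_one (by linarith)
  have hβ : S.beta (level c δ) m < Δ / 4 := by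
    refine lt_of_pow_lt_pow_left₀ 4 (by positivity) ?_
    rw [beta_pow_four hκ (level_pos hδ)]
    have h1 : (1 + Real.log m ^ 2) / m ≤ 9 / (θ * x) :=
      (antitoneOn_one_add_log_sq_div (by simpa using hL1) (by simpa using hm1) hml).trans
        (one_add_log_sq_div_le hx1 hθ0 hθ1 hL1)
    have hlev : 2 * ((S.κ + 3) * S.σ ^ 4) / level c δ = B / δ := by
      rw [hB, level]
      field_simp
      norm_num
    rw [hlev]
    have hB0 : 0 ≤ B := by positivity
    refine lt_of_le_of_lt (mul_le_mul_of_nonneg_left h1 (by positivity)) ?_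
    rw [hθx]
    refine lt_of_eq_of_lt ?_ e6
    field_simp
    ring
  refine ⟨fun _ => {ω | ¬ RegularPath c δ X ω} ∪ {ω | ∃ t : ℕ, (g x < t ∧ 1 ≤ t) ∧
        ε / 2 ≤ |∑ s ∈ Finset.Icc 1 t, 1 / (t : ℝ) * avgDev c X s ω|}, ?_,
    fun a ha ω hω t ht => ?_⟩
  · have h1 := hrun.measure_not_regularPath_le hδ
    have h2 := hrun.measure_sum_avgDev_le hc hε hx0 (le_max_one_g x)
    have h3 : 2048 * q / ε ^ 4 / x ≤ 1 / 5 * δ := by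
      rw [hx, hc₀]
      have : 2048 * q / ε ^ 4 / (1000000 * q / (ε ^ 4 * δ)) = 2048 / 1000000 * δ := by
        field_simp
      rw [this]
      linarith
    have h4 : P ({ω | ¬ RegularPath c δ X ω} ∪ {ω | ∃ t : ℕ, (g x < t ∧ 1 ≤ t) ∧
        ε / 2 ≤ |∑ s ∈ Finset.Icc 1 t, 1 / (t : ℝ) * avgDev c X s ω|}) ≤ ENNReal.ofReal δ := by
      refine (measure_union_le _ _).trans ((add_le_add h1
        (h2.trans (ENNReal.ofReal_le_ofReal h3))).trans ?_)
      rw [← ENNReal.ofReal_add (by positivity) (by positivity)]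
      exact ENNReal.ofReal_le_ofReal (by linarith)
    rw [Finset.sum_const, nsmul_eq_mul, ENNReal.ofReal_mul (by positivity),
      ENNReal.ofReal_natCast]
    exact mul_le_mul_right h4 _
  · rw [hτ a ha, max_lt_iff] at ht
    simp only [Set.mem_union, Set.mem_ofPred_eq, not_or, not_not, not_exists, not_and, not_le] at hω
    obtain ⟨hreg, havg⟩ := hω
    have htx : x ≤ t := hgx.trans ht.2.le
    have ht1 : (1 : ℝ) ≤ t := hx1.trans htx
    have ht1' : 1 ≤ t := by exact_mod_cast ht1
    have ht0 : (0 : ℝ) < t := by linarith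
    have htc : c₀ ≤ t * ε ^ 4 * d ^ 4 := by
      rw [hx, div_le_iff₀ (by positivity)] at htx
      rw [hd4]
      linarith
    have hLt : 16 * k₂ * (θ * g x) ≤ ε * t := by
      have : 16 * k₂ * (θ * g x) = ε * g x := by
        rw [hθ]
        field_simp
      rw [this]
      exact mul_le_mul_of_nonneg_left ht.2.le hε.le
    have hm2 : ((m + 1 : ℕ) : ℝ) ≤ θ * g x + 2 := by
      push_cast
      linarith
    have hrem := average_remainder_le (K := K) (k₁ := S.devConst) (k₂ := k₂) ht0.le hε hd0 hd1
      hk₂0.le htc e2.le e3.le e4.le hm2 hLt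
    have hKr : 0 ≤ K * (2 * (S.devConst / d) + 4 * (S.devConst / d) * √(t : ℝ)) := by positivity
    have hmt : m + 1 ≤ t := by
      have h1 : ((m + 1 : ℕ) : ℝ) ≤ ((m + 1 : ℕ) : ℝ) * k₂ :=
        le_mul_of_one_le_right (by positivity) hk₂1
      have h2 : (t : ℝ) * ε ≤ t := mul_le_of_le_one_right ht0.le e1.le
      have h3 : ((m + 1 : ℕ) : ℝ) ≤ t := by linarith
      exact_mod_cast h3
    have hest := hrun.mul_abs_est_sub_le hδ hQ hK0 hK ha₀ hinit hmean hΔ (ofReal_le_gap hΔle) hreg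
      hm1 hβ hmt ha
    have hav := havg t ⟨ht.2, ht1'⟩
    rw [← Finset.mul_sum, abs_mul, abs_of_pos (by positivity), one_div, inv_mul_lt_iff₀ ht0] at hav
    rw [mean_eq_of_mem ha ha₀]
    have hk : ((m + 1 : ℕ) : ℝ) * (D + 16 * N ^ 2 * Δ) ≤ ((m + 1 : ℕ) : ℝ) * k₂ := by
      gcongr
      linarith
    have hpos : 0 < (t : ℝ) * ε := by positivity
    refine lt_of_mul_lt_mul_left ?_ ht0.le
    linarith

end System

/-! ### Constant memory: the unrolled recursion -/

theorem norm_sub_average_le {ι : Type*} [Fintype ι] (v : ι → ℝ) :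
    ‖WithLp.toLp 2 fun a => v a - (∑ b, v b) / Fintype.card ι‖ ≤ ‖WithLp.toLp 2 v‖ := by
  refine le_of_pow_le_pow_left₀ (n := 2) (by norm_num) (norm_nonneg _) ?_
  rw [EuclideanSpace.norm_sq_eq, EuclideanSpace.norm_sq_eq]
  simp only [Real.norm_eq_abs, sq_abs]
  rcases isEmpty_or_nonempty ι with h | h
  · simp
  have hn : (0 : ℝ) < Fintype.card ι := by exact_mod_cast Fintype.card_pos
  set m := (∑ b, v b) / (Fintype.card ι : ℝ) with hm
  have hs : ∑ b, v b = Fintype.card ι * m := by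
    rw [hm]
    field_simp
  have e : ∑ a, (v a - m) ^ 2 = ∑ a, v a ^ 2 - Fintype.card ι * m ^ 2 := by
    have : ∀ a, (v a - m) ^ 2 = v a ^ 2 - 2 * m * v a + m ^ 2 := fun a => by ring
    simp_rw [this]
    rw [Finset.sum_add_distrib, Finset.sum_sub_distrib, ← Finset.mul_sum, hs, Finset.sum_const,
      Finset.card_univ, nsmul_eq_mul]
    ring
  rw [e]
  have : 0 ≤ (Fintype.card ι : ℝ) * m ^ 2 := by positivity
  linarith

section Unrolled

variable {ι : Type*} [Fintype ι] [DecidableEq ι]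

theorem abs_pow_mulVec_le {A : Matrix ι ι ℝ} (h0 : ∀ a b, 0 ≤ A a b) (h1 : ∀ a, ∑ b, A a b = 1)
    {v : ι → ℝ} {M : ℝ} (hv : ∀ a, |v a| ≤ M) (k : ℕ) (a : ι) : |(A ^ k).mulVec v a| ≤ M := by
  induction k generalizing a with
  | zero => simpa using hv a
  | succ k ih =>
    rw [pow_succ', ← Matrix.mulVec_mulVec]
    exact abs_mulVec_le h0 h1 ih a

theorem pow_mulVec_const {A : Matrix ι ι ℝ} (h1 : ∀ a, ∑ b, A a b = 1) (m : ℝ) (k : ℕ) :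
    (A ^ k).mulVec (fun _ => m) = fun _ => m := by
  induction k with
  | zero => simp
  | succ k ih =>
    rw [pow_succ', ← Matrix.mulVec_mulVec, ih]
    ext a
    simp only [Matrix.mulVec, dotProduct]
    rw [← Finset.sum_mul, h1, one_mul]

/-- The solution of the recursion `u (s + 1) = (1 - α) y (s + 1) + α A u s`. -/
theorem eq_sum_pow_mulVec_of_recursion {A : Matrix ι ι ℝ} {α : ℝ} {u y : ℕ → ι → ℝ} {r t : ℕ}
    (hrt : r ≤ t)
    (hu : ∀ s, r ≤ s → s < t → u (s + 1) = (1 - α) • y (s + 1) + α • A.mulVec (u s)) :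
    u t = α ^ (t - r) • (A ^ (t - r)).mulVec (u r) +
      ∑ s ∈ Finset.Ioc r t, ((1 - α) * α ^ (t - s)) • (A ^ (t - s)).mulVec (y s) := by
  induction t, hrt using Nat.le_induction with
  | base => simp
  | succ t hrt ih =>
    have ih' := ih fun s hs hst => hu s hs (by omega)
    have hk : t + 1 - r = (t - r) + 1 := by omega
    rw [hu t hrt (by omega), ih', ← Finset.insert_Ioc_right_eq_Ioc_add_one (by omega),
      Finset.sum_insert (by simp), hk, Matrix.mulVec_add, Matrix.mulVec_smul, Matrix.mulVec_sum,
      smul_add, Finset.smul_sum, Matrix.mulVec_mulVec, ← pow_succ', smul_smul, ← pow_succ']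
    have hsum : ∑ s ∈ Finset.Ioc r t, α • A.mulVec (((1 - α) * α ^ (t - s)) •
        (A ^ (t - s)).mulVec (y s)) = ∑ s ∈ Finset.Ioc r t, ((1 - α) * α ^ (t + 1 - s)) •
        (A ^ (t + 1 - s)).mulVec (y s) := by
      refine Finset.sum_congr rfl fun s hs => ?_
      have hs' : t + 1 - s = (t - s) + 1 := by
        rw [Finset.mem_Ioc] at hs
        omega
      rw [hs', Matrix.mulVec_smul, Matrix.mulVec_mulVec, ← pow_succ', smul_smul]
      congr 1
      ring
    rw [hsum]
    simp only [Nat.sub_self, pow_zero, mul_one, Matrix.one_mulVec]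
    abel

end Unrolled

/-- A version of `measure_exists_le_of_moments` for finitely many processes of which only the sum of
the fourth moments is controlled. -/
theorem sum_measure_exists_le_of_moments {Ω ι : Type*} [MeasurableSpace Ω] {P : Measure Ω}
    [IsProbabilityMeasure P] (A : Finset ι) {f : ι → ℕ → Ω → ℝ} {I : ℕ → Prop} {u M q : ℕ → ℝ}
    {η : ℝ} (hi : ∀ i ∈ A, ∀ t, I t → Integrable (fun ω => f i t ω ^ 4) P)
    (hM : ∀ t, I t → ∑ i ∈ A, ∫ ω, f i t ω ^ 4 ∂P ≤ M t) (hu : ∀ t, I t → 0 < u t)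
    (hq0 : ∀ t, 0 ≤ q t) (hq : ∀ t, I t → M t / u t ^ 4 ≤ q t)
    (hη : ∀ k, ∑ t ∈ Finset.range k, q t ≤ η) :
    ∑ i ∈ A, P {ω | ∃ t, I t ∧ u t ≤ |f i t ω|} ≤ ENNReal.ofReal η := by
  classical
  set p : ι → ℕ → ℝ := fun i t => if I t then (∫ ω, f i t ω ^ 4 ∂P) / u t ^ 4 else 0 with hp
  have hint : ∀ i t, 0 ≤ ∫ ω, f i t ω ^ 4 ∂P := fun i t => integral_nonneg fun ω => by positivity
  have hp0 : ∀ i t, 0 ≤ p i t := fun i t => by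
    simp only [hp]
    split_ifs with h
    · exact div_nonneg (hint i t) (pow_pos (hu t h) 4).le
    · exact le_rfl
  have hpq : ∀ t, ∑ i ∈ A, p i t ≤ q t := fun t => by
    simp only [hp]
    split_ifs with h
    · rw [← Finset.sum_div]
      refine le_trans ?_ (hq t h)
      have := pow_pos (hu t h) 4
      exact div_le_div_of_nonneg_right (hM t h) this.le
    · simpa using hq0 t
  have hpart : ∀ i ∈ A, ∀ k, ∑ t ∈ Finset.range k, p i t ≤ η := fun i hiA k =>
    (Finset.sum_le_sum fun t _ =>
      (Finset.single_le_sum (f := fun i => p i t) (fun j _ => hp0 j t) hiA).trans (hpq t)).trans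
      (hη k)
  have hsum : ∀ i ∈ A, Summable (p i) := fun i hiA =>
    summable_of_sum_range_le (hp0 i) (hpart i hiA)
  have hone : ∀ i ∈ A, P {ω | ∃ t, I t ∧ u t ≤ |f i t ω|} ≤ ENNReal.ofReal (∑' t, p i t) :=
    fun i hiA => measure_exists_le_of_moments (hi i hiA) (fun t _ => le_rfl) hu (hp0 i)
      (fun t h => by simp only [hp]; rw [if_pos h])
      fun k => (hsum i hiA).sum_le_tsum _ fun t _ => hp0 i t
  refine (Finset.sum_le_sum hone).trans ?_
  rw [← ENNReal.ofReal_sum_of_nonneg fun i _ => tsum_nonneg (hp0 i), ← Summable.tsum_finsetSum hsum]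
  refine ENNReal.ofReal_le_ofReal (Real.tsum_le_of_sum_range_le
    (fun t => Finset.sum_nonneg fun i _ => hp0 i t) fun k => ?_)
  exact (Finset.sum_le_sum fun t _ => hpq t).trans (hη k)

/-- A geometric window over the second half of the time interval: `1 / √s` may be replaced by its
value at the end, up to a factor `√2`. -/
theorem sum_geometric_mul_inv_sqrt_le {θ β : ℝ} (hβ : 0 ≤ β) (hθ : 0 ≤ θ) (hθ1 : θ < 1) {r t : ℕ}
    (hr : t < 2 * r) :
    ∑ s ∈ Finset.Ioc r t, β * θ ^ (t - s) * (1 / √(s : ℝ)) ≤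
      β / (1 - θ) * √(2 / (t : ℝ)) := by
  have h1 : ∀ s ∈ Finset.Ioc r t, β * θ ^ (t - s) * (1 / √(s : ℝ)) ≤
      β * √(2 / (t : ℝ)) * θ ^ (t - s) := by
    intro s hs
    rw [Finset.mem_Ioc] at hs
    have hs0 : (0 : ℝ) < s := by exact_mod_cast (by omega : 0 < s)
    have ht0 : (0 : ℝ) < t := by exact_mod_cast (by omega : 0 < t)
    have h2 : 1 / √(s : ℝ) ≤ √(2 / (t : ℝ)) := by
      rw [one_div, ← Real.sqrt_inv]
      refine Real.sqrt_le_sqrt ?_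
      rw [inv_eq_one_div, div_le_div_iff₀ hs0 ht0]
      have : (t : ℝ) ≤ 2 * s := by exact_mod_cast (by omega : t ≤ 2 * s)
      linarith
    calc β * θ ^ (t - s) * (1 / √(s : ℝ)) ≤ β * θ ^ (t - s) * √(2 / (t : ℝ)) := by gcongr
      _ = _ := by ring
  refine (Finset.sum_le_sum h1).trans ?_
  rw [← Finset.mul_sum]
  refine (mul_le_mul_of_nonneg_left (sum_geometric_weights_le hθ hθ1 r t)
    (by positivity)).trans (le_of_eq ?_)
  ring

theorem sqrt_two_div_pow_four (t : ℕ) : √(2 / (t : ℝ)) ^ 4 = 4 / (t : ℝ) ^ 2 := by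
  rw [show √(2 / (t : ℝ)) ^ 4 = (√(2 / (t : ℝ)) ^ 2) ^ 2 by ring, Real.sq_sqrt (by positivity),
    div_pow]
  norm_num

namespace System

variable {N : ℕ} {S : System N}

/-- If moreover the averages are close to their means, the neighbourhoods are settled from half the
identification time on. -/
theorem RegularPath.pruned_eq_of_dev_le {c : S.Component} {δ : ℝ} {Ω : Type*}
    {X : Fin N → ℕ → Ω → ℝ} {ω : Ω} (h : RegularPath c δ X ω) (hδ : 0 < δ) {a₀ : Fin N}
    (ha₀ : a₀ ∈ members c) {n : ℕ} (hn : 1 ≤ n)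
    (hgap : ENNReal.ofReal (S.beta (level c δ) n) < S.gap a₀ / 4) {m : ℕ} (hm : 1 ≤ m)
    (hnm : n ≤ 2 * m) {Δ : ℝ} (hΔ : ∀ b, b ∉ S.simClass a₀ → Δ ≤ |S.mean a₀ - S.mean b|)
    (hdev : ∀ b s, m ≤ s → |S.dev X s ω b| ≤ Δ / 8) {t : ℕ} (ht : m + 1 ≤ t)
    {a : Fin N} (ha : a ∈ members c) :
    S.pruned (level c δ) (fun s => empMean X s ω) t a = S.simClass a ∩ S.G.neighborSet a := by
  have hκ := kappa_nonneg (S := S) a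
  have hl := level_pos (c := c) hδ
  refine pruned_eq_of_separated hm (h.dev_le a ha) (fun b _ hcl s hs => ?_) ht
  rw [simClass_eq_of_mem ha ha₀] at hcl
  have hΔb := hΔ b hcl
  rw [mean_eq_of_mem ha₀ ha] at hΔb
  set G := |S.mean a - S.mean b| with hG
  have h1 : ENNReal.ofReal (S.beta (level c δ) n) < ENNReal.ofReal (G / 4) := by
    refine hgap.trans_le ?_
    rw [ENNReal.ofReal_div_of_pos (by norm_num), hG, mean_eq_of_mem ha ha₀]
    simpa using ENNReal.div_le_div_right (gap_le hcl) 4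
  have h2 : S.beta (level c δ) n < G / 4 :=
    (ENNReal.ofReal_lt_ofReal_iff_of_nonneg (beta_nonneg hκ hl n)).1 h1
  have hG0 : 0 < G := by linarith [beta_nonneg (S := S) hκ hl n]
  have hβ : ∀ s, m ≤ s → S.beta (level c δ) s < 3 / 8 * G := by
    intro s hs
    have hs1 : 1 ≤ s := hm.trans hs
    rcases le_total s n with hsn | hsn
    · refine lt_of_pow_lt_pow_left₀ 4 (by positivity) ?_
      have hs' : (0 : ℝ) < s := by exact_mod_cast hs1
      have h3 : (n : ℝ) / s ≤ 2 := by
        rw [div_le_iff₀ hs']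
        exact_mod_cast (by omega : n ≤ 2 * s)
      calc S.beta (level c δ) s ^ 4 ≤ S.beta (level c δ) n ^ 4 * ((n : ℝ) / s) :=
            beta_pow_four_le_mul_div hκ hl hs1 hsn
        _ ≤ (G / 4) ^ 4 * 2 := by
            have := pow_le_pow_left₀ (beta_nonneg hκ hl n) h2.le 4
            gcongr
        _ < (3 / 8 * G) ^ 4 := by
            rw [mul_pow, div_pow]
            have := pow_pos hG0 4
            linarith
    · linarith [beta_anti (S := S) hκ hl hn hsn]
  have h3 := hβ s hs
  have h4 := hβ (s + 1) (by omega)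
  have h5 := hdev a (s + 1) (by omega)
  have h6 := hdev b s hs
  have h7 : G ≤ |S.dev X (s + 1) ω a| + |empMean X (s + 1) ω a - empMean X s ω b| +
      |S.dev X s ω b| := by
    have : S.mean a - S.mean b = -S.dev X (s + 1) ω a +
        (empMean X (s + 1) ω a - empMean X s ω b) + S.dev X s ω b := by
      simp only [dev]
      ring
    rw [hG, this]
    refine (abs_add_three _ _ _).trans ?_
    rw [abs_neg]
  linarith

/-! ### Constant memory: the window of recent samples -/

/-- The contribution of the mean deviations of the second half of the time interval to the error
at time `t`. -/
noncomputable def windowAverage {Ω : Type*} (c : S.Component) (α : ℝ) (X : Fin N → ℕ → Ω → ℝ)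
    (t : ℕ) (ω : Ω) : ℝ :=
  ∑ s ∈ Finset.Ioc (t / 2 + 1) t, (1 - α) * α ^ (t - s) * avgDev c X s ω

/-- The contribution of the deviations from the mean deviation of the second half of the time
interval to the error at time `t`. -/
noncomputable def windowResidual {Ω : Type*} (c : S.Component) (α : ℝ) (X : Fin N → ℕ → Ω → ℝ)
    (t : ℕ) (ω : Ω) : members c → ℝ :=
  ∑ s ∈ Finset.Ioc (t / 2 + 1) t, ((1 - α) * α ^ (t - s)) •
    ((block c) ^ (t - s)).mulVec fun a : members c => S.dev X s ω a - avgDev c X s ω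

/-- The error splits into the forgotten past, the averaged and the residual recent deviations. -/
theorem IsRun.abs_est_const_sub_le {c : S.Component} {γ : ℝ} {Ω : Type*} [MeasurableSpace Ω]
    {P : Measure Ω} {X : Fin N → ℕ → Ω → ℝ} {Wt : ℕ → Ω → Matrix (Fin N) (Fin N) ℝ}
    (h : IsRun c γ P X Wt) {α : ℝ} (h0 : 0 ≤ α) {ω : Ω} {t : ℕ} (ht : 2 ≤ t)
    (hset : ∀ s, t / 2 + 1 ≤ s → ∀ a ∈ members c,
      S.pruned γ (fun s => empMean X s ω) s a = S.simClass a ∩ S.G.neighborSet a)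
    {m U : ℝ} (hm : ∀ a ∈ members c, S.mean a = m)
    (hU : ∀ a, |S.est (fun _ => α) (fun s => empMean X s ω) (fun s => Wt s ω) (t / 2 + 1) a - m| ≤
      U) (a : members c) :
    |S.est (fun _ => α) (fun s => empMean X s ω) (fun s => Wt s ω) t a - m| ≤
      α ^ (t - (t / 2 + 1)) * U + |windowAverage c α X t ω| + |windowResidual c α X t ω a| := by
  set u : ℕ → members c → ℝ := fun s a =>
    S.est (fun _ => α) (fun s => empMean X s ω) (fun s => Wt s ω) s a - m with hu
  have hrec : ∀ s, t / 2 + 1 ≤ s → s < t → u (s + 1) =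
      (1 - α) • (fun a : members c => S.dev X (s + 1) ω a) + α • (block c).mulVec (u s) := by
    intro s hs _
    ext a
    have := est_sub_succ (S := S) (α := fun _ => α) (xbar := fun s => empMean X s ω)
      (Wt := fun s => Wt s ω) (h.weight_settled s ω (hset s hs)) m a
    simp only [Pi.add_apply, Pi.smul_apply, smul_eq_mul, dev, hm a a.2]
    exact this
  have hsol := eq_sum_pow_mulVec_of_recursion (u := u)
    (y := fun s (a : members c) => S.dev X s ω a) (by omega : t / 2 + 1 ≤ t) hrec
  have hsplit : ∑ s ∈ Finset.Ioc (t / 2 + 1) t, ((1 - α) * α ^ (t - s)) •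
      ((block c) ^ (t - s)).mulVec (fun a : members c => S.dev X s ω a) =
      (fun _ => windowAverage c α X t ω) + windowResidual c α X t ω := by
    have e : ∀ s, ((block c) ^ (t - s)).mulVec (fun a : members c => S.dev X s ω a) =
        (fun _ => avgDev c X s ω) + ((block c) ^ (t - s)).mulVec
          (fun a : members c => S.dev X s ω a - avgDev c X s ω) := by
      intro s
      rw [← pow_mulVec_const (block_row_sum c) (avgDev c X s ω) (t - s), ← Matrix.mulVec_add]
      congr 1
      ext a
      simp only [Pi.add_apply]
      ring
    simp_rw [e, smul_add]
    rw [Finset.sum_add_distrib]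
    congr 1
    ext a
    rw [Finset.sum_apply]
    rfl
  have happ : u t a = α ^ (t - (t / 2 + 1)) *
      ((block c) ^ (t - (t / 2 + 1))).mulVec (u (t / 2 + 1)) a +
      (windowAverage c α X t ω + windowResidual c α X t ω a) := by
    rw [hsol, hsplit]
    rfl
  show |u t a| ≤ _
  rw [happ]
  have h1 := abs_pow_mulVec_le (block_nonneg c) (block_row_sum c) (v := u (t / 2 + 1))
    (fun a => hU a) (t - (t / 2 + 1)) a
  have h2 : |α ^ (t - (t / 2 + 1)) *
      ((block c) ^ (t - (t / 2 + 1))).mulVec (u (t / 2 + 1)) a| ≤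
      α ^ (t - (t / 2 + 1)) * U := by
    rw [abs_mul, abs_of_nonneg (pow_nonneg h0 _)]
    exact mul_le_mul_of_nonneg_left h1 (pow_nonneg h0 _)
  refine (abs_add_le _ _).trans ?_
  have h3 := abs_add_le (windowAverage c α X t ω) (windowResidual c α X t ω a)
  linarith

section Run

variable {c : S.Component} {γ : ℝ} {Ω : Type*} [MeasurableSpace Ω] {P : Measure Ω}
  {X : Fin N → ℕ → Ω → ℝ} {Wt : ℕ → Ω → Matrix (Fin N) (Fin N) ℝ}

theorem IsRun.memLp_windowAverage [IsProbabilityMeasure P] (h : IsRun c γ P X Wt) (α : ℝ) (t : ℕ) :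
    MemLp (windowAverage c α X t) 4 P :=
  memLp_finsetSum _ fun s hs =>
    (h.memLp_avgDev (by rw [Finset.mem_Ioc] at hs; omega)).const_mul _

theorem IsRun.integral_windowAverage_pow_four_le [IsProbabilityMeasure P] (hc : Nondegenerate c)
    (h : IsRun c γ P X Wt) {α : ℝ} (h0 : 0 < α) (h1 : α < 1) (t : ℕ) :
    ∫ ω, windowAverage c α X t ω ^ 4 ∂P ≤
      (totalFourth c + 3 * totalVar c ^ 2) / (size c : ℝ) ^ 4 * (4 / (t : ℝ) ^ 2) := by
  have hn : (1 : ℝ) ≤ size c := by exact_mod_cast one_le_size c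
  have hV := totalVar_pos hc
  have hF := totalFourth_nonneg c
  have hα : 0 < 1 - α := sub_pos.2 h1
  set w := (totalFourth c + 3 * totalVar c ^ 2) / (size c : ℝ) ^ 4 with hw
  have hw0 : 0 < w := by positivity
  have hv0 : 0 < √√w := Real.sqrt_pos.2 (Real.sqrt_pos.2 hw0)
  refine (integral_pow_four_sum_le _ (w := fun s => (1 - α) * α ^ (t - s))
    (b := fun s : ℕ => √√w * (1 / √(s : ℝ)))
    (fun s _ => by positivity) (fun s hs => ?_) (fun s hs => ?_) (fun s hs => ?_)).trans ?_
  · have : (0 : ℝ) < s := by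
      rw [Finset.mem_Ioc] at hs
      exact_mod_cast (by omega : 0 < s)
    positivity
  · exact integrable_pow_of_memLp_four
      (h.memLp_avgDev (by rw [Finset.mem_Ioc] at hs; omega)) le_rfl
  · have hs1 : 1 ≤ s := by rw [Finset.mem_Ioc] at hs; omega
    refine (h.integral_avgDev_pow_four_le hs1).trans (le_of_eq ?_)
    rw [mul_pow, sqrt_sqrt_pow_four hw0.le, div_pow, one_pow,
      show √(s : ℝ) ^ 4 = (√(s : ℝ) ^ 2) ^ 2 by ring, Real.sq_sqrt (by positivity), mul_one_div]
  · have hs := sum_geometric_mul_inv_sqrt_le hα.le h0.le h1 (r := t / 2 + 1) (t := t) (by omega)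
    rw [div_self hα.ne', one_mul] at hs
    have e : ∑ s ∈ Finset.Ioc (t / 2 + 1) t, (1 - α) * α ^ (t - s) * (√√w * (1 / √(s : ℝ))) =
        √√w * ∑ s ∈ Finset.Ioc (t / 2 + 1) t, (1 - α) * α ^ (t - s) * (1 / √(s : ℝ)) := by
      rw [Finset.mul_sum]
      exact Finset.sum_congr rfl fun s _ => by ring
    rw [e, mul_pow, sqrt_sqrt_pow_four hw0.le, ← sqrt_two_div_pow_four]
    have : 0 ≤ ∑ s ∈ Finset.Ioc (t / 2 + 1) t, (1 - α) * α ^ (t - s) * (1 / √(s : ℝ)) :=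
      Finset.sum_nonneg fun s _ => by positivity
    gcongr

theorem IsRun.memLp_windowResidual [IsProbabilityMeasure P] (h : IsRun c γ P X Wt) (α : ℝ) (t : ℕ)
    (a : members c) : MemLp (fun ω => windowResidual c α X t ω a) 4 P := by
  have e : (fun ω => windowResidual c α X t ω a) = fun ω => ∑ s ∈ Finset.Ioc (t / 2 + 1) t,
      (1 - α) * α ^ (t - s) * ∑ b, ((block c) ^ (t - s)) a b *
        (S.dev X s ω b - avgDev c X s ω) := by
    ext ω
    rw [windowResidual, Finset.sum_apply]
    rfl
  rw [e]
  refine memLp_finsetSum _ fun s hs => ?_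
  have hs1 : 1 ≤ s := by rw [Finset.mem_Ioc] at hs; omega
  have hsub : ∀ b : members c, MemLp (fun ω => S.dev X s ω b - avgDev c X s ω) 4 P := fun b =>
    (h.memLp_dev hs1 b).sub (h.memLp_avgDev hs1)
  generalize hB : (block c) ^ (t - s) = B
  have hsum : MemLp (fun ω => ∑ b : members c, B a b * (S.dev X s ω b - avgDev c X s ω)) 4 P :=
    memLp_finsetSum _ fun b _ => (hsub b).const_mul (B a b)
  exact hsum.const_mul _

/-- The residual is damped by the second modulus of the block on top of the memory. -/
theorem norm_windowResidual_le {Ω : Type*} (c : S.Component) {α : ℝ} (h0 : 0 ≤ α) (h1 : α ≤ 1)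
    (X : Fin N → ℕ → Ω → ℝ) (t : ℕ) (ω : Ω) :
    ‖WithLp.toLp 2 (windowResidual c α X t ω)‖ ≤ ∑ s ∈ Finset.Ioc (t / 2 + 1) t,
      (1 - α) * (α * lambda2 c) ^ (t - s) *
        ‖WithLp.toLp 2 fun a : members c => S.dev X s ω a‖ := by
  rw [windowResidual, WithLp.toLp_sum]
  refine (norm_sum_le _ _).trans (Finset.sum_le_sum fun s _ => ?_)
  have hα : 0 ≤ 1 - α := sub_nonneg.2 h1
  have hl := lambda2_nonneg c
  rw [WithLp.toLp_smul, norm_smul, Real.norm_of_nonneg (by positivity)]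
  have e1 : ∑ a : members c, (S.dev X s ω a - avgDev c X s ω) = 0 := by
    have hn : (Fintype.card (members c) : ℝ) ≠ 0 := by
      rw [card_members]
      have := one_le_size c
      positivity
    rw [Finset.sum_sub_distrib, Finset.sum_const, Finset.card_univ, nsmul_eq_mul, ← avgDev_eq,
      mul_div_cancel₀ _ hn, sub_self]
  have e2 := norm_pow_mulVec_le_secondModulus (block_isSymm c) (block_nonneg c) (block_row_sum c)
    (block_fixed c) e1 (t - s)
  have e3 := norm_sub_average_le fun a : members c => S.dev X s ω a
  rw [avgDev_eq] at e3
  rw [← lambda2_eq_secondModulus] at e2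
  calc (1 - α) * α ^ (t - s) * _
      ≤ (1 - α) * α ^ (t - s) * (lambda2 c ^ (t - s) *
          ‖WithLp.toLp 2 fun a : members c => S.dev X s ω a‖) := by
        refine mul_le_mul_of_nonneg_left (e2.trans ?_) (by positivity)
        gcongr
    _ = _ := by
        rw [mul_pow]
        ring

theorem norm_toLp_pow_four {ι : Type*} [Fintype ι] (v : ι → ℝ) :
    ‖WithLp.toLp 2 v‖ ^ 4 = (∑ a, v a ^ 2) ^ 2 := by
  rw [show ∀ y : ℝ, y ^ 4 = (y ^ 2) ^ 2 from fun y => by ring, EuclideanSpace.norm_sq_eq]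
  simp only [Real.norm_eq_abs, sq_abs]

/-- The norm of the residual controls the sum of the fourth moments of the agents. For a random
agent of the component this gains the factor `1 / n_c`. -/
theorem IsRun.sum_integral_windowResidual_pow_four_le [IsProbabilityMeasure P]
    (hc : Nondegenerate c) (h : IsRun c γ P X Wt) {α : ℝ} (h0 : 0 < α) (h1 : α < 1) (t : ℕ) :
    ∑ a, ∫ ω, windowResidual c α X t ω a ^ 4 ∂P ≤
      ((1 - α) / (1 - α * lambda2 c)) ^ 4 * (totalFourth c + 4 * totalVar c ^ 2) *
        (4 / (t : ℝ) ^ 2) := by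
  have hV := totalVar_pos hc
  have hF := totalFourth_nonneg c
  have hα : 0 < 1 - α := sub_pos.2 h1
  have hl := lambda2_nonneg c
  have hl1 := lambda2_le_one c
  have hαl : α * lambda2 c < 1 := lt_of_le_of_lt (mul_le_of_le_one_right h0.le hl1) h1
  set w := totalFourth c + 4 * totalVar c ^ 2 with hw
  have hw0 : 0 < w := by positivity
  have hv0 : 0 < √√w := Real.sqrt_pos.2 (Real.sqrt_pos.2 hw0)
  set y : ℕ → Ω → ℝ := fun s ω => ‖WithLp.toLp 2 fun a : members c => S.dev X s ω a‖ with hy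
  have hy4 : ∀ s ω, y s ω ^ 4 = (∑ a ∈ members c, S.dev X s ω a ^ 2) ^ 2 := fun s ω => by
    rw [hy, norm_toLp_pow_four, Finset.sum_coe_sort (members c) (fun a => S.dev X s ω a ^ 2)]
  have hyint : ∀ s, 1 ≤ s → Integrable (fun ω => y s ω ^ 4) P := fun s hs => by
    simp_rw [hy4]
    exact integrable_sq_sum_sq (fun a => h.measurable_dev s a) (fun a => h.memLp_dev hs a) _
  have hs1 : ∀ s ∈ Finset.Ioc (t / 2 + 1) t, 1 ≤ s := fun s hs => by
    rw [Finset.mem_Ioc] at hs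
    omega
  have hmeas : ∀ s, 1 ≤ s → MemLp (y s) 4 P := fun s hs => by
    have hm : Measurable (y s) := by
      have : y s = fun ω => √(∑ a : members c, S.dev X s ω a ^ 2) := by
        ext ω
        simp only [hy, EuclideanSpace.norm_eq, Real.norm_eq_abs, sq_abs]
      rw [this]
      exact (Finset.measurable_fun_sum _ fun (a : members c) _ =>
        (h.measurable_dev s a).pow_const 2).sqrt
    exact (memLp_four_iff_integrable_pow hm).2 (hyint s hs)
  set Y : Ω → ℝ := fun ω => ∑ s ∈ Finset.Ioc (t / 2 + 1) t,
      (1 - α) * (α * lambda2 c) ^ (t - s) * y s ω with hY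
  have hYm : MemLp Y 4 P := memLp_finsetSum _ fun s hs => (hmeas s (hs1 s hs)).const_mul _
  have hr4 : ∀ a, Integrable (fun ω => windowResidual c α X t ω a ^ 4) P := fun a =>
    integrable_pow_of_memLp_four (h.memLp_windowResidual α t a) le_rfl
  have hpoint : ∀ ω, ∑ a, windowResidual c α X t ω a ^ 4 ≤ Y ω ^ 4 := fun ω => by
    have h2 := pow_le_pow_left₀ (norm_nonneg _) (norm_windowResidual_le c h0.le h1.le X t ω) 4
    rw [norm_toLp_pow_four] at h2
    refine le_trans ?_ h2
    have := Finset.sum_sq_le_sq_sum_of_nonneg (s := Finset.univ)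
      (f := fun a => windowResidual c α X t ω a ^ 2) fun a _ => sq_nonneg _
    refine le_trans (le_of_eq (Finset.sum_congr rfl fun a _ => ?_)) this
    ring
  rw [← integral_finsetSum _ fun a _ => hr4 a]
  refine (integral_mono (integrable_finsetSum _ fun a _ => hr4 a)
    (integrable_pow_of_memLp_four hYm le_rfl) hpoint).trans ?_
  refine (integral_pow_four_sum_le _ (w := fun s => (1 - α) * (α * lambda2 c) ^ (t - s))
    (b := fun s : ℕ => √√w * (1 / √(s : ℝ)))
    (fun s _ => by positivity) (fun s hs => ?_) (fun s hs => ?_) (fun s hs => ?_)).trans ?_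
  · have : (0 : ℝ) < s := by exact_mod_cast hs1 s hs
    positivity
  · exact hyint s (hs1 s hs)
  · simp_rw [hy4]
    refine (h.integral_sq_sum_dev_sq_le (hs1 s hs)).trans (le_of_eq ?_)
    rw [mul_pow, sqrt_sqrt_pow_four hw0.le, div_pow, one_pow,
      show √(s : ℝ) ^ 4 = (√(s : ℝ) ^ 2) ^ 2 by ring, Real.sq_sqrt (by positivity), mul_one_div]
  · have hs := sum_geometric_mul_inv_sqrt_le hα.le (by positivity : 0 ≤ α * lambda2 c) hαl
      (r := t / 2 + 1) (t := t) (by omega)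
    have e : ∑ s ∈ Finset.Ioc (t / 2 + 1) t,
        (1 - α) * (α * lambda2 c) ^ (t - s) * (√√w * (1 / √(s : ℝ))) =
        √√w * ∑ s ∈ Finset.Ioc (t / 2 + 1) t,
          (1 - α) * (α * lambda2 c) ^ (t - s) * (1 / √(s : ℝ)) := by
      rw [Finset.mul_sum]
      exact Finset.sum_congr rfl fun s _ => by ring
    have e2 : ((1 - α) / (1 - α * lambda2 c)) ^ 4 * w * (4 / (t : ℝ) ^ 2) =
        w * ((1 - α) / (1 - α * lambda2 c) * √(2 / (t : ℝ))) ^ 4 := by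
      rw [mul_pow, sqrt_two_div_pow_four]
      ring
    rw [e, mul_pow, sqrt_sqrt_pow_four hw0.le, e2]
    have : 0 ≤ ∑ s ∈ Finset.Ioc (t / 2 + 1) t,
        (1 - α) * (α * lambda2 c) ^ (t - s) * (1 / √(s : ℝ)) :=
      Finset.sum_nonneg fun s _ => by positivity
    gcongr

/-- The averages are uniformly close to their means after a time `T`. -/
theorem IsRun.measure_le_dev_le [IsProbabilityMeasure P] (h : IsRun c γ P X Wt) {y T x : ℝ}
    (hy : 0 < y) (hx : 0 < x) (hxT : x ≤ max 1 T) (a : Fin N) :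
    P {ω | ∃ t : ℕ, (T < t ∧ 1 ≤ t) ∧ y ≤ |S.dev X t ω a|} ≤
      ENNReal.ofReal ((S.κ + 3) * S.σ ^ 4 / y ^ 4 * (2 / x)) := by
  have hκ := kappa_nonneg (S := S) a
  have hσ := S.σ_pos
  refine measure_exists_le_of_moments (M := fun t : ℕ => (S.κ + 3) * S.σ ^ 4 / (t : ℝ) ^ 2)
    (q := fun t : ℕ => (S.κ + 3) * S.σ ^ 4 / y ^ 4 * (if T < t then 1 / (t : ℝ) ^ 2 else 0))
    (fun t ht => integrable_pow_of_memLp_four (h.memLp_dev ht.2 a) le_rfl)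
    (fun t ht => ?_) (fun _ _ => hy) (fun t => by split_ifs <;> positivity)
    (fun t ht => ?_) (fun k => ?_)
  · refine (h.integral_dev_pow_four_le ht.2 a).trans ?_
    have := fourth_add_le (S := S) a
    gcongr
  · rw [if_pos ht.1]
    refine le_of_eq ?_
    ring
  · rw [← Finset.mul_sum]
    exact mul_le_mul_of_nonneg_left (sum_inv_sq_tail_le hx hxT k) (by positivity)

theorem IsRun.measure_windowAverage_le [IsProbabilityMeasure P] (hc : Nondegenerate c)
    (h : IsRun c γ P X Wt) {α : ℝ} (h0 : 0 < α) (h1 : α < 1) {ε x : ℝ} (hε : 0 < ε) (hx : 0 < x) :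
    P {ω | ∃ t : ℕ, (x < t ∧ 1 ≤ t) ∧ ε / 4 ≤ |windowAverage c α X t ω|} ≤
      ENNReal.ofReal (8192 * (fullMoment c / (size c : ℝ) ^ 4) / ε ^ 4 / x) := by
  have hn : (1 : ℝ) ≤ size c := by exact_mod_cast one_le_size c
  have hV := totalVar_pos hc
  have hF := totalFourth_nonneg c
  set w := (totalFourth c + 3 * totalVar c ^ 2) / (size c : ℝ) ^ 4 with hw
  have hwF : w ≤ 4 * (fullMoment c / (size c : ℝ) ^ 4) := by
    obtain ⟨b1, b2⟩ := fullMoment_bounds c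
    rw [hw, ← mul_div_assoc]
    gcongr
    linarith
  have hw0 : 0 < w := by positivity
  refine measure_exists_le_of_moments (M := fun t : ℕ => w * (4 / (t : ℝ) ^ 2))
    (q := fun t : ℕ => 1024 * w / ε ^ 4 * (if x < t then 1 / (t : ℝ) ^ 2 else 0))
    (fun t _ => integrable_pow_of_memLp_four (h.memLp_windowAverage α t) le_rfl)
    (fun t _ => h.integral_windowAverage_pow_four_le hc h0 h1 t) (fun _ _ => by positivity)
    (fun t => by split_ifs <;> positivity) (fun t ht => ?_) (fun k => ?_)
  · rw [if_pos ht.1]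
    have ht' : (0 : ℝ) < t := by exact_mod_cast ht.2
    refine le_of_eq ?_
    field_simp
    norm_num
  · rw [← Finset.mul_sum]
    refine (mul_le_mul_of_nonneg_left (sum_inv_sq_tail_le hx (le_max_right 1 x) k)
      (by positivity)).trans ?_
    have e : 1024 * w / ε ^ 4 * (2 / x) = 2048 * w / ε ^ 4 / x := by
      field_simp
      norm_num
    rw [e]
    have : 2048 * w ≤ 8192 * (fullMoment c / (size c : ℝ) ^ 4) := by linarith
    gcongr

theorem IsRun.sum_measure_windowResidual_le [IsProbabilityMeasure P] (hc : Nondegenerate c)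
    (h : IsRun c γ P X Wt) {α : ℝ} (h0 : 0 < α) (h1 : α < 1) {ε x : ℝ} (hε : 0 < ε) (hx : 0 < x) :
    ∑ a : members c, P {ω | ∃ t : ℕ, (x < t ∧ 1 ≤ t) ∧ ε / 4 ≤ |windowResidual c α X t ω a|} ≤
      ENNReal.ofReal
        (10240 * (((1 - α) / (1 - α * lambda2 c)) ^ 4 * fullMoment c) / ε ^ 4 / x) := by
  have hV := totalVar_pos hc
  have hF := totalFourth_nonneg c
  set w := ((1 - α) / (1 - α * lambda2 c)) ^ 4 * (totalFourth c + 4 * totalVar c ^ 2) with hw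
  have hwF : w ≤ 5 * (((1 - α) / (1 - α * lambda2 c)) ^ 4 * fullMoment c) := by
    obtain ⟨b1, b2⟩ := fullMoment_bounds c
    rw [hw, mul_left_comm]
    gcongr
    linarith
  have hw0 : 0 ≤ w := by positivity
  refine sum_measure_exists_le_of_moments Finset.univ (f := fun a t ω => windowResidual c α X t ω a)
    (M := fun t : ℕ => w * (4 / (t : ℝ) ^ 2))
    (q := fun t : ℕ => 1024 * w / ε ^ 4 * (if x < t then 1 / (t : ℝ) ^ 2 else 0))
    (fun a _ t _ => integrable_pow_of_memLp_four (h.memLp_windowResidual α t a) le_rfl)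
    (fun t _ => h.sum_integral_windowResidual_pow_four_le hc h0 h1 t) (fun _ _ => by positivity)
    (fun t => by split_ifs <;> positivity) (fun t ht => ?_) (fun k => ?_)
  · rw [if_pos ht.1]
    have ht' : (0 : ℝ) < t := by exact_mod_cast ht.2
    refine le_of_eq ?_
    field_simp
    norm_num
  · rw [← Finset.mul_sum]
    refine (mul_le_mul_of_nonneg_left (sum_inv_sq_tail_le hx (le_max_right 1 x) k)
      (by positivity)).trans ?_
    have e : 1024 * w / ε ^ 4 * (2 / x) = 2048 * w / ε ^ 4 / x := by
      ring
    rw [e]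
    have : 2048 * w ≤ 10240 * (((1 - α) / (1 - α * lambda2 c)) ^ 4 * fullMoment c) := by linarith
    gcongr

end Run

end System

/-! ### Constant memory: small accuracies -/

/-- A constant memory forgets the first half of the past faster than `1 / t`. -/
theorem mul_pow_half_le {α : ℝ} (h0 : 0 < α) (h1 : α < 1) (t : ℕ) :
    (t : ℝ) * α ^ (t - (t / 2 + 1)) ≤ 6 / (1 - α) := by
  set k := t - (t / 2 + 1) with hk
  have hα : 0 < 1 - α := sub_pos.2 h1
  have h2 : (k : ℝ) * α ^ k ≤ 1 / (1 - α) := by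
    refine le_trans ?_ (sum_geometric_weights_le h0.le h1 0 k)
    have := Finset.card_nsmul_le_sum (Finset.Ioc 0 k) (fun s => α ^ (k - s)) (α ^ k)
      fun s _ => pow_le_pow_of_le_one h0.le h1.le (Nat.sub_le k s)
    rwa [Nat.card_Ioc, nsmul_eq_mul, Nat.sub_zero] at this
  have h3 : α ^ k ≤ 1 / (1 - α) := by
    refine (pow_le_one₀ h0.le h1.le).trans ?_
    rw [le_div_iff₀ hα]
    linarith
  have h4 : (t : ℝ) ≤ 2 * (k + 2) := by exact_mod_cast (by omega : t ≤ 2 * (k + 2))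
  have h5 : 0 ≤ α ^ k := by positivity
  calc (t : ℝ) * α ^ k ≤ 2 * (k + 2) * α ^ k := by gcongr
    _ = 2 * (k * α ^ k) + 4 * α ^ k := by ring
    _ ≤ 2 * (1 / (1 - α)) + 4 * (1 / (1 - α)) := by gcongr
    _ = 6 / (1 - α) := by ring

namespace System

variable {N : ℕ} {S : System N}

/-- The factor by which a constant memory `α` scales the averaging time. -/
noncomputable def constFactor (c : S.Component) (α : ℝ) : ℝ :=
  (1 - α) ^ 2 / (1 - α * lambda2 c) ^ 2 * (1 + 1 / Real.log (1 / (α * lambda2 c))) ^ 2 +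
    1 / (size c : ℝ) ^ 2 * (1 + 1 / Real.log (1 / α)) ^ 2

/-- The time in the form of `exists_const_of_small_of_large`. -/
theorem tauConst_eq {c : S.Component} {a : Fin N} (ha : a ∈ members c) (α C ε δ : ℝ) :
    S.tauConst α C ε δ a =
      max (S.zeta a δ : ℝ) (C * (fullMoment c / size c * constFactor c α / (ε ^ 4 * δ))) := by
  rw [tauConst, mem_members.1 ha, constFactor]
  congr 1
  ring

/-- The logarithmic terms of the factor only increase it. -/
theorem constFactor_bounds (c : S.Component) {α : ℝ} (h0 : 0 < α) (h1 : α < 1) :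
    ((1 - α) / (1 - α * lambda2 c)) ^ 4 ≤ constFactor c α ∧
      1 / (size c : ℝ) ^ 2 ≤ constFactor c α := by
  have hl := lambda2_nonneg c
  have hl1 := lambda2_le_one c
  have hαl : α * lambda2 c ≤ α := mul_le_of_le_one_right h0.le hl1
  have hn : (1 : ℝ) ≤ size c := by exact_mod_cast one_le_size c
  have hlog : ∀ x : ℝ, 0 ≤ x → x ≤ 1 → 1 ≤ (1 + 1 / Real.log (1 / x)) ^ 2 := fun x hx hx1 => by
    have h2 : 0 ≤ 1 / Real.log (1 / x) := by
      rw [one_div x, Real.log_inv]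
      have := Real.log_nonpos hx hx1
      exact one_div_nonneg.2 (by linarith)
    exact one_le_pow₀ (by linarith)
  have e1 := hlog (α * lambda2 c) (by positivity) (by linarith)
  have e2 := hlog α h0.le h1.le
  set ρ := (1 - α) / (1 - α * lambda2 c) with hρ
  have hρ0 : 0 ≤ ρ := div_nonneg (by linarith) (by linarith)
  have hρ1 : ρ ≤ 1 := div_le_one_of_le₀ (by linarith) (by linarith)
  have hform : constFactor c α = ρ ^ 2 * (1 + 1 / Real.log (1 / (α * lambda2 c))) ^ 2 +
      1 / (size c : ℝ) ^ 2 * (1 + 1 / Real.log (1 / α)) ^ 2 := by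
    rw [constFactor, hρ, div_pow]
  have f1 := le_mul_of_one_le_right (sq_nonneg ρ) e1
  have f2 : 1 / (size c : ℝ) ^ 2 ≤ 1 / (size c : ℝ) ^ 2 * (1 + 1 / Real.log (1 / α)) ^ 2 :=
    le_mul_of_one_le_right (by positivity) e2
  have f3 : ρ ^ 4 ≤ ρ ^ 2 := pow_le_pow_of_le_one hρ0 hρ1 (by norm_num)
  have f4 : 0 < 1 / (size c : ℝ) ^ 2 := by positivity
  have f5 := sq_nonneg ρ
  rw [hform]
  constructor <;> linarith

theorem constFactor_pos (c : S.Component) {α : ℝ} (h0 : 0 < α) (h1 : α < 1) :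
    0 < constFactor c α := by
  have hn : (1 : ℝ) ≤ size c := by exact_mod_cast one_le_size c
  exact lt_of_lt_of_le (by positivity) (constFactor_bounds c h0 h1).2

theorem fullMoment_pos {c : S.Component} (hc : Nondegenerate c) : 0 < fullMoment c :=
  (pow_pos (totalVar_pos hc) 2).trans_le (fullMoment_bounds c).2

/-- The last half of the time before `t` lies after half of the identification time, and after
half of the averaging time. There the averages are close to their means, so that the
neighbourhoods are settled, and the recursion may be unrolled over this window. -/
theorem accurateAfter_const_small {c : S.Component} (hc : Nondegenerate c) {α : ℝ} (h0 : 0 < α)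
    (h1 : α < 1) :
    ∃ ε₀ : ℝ, 0 < ε₀ ∧ ∀ ε δ : ℝ, 0 < ε → ε ≤ ε₀ → 0 < δ → δ < 1 →
      AccurateAfter.{u} c (fun _ => α) ε δ (S.tauConst α 1000000 ε δ) := by
  obtain ⟨a₀, ha₀⟩ := members_nonempty c
  have hκ := kappa_nonneg (S := S) a₀
  have hσ := S.σ_pos
  have hN : (1 : ℝ) ≤ N := by exact_mod_cast a₀.pos
  have hn : (1 : ℝ) ≤ size c := by exact_mod_cast one_le_size c
  have hdc := one_le_devConst (S := S) hκ
  have hα : 0 < 1 - α := sub_pos.2 h1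
  obtain ⟨D, hD, hinit, hmean⟩ := exists_spread (S := S) (S.mean a₀)
  obtain ⟨Δ, hΔ, hΔle⟩ := exists_pos_le_gap (S := S) a₀
  have hF := fullMoment_pos hc
  have hΛ := constFactor_pos c h0 h1
  obtain ⟨hΛ1, hΛ2⟩ := constFactor_bounds c h0 h1
  set Λ := constFactor c α with hΛdef
  set F := fullMoment c with hFdef
  set q := F / size c * Λ with hq
  have hq0 : 0 < q := by positivity
  set c₀ := 1000000 * q with hc₀
  have hc₀0 : 0 < c₀ := by positivity
  set R := D + N * S.devConst with hR
  have hR0 : 0 ≤ R := by positivity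
  set V := (S.κ + 3) * S.σ ^ 4 / (Δ / 8) ^ 4 with hV
  obtain ⟨ε₀, hε₀, hcond⟩ := exists_forall_le_of_eventually
    ((eventually_mul_pow_lt 2 hc₀0 (by norm_num : 4 ≠ 0)).and <|
      (eventually_mul_pow_lt (4 * (6 / (1 - α) * R)) hc₀0 (by norm_num : 3 ≠ 0)).and <|
      (eventually_mul_pow_lt (160 * (N * V)) hc₀0 (by norm_num : 4 ≠ 0)))
  refine ⟨ε₀, hε₀, fun ε δ hε hεε₀ hδ hδ1 => accurateAfter_of_bad hδ.le ?_⟩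
  obtain ⟨e1, e2, e3⟩ := hcond ε hε hεε₀
  intro Ω _ P _ X Wt hrun
  set d := √√δ with hd
  have hd0 : 0 < d := Real.sqrt_pos.2 (Real.sqrt_pos.2 hδ)
  have hd1 : d ≤ 1 := Real.sqrt_le_one.2 (Real.sqrt_le_one.2 hδ1.le)
  have hd4 : d ^ 4 = δ := sqrt_sqrt_pow_four hδ.le
  set x := c₀ / (ε ^ 4 * δ) with hx
  have hx0 : 0 < x := by positivity
  have hx2 : 2 ≤ x := by
    rw [hx, le_div_iff₀ (by positivity)]
    have : ε ^ 4 * δ ≤ ε ^ 4 := mul_le_of_le_one_right (by positivity) hδ1.le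
    linarith
  have hτ : ∀ a ∈ members c, S.tauConst α 1000000 ε δ a = max (S.zeta a δ : ℝ) x := by
    intro a ha
    rw [tauConst_eq ha, hx, hc₀, ← mul_div_assoc]
  -- these sets have probability at most `4 δ / 5`, `δ / 20` and `δ / 20`; the residuals of the
  -- agents take up another `δ / 20` on average
  set bad : Set Ω := ({ω | ¬ RegularPath c δ X ω} ∪
    {ω | ∃ b ∈ Finset.univ, ω ∈ {ω | ∃ t : ℕ, ((x - 1) / 2 < t ∧ 1 ≤ t) ∧
      Δ / 8 ≤ |S.dev X t ω b|}}) ∪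
    {ω | ∃ t : ℕ, (x < t ∧ 1 ≤ t) ∧ ε / 4 ≤ |windowAverage c α X t ω|} with hbad
  refine ⟨fun a => bad ∪ {ω | ∃ ha : a ∈ members c, ∃ t : ℕ, (x < t ∧ 1 ≤ t) ∧
    ε / 4 ≤ |windowResidual c α X t ω ⟨a, ha⟩|}, ?_, fun a ha ω hω t ht => ?_⟩
  · have p1 := hrun.measure_not_regularPath_le hδ
    have p2 := measure_exists_finset_le (P := P) Finset.univ fun b (_ : b ∈ Finset.univ) =>
      hrun.measure_le_dev_le (y := Δ / 8) (T := (x - 1) / 2) (x := x / 4) (by positivity)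
        (by positivity) ((by linarith : x / 4 ≤ (x - 1) / 2).trans (le_max_right _ _)) b
    have p3 := hrun.measure_windowAverage_le hc h0 h1 hε hx0
    have p4 := hrun.sum_measure_windowResidual_le hc h0 h1 hε hx0
    have q2 : ((Finset.univ : Finset (Fin N)).card : ℝ) *
        ((S.κ + 3) * S.σ ^ 4 / (Δ / 8) ^ 4 * (2 / (x / 4))) ≤ 1 / 20 * δ := by
      rw [Finset.card_univ, Fintype.card_fin, ← hV]
      have e : (N : ℝ) * (V * (2 / (x / 4))) = (160 * (N * V) * ε ^ 4) / c₀ * (1 / 20 * δ) := by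
        rw [hx]
        field_simp
        ring
      rw [e]
      exact mul_le_of_le_one_left (by positivity) ((div_le_one hc₀0).2 e3.le)
    have q3 : 8192 * (F / (size c : ℝ) ^ 4) / ε ^ 4 / x ≤ 1 / 20 * δ := by
      have e : 8192 * (F / (size c : ℝ) ^ 4) / ε ^ 4 / x =
          8192 / 1000000 * δ * (1 / (size c * ((size c : ℝ) ^ 2 * Λ))) := by
        rw [hx, hc₀, hq]
        field_simp
      have h2 : 1 ≤ (size c : ℝ) * ((size c : ℝ) ^ 2 * Λ) := by
        rw [div_le_iff₀ (by positivity)] at hΛ2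
        nlinarith
      have h3 : 1 / ((size c : ℝ) * ((size c : ℝ) ^ 2 * Λ)) ≤ 1 := (div_le_one (by positivity)).2 h2
      rw [e]
      have := mul_le_mul_of_nonneg_left h3 (by positivity : 0 ≤ 8192 / 1000000 * δ)
      linarith
    have q4 : 10240 * (((1 - α) / (1 - α * lambda2 c)) ^ 4 * F) / ε ^ 4 / x ≤
        size c * (1 / 20 * δ) := by
      set ρ := ((1 - α) / (1 - α * lambda2 c)) ^ 4 with hρ
      have e : 10240 * (ρ * F) / ε ^ 4 / x = 10240 / 1000000 * δ * size c * (ρ / Λ) := by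
        rw [hx, hc₀, hq]
        field_simp
      have h3 : ρ / Λ ≤ 1 := (div_le_one hΛ).2 hΛ1
      rw [e]
      have := mul_le_mul_of_nonneg_left h3 (by positivity : 0 ≤ 10240 / 1000000 * δ * size c)
      have h5 : 0 < size c * δ := by positivity
      linarith
    have hP : P bad ≤ ENNReal.ofReal (9 / 10 * δ) := by
      refine (measure_union_le _ _).trans ((add_le_add ((measure_union_le _ _).trans (add_le_add p1
        (p2.trans (ENNReal.ofReal_le_ofReal q2))))
        (p3.trans (ENNReal.ofReal_le_ofReal q3))).trans ?_)
      rw [← ENNReal.ofReal_add (by positivity) (by positivity),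
        ← ENNReal.ofReal_add (by positivity) (by positivity)]
      exact ENNReal.ofReal_le_ofReal (by linarith)
    have hres : ∑ a ∈ members c, P {ω | ∃ ha : a ∈ members c, ∃ t : ℕ, (x < t ∧ 1 ≤ t) ∧
        ε / 4 ≤ |windowResidual c α X t ω ⟨a, ha⟩|} ≤ ENNReal.ofReal (size c * (1 / 20 * δ)) := by
      refine le_trans (le_of_eq ?_) (p4.trans (ENNReal.ofReal_le_ofReal q4))
      rw [← Finset.sum_coe_sort (members c)]
      refine Finset.sum_congr rfl fun a _ => ?_
      congr 1
      ext ω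
      exact ⟨fun ⟨_, h⟩ => h, fun h => ⟨a.2, h⟩⟩
    refine (Finset.sum_le_sum fun a _ => measure_union_le _ _).trans ?_
    rw [Finset.sum_add_distrib, Finset.sum_const, nsmul_eq_mul]
    have hsz : ((members c).card : ENNReal) = ENNReal.ofReal (size c) :=
      (ENNReal.ofReal_natCast _).symm
    refine (add_le_add (mul_le_mul_right hP _) hres).trans ?_
    rw [hsz, ← ENNReal.ofReal_mul (by positivity), ← ENNReal.ofReal_add (by positivity)
      (by positivity)]
    refine ENNReal.ofReal_le_ofReal ?_
    have : 0 < size c * δ := by positivity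
    linarith
  · rw [hτ a ha, max_lt_iff] at ht
    obtain ⟨htz, htx⟩ := ht
    simp only [hbad, Set.mem_union, Set.mem_ofPred_eq, not_or, not_not, not_exists, not_and, not_le,
      Finset.mem_univ, true_imp_iff] at hω
    obtain ⟨⟨⟨hreg, hdev⟩, havg⟩, hresid⟩ := hω
    have hl := level_pos (c := c) hδ
    obtain ⟨hn1, hgap⟩ := nStar_spec (S := S) hκ hl (x := S.gap a₀ / 4)
      (ENNReal.div_pos (gap_pos a₀).ne' (by norm_num))
    have hz : S.zeta a δ = S.nStar (level c δ) (S.gap a₀ / 4) + 1 := by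
      rw [zeta, mem_members.1 ha, gap_eq_of_mem ha ha₀]
    rw [hz] at htz
    -- hence `nStar ≤ 2 (t / 2)` in spite of the integer division
    have htz' : S.nStar (level c δ) (S.gap a₀ / 4) + 1 < t := by exact_mod_cast htz
    have ht2 : 2 ≤ t := by omega
    have ht0 : (0 : ℝ) < t := by linarith
    have hset : ∀ s, t / 2 + 1 ≤ s → ∀ a ∈ members c,
        S.pruned (level c δ) (fun s => empMean X s ω) s a = S.simClass a ∩ S.G.neighborSet a :=
      fun s hs a ha => hreg.pruned_eq_of_dev_le hδ ha₀ hn1 hgap (by omega) (by omega) hΔle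
        (fun b s hs => (hdev b s ⟨by
          have : (t : ℝ) ≤ 2 * s + 1 := by exact_mod_cast (by omega : t ≤ 2 * s + 1)
          linarith, by omega⟩).le) hs ha
    have hU : ∀ a, |S.est (fun _ => α) (fun s => empMean X s ω) (fun s => Wt s ω) (t / 2 + 1) a -
        S.mean a₀| ≤ R / d := fun a => by
      refine (hrun.abs_est_sub_le_smooth (fun _ => h0.le) (fun _ => h1.le) hinit hmean ω _ a).trans
        ?_
      have hsm := smooth_le (α := fun _ => α) (y := fun s => S.absDev X s ω) (fun _ => h0.le)
        (fun _ => h1.le) (M := N * (S.devConst / d)) (by positivity) (fun s hs =>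
          (hreg.absDev_le hs).trans (by
            have := beta_jointLevel_le c hδ hs
            gcongr)) (t / 2 + 1)
      have hDd : D ≤ D / d := by
        rw [le_div_iff₀ hd0]
        exact mul_le_of_le_one_right hD hd1
      calc _ ≤ D / d + N * (S.devConst / d) := add_le_add hDd hsm
        _ = R / d := by rw [hR]; ring
    have hest := hrun.abs_est_const_sub_le h0.le ht2 hset (fun b hb => mean_eq_of_mem hb ha₀) hU
      ⟨a, ha⟩
    have hw1 := havg t ⟨htx, by omega⟩
    have hw2 := hresid ha t ⟨htx, by omega⟩
    have htrans : α ^ (t - (t / 2 + 1)) * (R / d) ≤ ε / 4 := by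
      have hp := mul_pow_half_le h0 h1 t
      have hdd : δ ≤ d := by
        rw [← hd4]
        exact pow_le_of_le_one hd0.le hd1 (by norm_num)
      have hxt : c₀ ≤ t * (ε ^ 4 * δ) := (div_le_iff₀ (by positivity)).1 htx.le
      rw [← mul_div_assoc, div_le_iff₀ hd0]
      refine le_of_mul_le_mul_left ?_ (mul_pos ht0 (pow_pos hε 3))
      calc (t : ℝ) * ε ^ 3 * (α ^ (t - (t / 2 + 1)) * R)
          = t * α ^ (t - (t / 2 + 1)) * R * ε ^ 3 := by ring
        _ ≤ 6 / (1 - α) * R * ε ^ 3 := by gcongr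
        _ ≤ c₀ / 4 := by linarith
        _ ≤ t * (ε ^ 4 * d) / 4 := by
            have : (t : ℝ) * (ε ^ 4 * δ) ≤ t * (ε ^ 4 * d) := by gcongr
            linarith
        _ = t * ε ^ 3 * (ε / 4 * d) := by ring
    rw [mean_eq_of_mem ha ha₀]
    refine lt_of_le_of_lt hest ?_
    linarith

end System

end ColME

open ColME ColME.System in
theorem theorem3 :
    (∃ C₀ : ℝ, 0 < C₀ ∧ ∀ (N : ℕ) (S : System N) (c : S.Component), Nondegenerate c →
      -- memory `t / (t + 1)`
      ((∃ ε₀ : ℝ, 0 < ε₀ ∧ ∀ ε δ : ℝ, 0 < ε → ε ≤ ε₀ → 0 < δ → δ < 1 →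
          AccurateAfter.{u} c (fun t => (t : ℝ) / (t + 1)) ε δ (S.tau C₀ ε δ)) ∧
        (∃ C : ℝ, 0 < C ∧ ∀ ε δ : ℝ, 0 < ε → 0 < δ → δ < 1 →
          AccurateAfter.{u} c (fun t => (t : ℝ) / (t + 1)) ε δ (S.tau C ε δ))) ∧
      -- constant memory
      (∀ α : ℝ, 0 < α → α < 1 →
        (∃ ε₀ : ℝ, 0 < ε₀ ∧ ∀ ε δ : ℝ, 0 < ε → ε ≤ ε₀ → 0 < δ → δ < 1 →
          AccurateAfter.{u} c (fun _ => α) ε δ (S.tauConst α C₀ ε δ)) ∧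
        (∃ C : ℝ, 0 < C ∧ ∀ ε δ : ℝ, 0 < ε → 0 < δ → δ < 1 →
          AccurateAfter.{u} c (fun _ => α) ε δ (S.tauConst α C ε δ)))) ∧
    -- order of the averaging time
    (∀ C : ℝ, 0 < C → ∃ M : ℝ, 0 < M ∧
      ∀ (N : ℕ) (S : System N) (c : S.Component) (ε δ : ℝ), 0 < ε → 0 < δ → δ < 1 →
        avgTime c C ε δ ≤ M * ((S.nTilde ε δ : ℝ) / size c) *
          (1 + |Real.log ((S.nTilde ε δ : ℝ) / size c)|) ^ 2) := by
  refine ⟨⟨1000000, by norm_num, fun N S c hc => ⟨?_, fun α h0 h1 => ?_⟩⟩, fun C hC =>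
    ⟨4 * C * (1 + |Real.log C|) ^ 2, by positivity, fun N S c ε δ hε hδ _ =>
      avgTime_le hC c hε hδ⟩⟩
  · have hn : (1 : ℝ) ≤ size c := by exact_mod_cast one_le_size c
    have hq : 0 < avgMoment c / size c := div_pos (avgMoment_pos hc) (by linarith)
    have small := accurateAfter_average_small.{u} hc
    refine ⟨small, exists_const_of_small_of_large (by norm_num) hq
      (fun C ε δ a ha => tau_eq ha C ε δ) (fun x y => g_mono) small
      (accurateAfter_large (fun t => by positivity) (fun t => ?_) forgetsAtRate_average hq
        (fun C ε δ a ha => tau_eq ha C ε δ) fun x _ => le_max_one_g x)⟩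
    rw [div_le_one (by positivity)]
    linarith
  · have hn : (1 : ℝ) ≤ size c := by exact_mod_cast one_le_size c
    have hq : 0 < fullMoment c / size c * constFactor c α :=
      mul_pos (div_pos (fullMoment_pos hc) (by linarith)) (constFactor_pos c h0 h1)
    have small := accurateAfter_const_small.{u} hc h0 h1
    exact ⟨small, exists_const_of_small_of_large (T := fun x => x) (by norm_num) hq
      (fun C ε δ a ha => tauConst_eq ha α C ε δ) (fun x y _ h => h) small
      (accurateAfter_large (T := fun x => x) (fun _ => h0.le) (fun _ => h1.le)
        (forgetsAtRate_const h0 h1) hq (fun C ε δ a ha => tauConst_eq ha α C ε δ)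
        fun x _ => le_max_right 1 x)⟩
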